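/- Definitions. For $p=(p_1,\dots,p_n)\in[0,1]^n$ let $\mathbf P_p$ (an $n$-PBD) be the law of $\sum_i X_i$ for independent Bernoulli variables $X_i$ with $\Pr[X_i=1]=p_i$. For $0<\epsilon\le 1/4$ and a variance $V\ge 0$ let $R=\min\{1/4,\sqrt{\ln(1/\epsilon)/V}\}$ ($R=1/4$ if $V=0$) and $B_i=R^{2^i}$. For an integer $\ell\ge0$ let $I_0=[B_0,1/2]$, $I_{i+1}=[B_{i+1},B_i)$ for $0\le i<\ell$, $I_{\ell+1}=(0,B_\ell)$, $J_0=(1/2,1-B_0]$, $J_{i+1}=(1-B_i,1-B_{i+1}]$ for $0\le i<\ell$, $J_{\ell+1}=(1-B_\ell,1]$. Lemma. For every $A\in\mathbb N$ there are a constant $C\in\mathbb N$ and a word-RAM program, both depending only on $A$, such that the following holds for all $n\in\mathbb N$, all $\epsilon\in(0,1/4]$, every $n$-PBD $\mathbf P$ with $\mathrm{Var}[\mathbf P]\le(1/\epsilon)^A$, and all natural numbers $\tilde\mu,s$ with $|\mathbb E[\mathbf P]-\tilde\mu|\le\sqrt s$ and $(\mathrm{Var}[\mathbf P]+1)/2\le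 s\le 2(\mathrm{Var}[\mathbf P]+1)$. There are an integer $0\le\ell\le C\ln\ln(1/\epsilon)$ with $\epsilon^C\le B_\ell\le\epsilon$ (where $B_i,I_i,J_i$ are formed with $V=\mathrm{Var}[\mathbf P]$) and a finite set $\mathcal M$ of finite multisets of triples $(m_i,a_i,b_i)_{1\le i\le k}$, $m_i\in\mathbb N$, such that: (i) for each element of $\mathcal M$ and each of its triples, $a_i,b_i$ are the end points of one of the intervals $I_0,\dots,I_{\ell+1},J_0,\dots,J_{\ell+1},[0,0],[1,1]$; (ii) each element of $\mathcal M$ consists of $k\le C\ln(1/\epsilon)$ triples; (iii) there are an element of $\mathcal M$ and an $n$-PBD $\mathbf Q$ with $d_{\mathrm{TV}}(\mathbf P,\mathbf Q)<\epsilon^2$, $\mathbb E[\mathbf Q]=\mathbb E[\mathbf P]$, $\mathrm{Var}[\mathbf P]-\epsilon^3\le\mathrm{Var}[\mathbf Q]\le\mathrm{Var}[\mathbf P]$ such that: for $0\le i\le\ell$, each of $I_i$ and $J_i$ contains at most $C\ln(1/\epsilon)/\ln(1/B_i)$ distinct parameters of $\mathbf Q$ and at most $2\mathrm{Var}[\mathbf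 P]/B_i$ parameters of $\mathbf Q$; each of $I_{\ell+1}$ and $J_{\ell+1}\setminus\{1\}$ contains at most one parameter of $\mathbf Q$; the number of parameters of $\mathbf Q$ equal to $1$ differs from $\mathbb E[\mathbf P]$ by at most $(1/\epsilon)^C$; and the distinct parameters of $\mathbf Q$ correspond one-to-one to the triples of the element of $\mathcal M$, where the parameter that corresponds to $(m_i,a_i,b_i)$ has multiplicity exactly $m_i$ and lies in an interval from (i) with end points $a_i,b_i$; (iv) $|\mathcal M|\le(1/\epsilon)^{C\ln\ln(1/\epsilon)}$, and for every word size $w$ with $2^w\ge(n+\lceil1/\epsilon\rceil)^C$ the program, on input $(n,\lceil1/\epsilon\rceil,\tilde\mu,s)$, halts within $C|\mathcal M|^C$ steps and outputs $\ell$ followed by a list of all elements of $\mathcal M$, each exactly once, in which the pair $a_i,b_i$ of a triple is given by the name of its interval. -/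

import Mathlib

noncomputable section

namespace PoissonBinomial

open MeasureTheory ProbabilityTheory

/-! ### Poisson binomial distributions -/

/-- The `n`-PBD with parameters `p 0, …, p (n - 1)`: the law of the sum of `n` independent
Bernoulli variables, the `i`-th of which is `1` with probability `p i` and `0` otherwise. -/
def pbd {n : ℕ} (p : Fin n → unitInterval) : Measure ℕ :=
  (Measure.pi fun i => bernoulliMeasure (1 : ℕ) 0 (p i)).map (fun x => ∑ i, x i)

/-- Expectation of a distribution on `ℕ`. -/
def mean (P : Measure ℕ) : ℝ := ∫ k, (k : ℝ) ∂P

/-- Variance of a distribution on `ℕ`. -/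
def var (P : Measure ℕ) : ℝ := variance (fun k : ℕ => (k : ℝ)) P

/-- Total variation distance of two (probability) distributions on `ℕ`. -/
def dTV (P Q : Measure ℕ) : ℝ := ⨆ S : Set ℕ, |P.real S - Q.real S|

/-! ### The partition of the parameter range into intervals

`ε` is the accuracy, `V` the variance of the given PBD, `ℓ` the depth of the partition. -/

/-- `R = min {1/4, √(ln (1/ε) / V)}`, where the square root is `+∞` for `V = 0`. -/
def R (ε V : ℝ) : ℝ := if V = 0 then 1 / 4 else min (1 / 4) √(Real.log (1 / ε) / V)

/-- `B i = R ^ (2 ^ i)`. -/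
def B (ε V : ℝ) (i : ℕ) : ℝ := R ε V ^ 2 ^ i

/-- Names of the intervals that occur in triples: `[0,0]`, `[1,1]`, and `I i`, `J i` for
`0 ≤ i ≤ ℓ + 1`. -/
inductive IntervalName (ℓ : ℕ) : Type
  | zero : IntervalName ℓ
  | one : IntervalName ℓ
  | I (i : Fin (ℓ + 2)) : IntervalName ℓ
  | J (i : Fin (ℓ + 2)) : IntervalName ℓ

/-- Left end of `I i`: it is `B i` for `i ≤ ℓ`, and `0` for `i = ℓ + 1`. -/
def leftEnd (ε V : ℝ) (ℓ i : ℕ) : ℝ := if i ≤ ℓ then B ε V i else 0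

/-- Right end of `I i`: it is `1/2` for `i = 0`, and `B (i - 1)` for `i ≥ 1`. -/
def rightEnd (ε V : ℝ) (i : ℕ) : ℝ := if i = 0 then 1 / 2 else B ε V (i - 1)

namespace IntervalName

variable {ℓ : ℕ}

/-- The left end point `a` of the interval. -/
def low (ε V : ℝ) : IntervalName ℓ → ℝ
  | zero => 0
  | one => 1
  | I i => leftEnd ε V ℓ i
  | J i => 1 - rightEnd ε V i

/-- The right end point `b` of the interval. -/
def high (ε V : ℝ) : IntervalName ℓ → ℝ
  | zero => 0
  | one => 1
  | I i => rightEnd ε V i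
  | J i => 1 - leftEnd ε V ℓ i

/-- The interval itself. `I 0 = [B 0, 1/2]`, `I (i+1) = [B (i+1), B i)` for `i < ℓ`,
`I (ℓ+1) = (0, B ℓ)`, `J 0 = (1/2, 1 - B 0]`, `J (i+1) = (1 - B i, 1 - B (i+1)]` for `i < ℓ`,
`J (ℓ+1) = (1 - B ℓ, 1]`. -/
def set (ε V : ℝ) : IntervalName ℓ → Set ℝ
  | zero => {0}
  | one => {1}
  | I i =>
    if (i : ℕ) = 0 then Set.Icc (leftEnd ε V ℓ i) (rightEnd ε V i)
    else if (i : ℕ) ≤ ℓ then Set.Ico (leftEnd ε V ℓ i) (rightEnd ε V i)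
    else Set.Ioo (leftEnd ε V ℓ i) (rightEnd ε V i)
  | J i => Set.Ioc (1 - rightEnd ε V i) (1 - leftEnd ε V ℓ i)

/-- The integer by which a program names the interval. -/
def code : IntervalName ℓ → ℕ
  | zero => 0
  | one => 1
  | I i => 2 * i + 2
  | J i => 2 * i + 3

end IntervalName

/-- Number of parameters of `q` in `S`, counted with multiplicity. -/
def numParams {n : ℕ} (q : Fin n → unitInterval) (S : Set ℝ) : ℕ := {j | (q j : ℝ) ∈ S}.ncard

/-- Number of distinct parameters of `q` in `S`. -/
def numDistinct {n : ℕ} (q : Fin n → unitInterval) (S : Set ℝ) : ℕ :=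
  (Set.range (fun j => (q j : ℝ)) ∩ S).ncard

/-- The admissible depths: `ℓ = O(log log (1/ε))` and `B ℓ = poly(ε)`. -/
structure IsDepth (C : ℕ) (ε V : ℝ) (ℓ : ℕ) : Prop where
  depth_le : (ℓ : ℝ) ≤ C * Real.log (Real.log (1 / ε))
  le_B : ε ^ C ≤ B ε V ℓ
  B_le : B ε V ℓ ≤ ε

/-- The PBD with parameters `q` is a structured approximation of the PBD with parameters `p`:
close in total variation, same mean, almost the same variance, and only few parameters and few
distinct parameters in each interval of the partition. All implied constants are `C`. -/
structure IsStructuredApprox {n : ℕ} (C : ℕ) (ε : ℝ) (ℓ : ℕ) (p q : Fin n → unitInterval) :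
    Prop where
  dTV_le : dTV (pbd p) (pbd q) ≤ ε
  mean_eq : mean (pbd q) = mean (pbd p)
  var_ge : var (pbd p) - ε ^ 3 ≤ var (pbd q)
  var_le : var (pbd q) ≤ var (pbd p)
  distinct_I : ∀ i : Fin (ℓ + 2), (i : ℕ) ≤ ℓ →
    (numDistinct q ((IntervalName.I i).set ε (var (pbd p))) : ℝ) ≤
      C * (Real.log (1 / ε) / Real.log (1 / B ε (var (pbd p)) i))
  distinct_J : ∀ i : Fin (ℓ + 2), (i : ℕ) ≤ ℓ →
    (numDistinct q ((IntervalName.J i).set ε (var (pbd p))) : ℝ) ≤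
      C * (Real.log (1 / ε) / Real.log (1 / B ε (var (pbd p)) i))
  last_I : numParams q ((IntervalName.I (Fin.last (ℓ + 1))).set ε (var (pbd p))) ≤ 1
  last_J : numParams q ((IntervalName.J (Fin.last (ℓ + 1))).set ε (var (pbd p)) \ {1}) ≤ 1
  ones : |(numParams q {1} : ℝ) - mean (pbd p)| ≤ (1 / ε) ^ C
  count_I : ∀ i : Fin (ℓ + 2), (i : ℕ) ≤ ℓ →
    (numParams q ((IntervalName.I i).set ε (var (pbd p))) : ℝ) ≤
      2 * var (pbd p) / B ε (var (pbd p)) i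
  count_J : ∀ i : Fin (ℓ + 2), (i : ℕ) ≤ ℓ →
    (numParams q ((IntervalName.J i).set ε (var (pbd p))) : ℝ) ≤
      2 * var (pbd p) / B ε (var (pbd p)) i

/-- A multiset of triples `(m, a, b)` describes the parameters `q` if its elements correspond
one-to-one to the distinct parameters of `q`: the triple `(m, a, b)` that corresponds to the
parameter `v` consists of the multiplicity `m` of `v` and the end points `a`, `b` of an interval
that contains `v`. -/
def Describes {n : ℕ} (ε V : ℝ) (ℓ : ℕ) (S : Multiset (ℕ × ℝ × ℝ)) (q : Fin n → unitInterval) :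
    Prop :=
  ∃ f : unitInterval → IntervalName ℓ,
    (∀ j, (q j : ℝ) ∈ (f (q j)).set ε V) ∧
    S = (Finset.univ.image q).val.map
      (fun v => ({j | q j = v}.ncard, (f v).low ε V, (f v).high ε V))

/-! ### A word RAM

Finitely many registers (those that a program mentions) and a memory of addressable cells, all
holding words of `w` bits; a write-only output. Programs are built from unit-cost instructions by
sequencing, branching and loops. -/

/-- Binary instructions on words. -/
inductive BinOp
  | add | sub | mul | div | mod | lt | eq

/-- Value of an instruction, before reduction to word size (`sub` is truncated at `0`). -/
def BinOp.apply : BinOp → ℕ → ℕ → ℕ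
  | add, a, b => a + b
  | sub, a, b => a - b
  | mul, a, b => a * b
  | div, a, b => a / b
  | mod, a, b => a % b
  | lt, a, b => if a < b then 1 else 0
  | eq, a, b => if a = b then 1 else 0

/-- Programs; `x y z` are register numbers. -/
inductive Program
  /-- `x := c` -/
  | const (x c : ℕ)
  /-- `x := y o z` -/
  | op (o : BinOp) (x y z : ℕ)
  /-- `x := mem[y]` -/
  | load (x y : ℕ)
  /-- `mem[x] := y` -/
  | store (x y : ℕ)
  /-- append the contents of `x` to the output -/
  | emit (x : ℕ)
  /-- first `c`, then `d` -/
  | seq (c d : Program)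
  /-- if `x ≠ 0` then `c` else `d` -/
  | ite (x : ℕ) (c d : Program)
  /-- while `x ≠ 0` do `c` -/
  | loop (x : ℕ) (c : Program)

/-- Registers, memory, and the output so far. -/
structure State where
  reg : ℕ → ℕ
  mem : ℕ → ℕ
  out : List ℕ

/-- The start: the input words are in registers `0, 1, …`, all else is `0` or empty. -/
def State.init (input : List ℕ) : State := ⟨fun i => input.getD i 0, fun _ => 0, []⟩

/-- `Run w c s s' t`: with word size `w`, program `c` started in state `s` halts in state `s'`
after exactly `t` steps. Every instruction and every test takes one step; results are reduced
modulo `2 ^ w`. -/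
inductive Run (w : ℕ) : Program → State → State → ℕ → Prop
  | const (x c : ℕ) (s : State) :
      Run w (.const x c) s { s with reg := Function.update s.reg x (c % 2 ^ w) } 1
  | op (o : BinOp) (x y z : ℕ) (s : State) :
      Run w (.op o x y z) s
        { s with reg := Function.update s.reg x (o.apply (s.reg y) (s.reg z) % 2 ^ w) } 1
  | load (x y : ℕ) (s : State) :
      Run w (.load x y) s { s with reg := Function.update s.reg x (s.mem (s.reg y)) } 1
  | store (x y : ℕ) (s : State) :
      Run w (.store x y) s { s with mem := Function.update s.mem (s.reg x) (s.reg y) } 1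
  | emit (x : ℕ) (s : State) :
      Run w (.emit x) s { s with out := s.out ++ [s.reg x] } 1
  | seq {c d : Program} {s s' s'' : State} {t t' : ℕ} :
      Run w c s s' t → Run w d s' s'' t' → Run w (.seq c d) s s'' (t + t')
  | ite_true {x : ℕ} {c d : Program} {s s' : State} {t : ℕ} :
      s.reg x ≠ 0 → Run w c s s' t → Run w (.ite x c d) s s' (t + 1)
  | ite_false {x : ℕ} {c d : Program} {s s' : State} {t : ℕ} :
      s.reg x = 0 → Run w d s s' t → Run w (.ite x c d) s s' (t + 1)
  | loop_true {x : ℕ} {c : Program} {s s' s'' : State} {t t' : ℕ} :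
      s.reg x ≠ 0 → Run w c s s' t → Run w (.loop x c) s' s'' t' →
      Run w (.loop x c) s s'' (t + t' + 1)
  | loop_false {x : ℕ} {c : Program} {s : State} :
      s.reg x = 0 → Run w (.loop x c) s s 1

/-! ### Listing multisets of triples -/

/-- The multiset of triples `(m, a, b)` given by a list of pairs (multiplicity, interval name). -/
def toTriples (ε V : ℝ) {ℓ : ℕ} (l : List (ℕ × IntervalName ℓ)) : Multiset (ℕ × ℝ × ℝ) :=
  (l.map fun x => (x.1, x.2.low ε V, x.2.high ε V) : List (ℕ × ℝ × ℝ))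

/-- The words that represent one list of pairs: its length, followed by its entries. -/
def encode {ℓ : ℕ} (l : List (ℕ × IntervalName ℓ)) : List ℕ :=
  l.length :: l.flatMap fun x => [x.1, x.2.code]

/-- On the given input, with word size `w`, the program lists the set `M` within `T` steps: it
halts, and its output is `ℓ` followed by representations of the elements of `M`, each element
being listed exactly once. -/
def Enumerates (prog : Program) (w : ℕ) (input : List ℕ) (ε V : ℝ) (ℓ : ℕ)
    (M : Finset (Multiset (ℕ × ℝ × ℝ))) (T : ℕ) : Prop :=
  ∃ (L : List (List (ℕ × IntervalName ℓ))) (s : State) (t : ℕ),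
    M.val = ((L.map (toTriples ε V) : List (Multiset (ℕ × ℝ × ℝ))) :
      Multiset (Multiset (ℕ × ℝ × ℝ))) ∧
    Run w prog (State.init input) s t ∧ t ≤ T ∧ s.out = ℓ :: L.flatMap encode

end PoissonBinomial

end

open PoissonBinomial

namespace PoissonBinomial
open MeasureTheory ProbabilityTheory

/-! ### Moments and characteristic function of a Poisson binomial distribution -/

/-! The approximation matches moments. Fold all parameters at `1/2` and let a cell consist of the
parameters on one side of `1/2` in one interval of the partition. Within a cell the points can be
moved, keeping their first `k` power sums, until at most `k` distinct values lie strictly between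
the end points: a minimiser of the next power sum has this property by Lagrange multipliers
(`exists_few_distinct`). In the last cell on each side only the sum is kept, and the points are
spread until at most one lies strictly inside (`exists_le_one_inside`). The mean is then unchanged,
and the variance drops by at most `2 * B ℓ * V`.

Total variation is bounded by the largest difference of the characteristic functions times the
length of a Chebyshev window, plus the mass outside the window (`dTV_pbd_le`). As `V` is polynomial
in `1/ε`, it suffices that the characteristic functions differ by a high power of `ε`. They are
products over the cells. Write `z = exp (iξ) - 1`. If a cell has right end `b` and keeps `k` power
sums, the logarithms of its two products agree up to order `(b * ‖z‖) ^ k`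
(`norm_prod_sub_prod_le_of_small`). For the interval with left end `B (i + 1)` the right end is `b =
B i`, the square root of `B (i + 1)`, so about `log (1/ε) / log (1 / B (i + 1))` power sums are
enough. For the first interval `b = 1/2` gains nothing by itself, and this is where `R` enters:
beyond a constant multiple of `R` both characteristic functions are tiny because of the variance
(`norm_cf_le`), and below it `‖z‖` is of order `R = B 0`. If `R` exceeds a positive constant, then
`V` is `O(log (1/ε))` and Newton's identities give the comparison at all frequencies
(`norm_prod_sub_prod_le_of_sum`).

For the enumeration, the multiplicities that belong to one interval name are listed in increasing
order and encoded by their differences, which become digits of one mixed radix number. Different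
numbers give different multisets (`config_injOn`), and every multiset that is needed occurs
(`exists_describes_blocks`). All digit strings are admitted, even those that describe nothing, so
the size of the set is exactly the product of the radices and a counter in memory runs through it
(`enumProg_ends`).

The program knows `V` only through the integer `s`. With `N = ⌈1/ε⌉` it uses `b = 4 + s / log₂ N`,
which satisfies `1 / R ≤ b ≤ 1 / R ^ 4`. Hence `b ^ 2 ^ i`, obtained by repeated squaring, is `1 / B
i` up to a constant factor in the exponent, and depth, radices and numbers of positions come from
integer arithmetic. The digits of one level take `O(log N)` bits, apart from `O(log log N)` bits per
position that account for the size of `V`. There are `O(log log N)` levels and `O(log N)` positions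
altogether, whence the bound for the size of the set (`numConfigs_allBlocks_le`). -/

instance isProbabilityMeasure_pbd {n : ℕ} (p : Fin n → unitInterval) :
    IsProbabilityMeasure (pbd p) :=
  Measure.isProbabilityMeasure_map (by fun_prop)

theorem integral_pbd {n : ℕ} (p : Fin n → unitInterval) {E : Type*} [NormedAddCommGroup E]
    [NormedSpace ℝ E] (f : ℕ → E) :
    ∫ k, f k ∂(pbd p) =
      ∫ x, f (∑ i, x i) ∂(Measure.pi fun i => bernoulliMeasure (1 : ℕ) 0 (p i)) := by
  rw [pbd, integral_map (by fun_prop)]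
  exact (StronglyMeasurable.of_discrete).aestronglyMeasurable

theorem memLp_bernoulliMeasure (q : unitInterval) :
    MemLp (fun k : ℕ => (k : ℝ)) 2 (bernoulliMeasure (1 : ℕ) 0 q) := by
  rw [memLp_two_iff_integrable_sq (by fun_prop)]
  exact integrable_bernoulliMeasure _ _ _ _

theorem mean_pbd {n : ℕ} (p : Fin n → unitInterval) : mean (pbd p) = ∑ i, (p i : ℝ) := by
  rw [mean, integral_pbd]
  push_cast
  rw [integral_finsetSum]
  · refine Finset.sum_congr rfl fun i _ => ?_
    rw [integral_comp_eval (μ := fun i => bernoulliMeasure (1 : ℕ) 0 (p i))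
      (f := fun k : ℕ => (k : ℝ)) (by fun_prop), integral_bernoulliMeasure]
    simp
  · intro i _
    exact integrable_comp_eval (μ := fun i => bernoulliMeasure (1 : ℕ) 0 (p i))
      (f := fun k : ℕ => (k : ℝ)) (integrable_bernoulliMeasure _ _ _ _)

theorem variance_bernoulli (q : unitInterval) :
    variance (fun k : ℕ => (k : ℝ)) (bernoulliMeasure (1 : ℕ) 0 q) = q * (1 - q) := by
  rw [variance_eq_sub (memLp_bernoulliMeasure q)]
  simp only [Pi.pow_apply, integral_bernoulliMeasure]
  simp
  ring

theorem var_pbd {n : ℕ} (p : Fin n → unitInterval) :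
    var (pbd p) = ∑ i, (p i : ℝ) * (1 - p i) := by
  rw [var, pbd, variance_map (by fun_prop) (by fun_prop)]
  have := variance_sum_pi (μ := fun i => bernoulliMeasure (1 : ℕ) 0 (p i))
    (X := fun _ k => (k : ℝ)) (fun i => memLp_bernoulliMeasure (p i))
  simp only [variance_bernoulli] at this
  rw [← this]
  congr 1
  ext x
  simp

theorem var_nonneg {n : ℕ} (p : Fin n → unitInterval) : 0 ≤ var (pbd p) := variance_nonneg _ _

theorem memLp_pbd {n : ℕ} (p : Fin n → unitInterval) :
    MemLp (fun k : ℕ => (k : ℝ)) 2 (pbd p) := by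
  rw [pbd, memLp_map_measure_iff (by fun_prop) (by fun_prop)]
  have : (fun k : ℕ => (k : ℝ)) ∘ (fun x : Fin n → ℕ => ∑ i, x i) = 
      fun x => ∑ i, (fun k : ℕ => (k : ℝ)) (x i) := by ext; simp
  rw [this]
  refine memLp_finsetSum _ fun i _ => ?_
  exact (memLp_bernoulliMeasure (p i)).comp_measurePreserving
    (measurePreserving_eval (fun i => bernoulliMeasure (1 : ℕ) 0 (p i)) i)

/-- The characteristic function of `pbd p`, as a product. -/
noncomputable def cf {n : ℕ} (p : Fin n → unitInterval) (ξ : ℝ) : ℂ :=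
  ∏ i, (1 + (p i : ℝ) * (Complex.exp (ξ * Complex.I) - 1))

theorem integral_exp_pbd {n : ℕ} (p : Fin n → unitInterval) (ξ : ℝ) :
    ∫ k : ℕ, Complex.exp (ξ * Complex.I * k) ∂(pbd p) = cf p ξ := by
  rw [integral_pbd]
  have : ∀ x : Fin n → ℕ, Complex.exp (ξ * Complex.I * (∑ i, x i : ℕ)) =
      ∏ i, (fun k : ℕ => Complex.exp (ξ * Complex.I * k)) (x i) := by
    intro x
    rw [← Complex.exp_sum, ← Finset.mul_sum]
    push_cast
    rfl
  simp_rw [this]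
  rw [integral_fintype_prod_eq_prod (fun _ (k : ℕ) => Complex.exp (ξ * Complex.I * k)), cf]
  refine Finset.prod_congr rfl fun i _ => ?_
  rw [integral_bernoulliMeasure]
  simp
  ring

/-- Orthogonality of characters. -/
theorem integral_exp_int (m : ℤ) :
    ∫ ξ in (-Real.pi)..Real.pi, Complex.exp (ξ * Complex.I * m) =
      if m = 0 then ((2 * Real.pi : ℝ) : ℂ) else 0 := by
  split_ifs with h
  · subst h
    simp
    ring
  · have hc : (Complex.I * m : ℂ) ≠ 0 := by simp [h]
    have : ∀ ξ : ℝ, Complex.exp (ξ * Complex.I * m) = Complex.exp ((Complex.I * m) * ξ) := by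
      intro ξ; ring_nf
    simp_rw [this]
    rw [integral_exp_mul_complex hc, div_eq_zero_iff]
    left
    rw [sub_eq_zero, Complex.exp_eq_exp_iff_exists_int]
    exact ⟨m, by push_cast; ring⟩

/-- Fourier inversion: once the characteristic function is written as an integral over `k`, Fubini
and the orthogonality of characters leave only `k = j`. -/
theorem pbd_real_singleton {n : ℕ} (p : Fin n → unitInterval) (j : ℕ) :
    ((2 * Real.pi : ℝ) : ℂ) * ((pbd p).real {j} : ℂ) =
      ∫ ξ in (-Real.pi)..Real.pi, Complex.exp (-(ξ * Complex.I * j)) * cf p ξ := by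
  have h1 : ∀ ξ : ℝ, Complex.exp (-(ξ * Complex.I * j)) * cf p ξ =
      ∫ k : ℕ, Complex.exp (ξ * Complex.I * ((k : ℤ) - (j : ℤ) : ℤ)) ∂(pbd p) := by
    intro ξ
    rw [← integral_exp_pbd, ← integral_const_mul]
    congr 1
    ext k
    rw [← Complex.exp_add]
    congr 1
    push_cast
    ring
  simp_rw [h1]
  rw [intervalIntegral.integral_of_le (by linarith [Real.pi_pos]), integral_integral_swap]
  · simp_rw [← intervalIntegral.integral_of_le (show -Real.pi ≤ Real.pi by linarith [Real.pi_pos]),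
      integral_exp_int]
    have : ∀ k : ℕ, (if (k : ℤ) - (j : ℤ) = 0 then ((2 * Real.pi : ℝ) : ℂ) else 0) =
        Set.indicator {j} (fun _ => ((2 * Real.pi : ℝ) : ℂ)) k := by
      intro k
      by_cases h : k = j <;> simp [h, sub_eq_zero]
    simp_rw [this]
    rw [integral_indicator (measurableSet_singleton j), setIntegral_const, mul_comm]
    simp
  · refine Integrable.of_bound (C := 1) ?_ ?_
    · refine Measurable.aestronglyMeasurable ?_
      refine measurable_from_prod_countable_left (fun k => ?_)
      simp only [Function.uncurry]
      fun_prop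
    · refine Filter.Eventually.of_forall fun x => ?_
      simp only [Function.uncurry]
      rw [show (x.1 : ℂ) * Complex.I * (((x.2 : ℤ) - (j : ℤ) : ℤ) : ℂ) =
        ((x.1 * (((x.2 : ℤ) - (j : ℤ) : ℤ) : ℝ) : ℝ) : ℂ) * Complex.I by push_cast; ring,
        Complex.norm_exp_ofReal_mul_I]

theorem continuous_cf {n : ℕ} (p : Fin n → unitInterval) : Continuous (cf p) := by
  unfold cf
  fun_prop

theorem abs_pbd_singleton_sub_le {n : ℕ} (p q : Fin n → unitInterval) (η : ℝ)
    (h : ∀ ξ : ℝ, |ξ| ≤ Real.pi → ‖cf p ξ - cf q ξ‖ ≤ η) (j : ℕ) :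
    |(pbd p).real {j} - (pbd q).real {j}| ≤ η := by
  have hpi := Real.pi_pos
  have h2 : ((2 * Real.pi : ℝ) : ℂ) * (((pbd p).real {j} - (pbd q).real {j} : ℝ) : ℂ) =
      ∫ ξ in (-Real.pi)..Real.pi, Complex.exp (-(ξ * Complex.I * j)) * (cf p ξ - cf q ξ) := by
    push_cast
    rw [mul_sub]
    have := pbd_real_singleton p j
    have h' := pbd_real_singleton q j
    push_cast at this h'
    rw [this, h', ← intervalIntegral.integral_sub]
    · congr 1; ext ξ; ring
    · have := continuous_cf p
      exact Continuous.intervalIntegrable (by fun_prop) _ _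
    · have := continuous_cf q
      exact Continuous.intervalIntegrable (by fun_prop) _ _
  have h3 := intervalIntegral.norm_integral_le_of_norm_le_const (a := -Real.pi) (b := Real.pi)
    (f := fun ξ : ℝ => Complex.exp (-(ξ * Complex.I * j)) * (cf p ξ - cf q ξ)) (C := η) (by
      intro ξ hξ
      rw [Set.uIoc_of_le (by linarith)] at hξ
      rw [norm_mul, show -((ξ : ℂ) * Complex.I * j) = ((-(ξ * j) : ℝ) : ℂ) * Complex.I by
        push_cast; ring, Complex.norm_exp_ofReal_mul_I, one_mul]
      exact h ξ (abs_le.2 ⟨hξ.1.le, hξ.2⟩))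
  rw [← h2, norm_mul, Complex.norm_real, Complex.norm_real, Real.norm_eq_abs, Real.norm_eq_abs,
    abs_of_pos (by positivity : 0 < 2 * Real.pi), sub_neg_eq_add,
    abs_of_pos (by positivity : 0 < Real.pi + Real.pi)] at h3
  nlinarith

/-- Total variation distance through the characteristic functions and Chebyshev's inequality. -/
theorem dTV_pbd_le {n : ℕ} (p q : Fin n → unitInterval) (η T : ℝ) (hT : 0 < T)
    (h : ∀ ξ : ℝ, |ξ| ≤ Real.pi → ‖cf p ξ - cf q ξ‖ ≤ η)
    (hm : mean (pbd q) = mean (pbd p)) (hv : var (pbd q) ≤ var (pbd p)) :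
    dTV (pbd p) (pbd q) ≤ (2 * T + 1) * η + 2 * (var (pbd p) / T ^ 2) := by
  classical
  have hη : 0 ≤ η := (norm_nonneg _).trans (h 0 (by simpa using Real.pi_pos.le))
  set m := mean (pbd p) with hmdef
  -- The integer window is taken in `ℤ`, since `m - T` may be negative, and then pulled back to `ℕ`.
  set W : Finset ℕ := (Finset.Icc ⌈m - T⌉ ⌊m + T⌋).preimage (fun k : ℕ => (k : ℤ))
    (Nat.cast_injective.injOn) with hW
  have hcard : (W.card : ℝ) ≤ 2 * T + 1 := by
    have h1 : W.card ≤ (Finset.Icc ⌈m - T⌉ ⌊m + T⌋).card := by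
      rw [← Finset.card_image_of_injective W (f := fun k : ℕ => (k : ℤ)) Nat.cast_injective]
      refine Finset.card_le_card ?_
      rw [Finset.image_subset_iff]
      intro x hx
      exact (Finset.mem_preimage.1 hx)
    rw [Int.card_Icc] at h1
    have h2 : ((⌊m + T⌋ + 1 - ⌈m - T⌉).toNat : ℝ) ≤ 2 * T + 1 := by
      rcases le_total 0 (⌊m + T⌋ + 1 - ⌈m - T⌉) with h0 | h0
      · have : ((⌊m + T⌋ + 1 - ⌈m - T⌉).toNat : ℝ) = ((⌊m + T⌋ + 1 - ⌈m - T⌉ : ℤ) : ℝ) := by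
          exact_mod_cast congrArg (fun z : ℤ => (z : ℝ)) (Int.toNat_of_nonneg h0)
        rw [this]
        push_cast
        linarith [Int.floor_le (m + T), Int.le_ceil (m - T)]
      · rw [Int.toNat_of_nonpos h0]; simp; positivity
    exact (Nat.cast_le.2 h1).trans h2
  -- Chebyshev. The two distributions share the mean `m` and the variance bound, so one window
  -- serves both.
  have htail : ∀ r : Fin n → unitInterval, mean (pbd r) = m → var (pbd r) ≤ var (pbd p) →
      (pbd r).real (↑W)ᶜ ≤ var (pbd p) / T ^ 2 := by
    intro r hr1 hr2
    have h1 := meas_ge_le_variance_div_sq (memLp_pbd r) hT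
    have h2 : ((↑W : Set ℕ)ᶜ) ⊆ {ω : ℕ | T ≤ |(ω : ℝ) - ∫ x : ℕ, (x : ℝ) ∂(pbd r)|} := by
      intro k hk
      simp only [Set.mem_ofPred_eq]
      have hk' : ¬ (⌈m - T⌉ ≤ (k : ℤ) ∧ (k : ℤ) ≤ ⌊m + T⌋) := by
        intro h'
        apply hk
        rw [hW, Finset.mem_coe, Finset.mem_preimage, Finset.mem_Icc]
        exact h'
      rw [Int.ceil_le, Int.le_floor] at hk'
      change T ≤ |(k : ℝ) - mean (pbd r)|
      rw [hr1]
      by_contra hlt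
      rw [not_le, abs_lt] at hlt
      apply hk'
      push_cast
      constructor <;> linarith
    have h3 : (pbd r) ((↑W : Set ℕ)ᶜ) ≤ ENNReal.ofReal (var (pbd r) / T ^ 2) :=
      (measure_mono h2).trans h1
    rw [measureReal_def]
    refine (ENNReal.toReal_le_of_le_ofReal (div_nonneg (var_nonneg r) (sq_nonneg T)) h3).trans ?_
    gcongr
  have hV : 0 ≤ var (pbd p) / T ^ 2 := div_nonneg (var_nonneg p) (sq_nonneg T)
  refine ciSup_le fun S => ?_
  have hsplit : ∀ r : Fin n → unitInterval,
      (pbd r).real S = (∑ k ∈ W with k ∈ S, (pbd r).real {k}) + (pbd r).real (S \ ↑W) := by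
    intro r
    rw [← measureReal_inter_add_sdiff (μ := pbd r) (s := S) (t := ↑W) (Finset.measurableSet _)]
    congr 1
    rw [show S ∩ ↑W = ↑(W.filter (· ∈ S)) by ext; simp [and_comm], ← sum_measureReal_singleton]
  have hd : ∀ r : Fin n → unitInterval, mean (pbd r) = m → var (pbd r) ≤ var (pbd p) →
      0 ≤ (pbd r).real (S \ ↑W) ∧ (pbd r).real (S \ ↑W) ≤ var (pbd p) / T ^ 2 := fun r h1 h2 =>
    ⟨measureReal_nonneg, (measureReal_mono (fun x hx => hx.2)).trans (htail r h1 h2)⟩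
  have hp := hd p rfl le_rfl
  have hq := hd q hm hv
  have hsum : |(∑ k ∈ W with k ∈ S, (pbd p).real {k}) - ∑ k ∈ W with k ∈ S, (pbd q).real {k}| ≤
      (2 * T + 1) * η := by
    rw [← Finset.sum_sub_distrib]
    refine (Finset.abs_sum_le_sum_abs _ _).trans ?_
    refine (Finset.sum_le_card_nsmul _ _ η fun k _ => abs_pbd_singleton_sub_le p q η h k).trans ?_
    rw [nsmul_eq_mul]
    refine mul_le_mul_of_nonneg_right (le_trans ?_ hcard) hη
    exact_mod_cast Finset.card_filter_le _ _
  rw [hsplit p, hsplit q, abs_le] at *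
  constructor <;> linarith [hsum.1, hsum.2]

end PoissonBinomial

namespace PoissonBinomial

/-! ### Few distinct values with prescribed power sums -/

theorem hasStrictFDerivAt_sum_pow {ι : Type*} [Fintype ι] (m : ℕ) (y : ι → ℝ) :
    HasStrictFDerivAt (fun u : ι → ℝ => ∑ i, u i ^ m)
      (∑ i, ((m : ℝ) * y i ^ (m - 1)) • ContinuousLinearMap.proj (R := ℝ) (φ := fun _ : ι => ℝ) i)
      y := by
  refine HasStrictFDerivAt.fun_sum fun i _ => ?_
  have h := (ContinuousLinearMap.proj (R := ℝ) (φ := fun _ : ι => ℝ) i).hasStrictFDerivAt (x := y)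
  have h2 := h.pow m
  simpa [mul_comm] using h2

/-- A constrained extremum of a power sum, the lower power sums being prescribed, has few distinct
coordinates. -/
theorem card_image_le_of_isLocalMinOn {ι : Type*} [Fintype ι] (k : ℕ) (y : ι → ℝ)
    (h : IsLocalMinOn (fun u : ι → ℝ => ∑ i, u i ^ (k + 1))
      {u | ∀ l : Fin k, ∑ i, u i ^ ((l : ℕ) + 1) = ∑ i, y i ^ ((l : ℕ) + 1)} y) :
    (Finset.univ.image y).card ≤ k := by
  classical
  obtain ⟨Λ, Λ₀, hne, hsum⟩ := IsLocalExtrOn.exists_multipliers_of_hasStrictFDerivAt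
    (f := fun (l : Fin k) (u : ι → ℝ) => ∑ i, u i ^ ((l : ℕ) + 1)) (Or.inl h)
    (fun l => hasStrictFDerivAt_sum_pow _ y) (hasStrictFDerivAt_sum_pow _ y)
  -- In one coordinate `v`, the multiplier equation says that `v` is a root of the polynomial with
  -- coefficients `c`; the factors `l + 1` come from differentiating `v ^ (l + 1)`.
  set c : ℕ → ℝ := fun l => if h : l < k then Λ ⟨l, h⟩ * (l + 1) else Λ₀ * (k + 1) with hc
  set P : Polynomial ℝ := ∑ l ∈ Finset.range (k + 1), Polynomial.C (c l) * Polynomial.X ^ l with hP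
  have hcoef : ∀ l ≤ k, P.coeff l = c l := by
    intro l hl
    rw [hP, Polynomial.finsetSum_coeff]
    simp only [Polynomial.coeff_C_mul, Polynomial.coeff_X_pow]
    simp [Nat.lt_succ_of_le hl]
  have hP0 : P ≠ 0 := by
    intro h0
    apply hne
    have hz : ∀ l ≤ k, c l = 0 := fun l hl => by rw [← hcoef l hl, h0, Polynomial.coeff_zero]
    refine Prod.ext (funext fun l => ?_) ?_
    · have := hz l l.2.le
      simp only [hc, l.2, dif_pos] at this
      rcases mul_eq_zero.1 this with h | h
      · simpa using h
      · exact absurd h (by positivity)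
    · have := hz k le_rfl
      simp only [hc, lt_irrefl, dif_neg, not_false_iff] at this
      rcases mul_eq_zero.1 this with h | h
      · simpa using h
      · exact absurd h (by positivity)
  have hdeg : P.natDegree ≤ k := by
    refine Polynomial.natDegree_sum_le_of_forall_le _ _ fun l hl => ?_
    exact (Polynomial.natDegree_C_mul_X_pow_le _ _).trans (Nat.lt_succ_iff.1 (Finset.mem_range.1 hl))
  have hroot : ∀ i, P.IsRoot (y i) := by
    intro i
    have h1 := congrArg (fun T : (ι → ℝ) →L[ℝ] ℝ => T (Pi.single i 1)) hsum
    simp only [add_apply, sum_apply, smul_apply, ContinuousLinearMap.proj_apply, smul_eq_mul,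
      zero_apply] at h1
    simp only [Pi.single_apply, mul_ite, mul_one, mul_zero, Finset.sum_ite_eq', Finset.mem_univ,
      if_true, Nat.add_sub_cancel] at h1
    rw [Polynomial.IsRoot, hP, Polynomial.eval_finsetSum, Finset.sum_range_succ,
      ← Fin.sum_univ_eq_sum_range (fun l => Polynomial.eval (y i) (Polynomial.C (c l) * Polynomial.X ^ l)),
      ← h1]
    congr 1
    · refine Finset.sum_congr rfl fun l _ => ?_
      simp [hc, l.2]
      ring
    · simp [hc]
      ring
  calc (Finset.univ.image y).card ≤ P.roots.toFinset.card := by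
        refine Finset.card_le_card fun v hv => ?_
        obtain ⟨i, -, rfl⟩ := Finset.mem_image.1 hv
        rw [Multiset.mem_toFinset, Polynomial.mem_roots hP0]
        exact hroot i
    _ ≤ P.roots.card := Multiset.toFinset_card_le _
    _ ≤ P.natDegree := Polynomial.card_roots' _
    _ ≤ k := hdeg

/-- Points of an interval can be moved, keeping their first `k` power sums, so that there are at
most `k` distinct points inside. -/
theorem exists_few_distinct {ι : Type*} [Fintype ι] (k : ℕ) (a b : ℝ) (x : ι → ℝ)
    (hx : ∀ i, x i ∈ Set.Icc a b) :
    ∃ y : ι → ℝ, (∀ i, y i ∈ Set.Icc a b) ∧ (∀ l ≤ k, ∑ i, y i ^ l = ∑ i, x i ^ l) ∧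
      (Finset.univ.image y \ {a, b}).card ≤ k := by
  classical
  set S : Set (ι → ℝ) := {u | (∀ i, u i ∈ Set.Icc a b) ∧ ∀ l ≤ k, ∑ i, u i ^ l = ∑ i, x i ^ l}
    with hS
  have hcomp : IsCompact S := by
    have h1 : IsCompact (Set.pi Set.univ fun _ : ι => Set.Icc a b) :=
      isCompact_univ_pi fun _ => isCompact_Icc
    refine h1.of_isClosed_subset ?_ fun u hu i _ => hu.1 i
    have : S = (Set.pi Set.univ fun _ : ι => Set.Icc a b) ∩
        ⋂ l, ⋂ (_ : l ≤ k), {u : ι → ℝ | ∑ i, u i ^ l = ∑ i, x i ^ l} := by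
      ext u; simp [hS, Pi.le_def, forall_and]
    rw [this]
    refine h1.isClosed.inter (isClosed_iInter fun l => isClosed_iInter fun _ => ?_)
    exact isClosed_eq (by fun_prop) (by fun_prop)
  -- Minimise the first power sum that is not prescribed.
  obtain ⟨y, hyS, hymin⟩ := hcomp.exists_isMinOn ⟨x, hx, fun _ _ => rfl⟩
    (f := fun u : ι → ℝ => ∑ i, u i ^ (k + 1)) (by fun_prop)
  refine ⟨y, hyS.1, hyS.2, ?_⟩
  set U : Finset ι := Finset.univ.filter fun i => y i ∈ Set.Ioo a b with hU
  -- Coordinates at an end point are frozen. The others may vary in an open set, so that the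
  -- unconstrained form of the multiplier rule applies to them.
  set e : (U → ℝ) → ι → ℝ := fun u i => if h : i ∈ U then u ⟨i, h⟩ else y i with he
  have hesum : ∀ (u : U → ℝ) (l : ℕ),
      ∑ i, e u i ^ l = ∑ i : U, u i ^ l + ∑ i ∈ Uᶜ, y i ^ l := by
    intro u l
    rw [← Finset.sum_add_sum_compl U]
    congr 1
    · rw [← Finset.sum_coe_sort U]
      refine Finset.sum_congr rfl fun i _ => ?_
      simp [he]
    · refine Finset.sum_congr rfl fun i hi => ?_
      simp [he, Finset.mem_compl.1 hi]
  have hey : e (fun i => y i) = y := by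
    funext i; simp [he]
  have hloc := card_image_le_of_isLocalMinOn k (fun i : U => y i) (by
    have hopen : ∀ᶠ u : U → ℝ in nhds (fun i : U => y i), ∀ i, u i ∈ Set.Ioo a b := by
      rw [Filter.eventually_all]
      intro i
      have hi : y i ∈ Set.Ioo a b := (Finset.mem_filter.1 i.2).2
      exact (continuous_apply i).continuousAt.eventually (isOpen_Ioo.mem_nhds hi)
    filter_upwards [nhdsWithin_le_nhds hopen, self_mem_nhdsWithin] with u hu1 hu2
    have heu : e u ∈ S := by
      refine ⟨fun i => ?_, fun l hl => ?_⟩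
      · by_cases hi : i ∈ U
        · simp only [he, hi, dif_pos]; exact Set.Ioo_subset_Icc_self (hu1 _)
        · simp only [he, hi, dif_neg, not_false_iff]; exact hyS.1 i
      · rw [← hyS.2 l hl, hesum, ← Finset.sum_add_sum_compl U (fun i => y i ^ l),
          ← Finset.sum_coe_sort U]
        congr 1
        -- The power sum with exponent `0` merely counts the points; the constraints of the local
        -- problem start at exponent `1`.
        rcases l with _ | l
        · simp
        · exact hu2 ⟨l, hl⟩
    have := hymin heu
    simp only [Set.mem_ofPred_eq] at this
    rw [hesum, ← Finset.sum_add_sum_compl U (fun i => y i ^ (k + 1)),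
      ← Finset.sum_coe_sort U] at this
    linarith)
  refine le_trans (Finset.card_le_card ?_) hloc
  intro v hv
  simp only [Finset.mem_sdiff, Finset.mem_image, Finset.mem_univ, true_and, Finset.mem_insert,
    Finset.mem_singleton, not_or] at hv
  obtain ⟨⟨i, rfl⟩, h1, h2⟩ := hv
  refine Finset.mem_image.2 ⟨⟨i, ?_⟩, Finset.mem_univ _, rfl⟩
  rw [hU, Finset.mem_filter]
  have := hyS.1 i
  exact ⟨Finset.mem_univ _, lt_of_le_of_ne this.1 (Ne.symm h1), lt_of_le_of_ne this.2 h2⟩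

/-- Points of `[0, b]` can be moved, keeping their sum and not decreasing their sum of squares, so
that at most one lies inside. -/
theorem exists_le_one_inside {ι : Type*} [Fintype ι] (b : ℝ) (x : ι → ℝ)
    (hx : ∀ i, x i ∈ Set.Icc 0 b) :
    ∃ y : ι → ℝ, (∀ i, y i ∈ Set.Icc 0 b) ∧ ∑ i, y i = ∑ i, x i ∧ ∑ i, x i ^ 2 ≤ ∑ i, y i ^ 2 ∧
      ∀ i j, y i ∈ Set.Ioo 0 b → y j ∈ Set.Ioo 0 b → i = j := by
  classical
  set S : Set (ι → ℝ) := {u | (∀ i, u i ∈ Set.Icc 0 b) ∧ ∑ i, u i = ∑ i, x i}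
    with hS
  have hcomp : IsCompact S := by
    have h1 : IsCompact (Set.pi Set.univ fun _ : ι => Set.Icc 0 b) :=
      isCompact_univ_pi fun _ => isCompact_Icc
    refine h1.of_isClosed_subset ?_ fun u hu i _ => hu.1 i
    have : S = (Set.pi Set.univ fun _ : ι => Set.Icc 0 b) ∩
        {u : ι → ℝ | ∑ i, u i = ∑ i, x i} := by
      ext u; simp [hS, Pi.le_def, forall_and]
    rw [this]
    exact h1.isClosed.inter (isClosed_eq (by fun_prop) (by fun_prop))
  obtain ⟨y, hyS, hymax⟩ := hcomp.exists_isMaxOn ⟨x, hx, rfl⟩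
    (f := fun u : ι → ℝ => ∑ i, u i ^ 2) (by fun_prop)
  refine ⟨y, hyS.1, hyS.2, hymax ⟨hx, rfl⟩, ?_⟩
  have key : ∀ i j, i ≠ j → y i ≤ y j → y i ∈ Set.Ioo 0 b → y j ∈ Set.Ioo 0 b → False := by
    intro i j hij hle hi hj
    -- Moving the smaller point down and the larger one up by `t` keeps the sum and adds `2 * t * (y
    -- j - y i) + 2 * t ^ 2 > 0` to the sum of squares.
    set t := min (y i) (b - y j) with ht
    have htpos : 0 < t := lt_min hi.1 (by linarith [hj.2])
    have ht1 : t ≤ y i := min_le_left _ _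
    have ht2 : t ≤ b - y j := min_le_right _ _
    set u : ι → ℝ := Function.update (Function.update y i (y i - t)) j (y j + t) with hu
    have hui : u i = y i - t := by simp [hu, hij]
    have huj : u j = y j + t := by simp [hu]
    have huo : ∀ m, m ≠ i → m ≠ j → u m = y m := by
      intro m h1 h2; simp [hu, h1, h2]
    have hji : j ∈ Finset.univ.erase i := by simp [hij.symm]
    have hsplit : ∀ F : ι → ℝ, ∑ m, F m = F i + (F j + ∑ m ∈ (Finset.univ.erase i).erase j, F m) := by
      intro F
      rw [← Finset.add_sum_erase _ _ (Finset.mem_univ i), ← Finset.add_sum_erase _ _ hji]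
    have hrest : ∀ F : ℝ → ℝ, ∑ m ∈ (Finset.univ.erase i).erase j, F (u m) =
        ∑ m ∈ (Finset.univ.erase i).erase j, F (y m) := by
      intro F
      refine Finset.sum_congr rfl fun m hm => ?_
      simp only [Finset.mem_erase, Finset.mem_univ, and_true] at hm
      rw [huo m hm.2 hm.1]
    have huS : u ∈ S := by
      refine ⟨fun m => ?_, ?_⟩
      · by_cases h1 : m = i
        · subst h1; rw [hui]; exact ⟨by linarith, by linarith [hi.2]⟩
        · by_cases h2 : m = j
          · subst h2; rw [huj]; exact ⟨by linarith [hj.1], by linarith⟩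
          · rw [huo m h1 h2]; exact hyS.1 m
      · rw [← hyS.2, hsplit u, hsplit y, hui, huj, hrest (fun v => v)]
        ring
    have := hymax huS
    simp only [Set.mem_ofPred_eq] at this
    rw [hsplit (fun m => u m ^ 2), hsplit (fun m => y m ^ 2), hui, huj, hrest (fun v => v ^ 2)] at this
    nlinarith
  intro i j hi hj
  by_contra hij
  rcases le_total (y i) (y j) with h | h
  · exact key i j hij h hi hj
  · exact key j i (Ne.symm hij) h hj hi

end PoissonBinomial

namespace PoissonBinomial

/-! ### Comparing generating functions -/

/-- Telescoping: the factors are exchanged one at a time, and all the others have norm at most `1`.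
-/
theorem norm_prod_sub_prod_le_sum {ι : Type*} (s : Finset ι) (a b : ι → ℂ)
    (ha : ∀ i ∈ s, ‖a i‖ ≤ 1) (hb : ∀ i ∈ s, ‖b i‖ ≤ 1) :
    ‖∏ i ∈ s, a i - ∏ i ∈ s, b i‖ ≤ ∑ i ∈ s, ‖a i - b i‖ := by
  classical
  induction s using Finset.induction_on with
  | empty => simp
  | insert i s hi ih =>
    rw [Finset.prod_insert hi, Finset.prod_insert hi, Finset.sum_insert hi]
    have h1 := ih (fun j hj => ha j (Finset.mem_insert_of_mem hj))
      (fun j hj => hb j (Finset.mem_insert_of_mem hj))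
    have hP : ‖∏ j ∈ s, a j‖ ≤ 1 := by
      rw [norm_prod]
      exact Finset.prod_le_one (fun _ _ => norm_nonneg _)
        (fun j hj => ha j (Finset.mem_insert_of_mem hj))
    have hbi := hb i (Finset.mem_insert_self _ _)
    calc ‖a i * ∏ j ∈ s, a j - b i * ∏ j ∈ s, b j‖
        = ‖(a i - b i) * ∏ j ∈ s, a j + b i * (∏ j ∈ s, a j - ∏ j ∈ s, b j)‖ := by ring_nf
      _ ≤ ‖a i - b i‖ * ‖∏ j ∈ s, a j‖ + ‖b i‖ * ‖∏ j ∈ s, a j - ∏ j ∈ s, b j‖ :=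
          (norm_add_le _ _).trans (by rw [norm_mul, norm_mul])
      _ ≤ ‖a i - b i‖ * 1 + 1 * ∑ j ∈ s, ‖a j - b j‖ := by gcongr
      _ = _ := by ring

theorem norm_log_one_add_sub_logTaylor_le {k : ℕ} (hk : 1 ≤ k) {w : ℂ} (hw : ‖w‖ ≤ 1 / 2) :
    ‖Complex.log (1 + w) - Complex.logTaylor (k + 1) w‖ ≤ ‖w‖ ^ (k + 1) := by
  refine (Complex.norm_log_sub_logTaylor_le k (by linarith)).trans ?_
  have h1 : (1 - ‖w‖)⁻¹ ≤ 2 := by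
    rw [inv_le_comm₀ (by linarith) (by norm_num)]; linarith
  have hk' : (1 : ℝ) ≤ k := by exact_mod_cast hk
  rw [div_le_iff₀ (by positivity)]
  have : 0 ≤ ‖w‖ ^ (k + 1) := by positivity
  gcongr
  linarith

/-- Products `∏ (1 + p z)` with equal low power sums are close, for small `p z`. -/
theorem norm_prod_sub_prod_le_of_small {ι : Type*} (s : Finset ι) (p q : ι → ℝ) (z : ℂ)
    {b : ℝ} {k : ℕ} (hk : 1 ≤ k) (hz : ‖z‖ ≤ 2) (hb : b * ‖z‖ ≤ 1 / 2)
    (hp : ∀ i ∈ s, p i ∈ Set.Icc 0 b) (hq : ∀ i ∈ s, q i ∈ Set.Icc 0 b)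
    (hp1 : ∀ i ∈ s, ‖1 + p i * z‖ ≤ 1) (hq1 : ∀ i ∈ s, ‖1 + q i * z‖ ≤ 1)
    (hmom : ∀ l ≤ k, ∑ i ∈ s, q i ^ l = ∑ i ∈ s, p i ^ l) :
    ‖∏ i ∈ s, (1 + p i * z) - ∏ i ∈ s, (1 + q i * z)‖ ≤ 8 * (b * ‖z‖) ^ k * ∑ i ∈ s, p i := by
  rcases s.eq_empty_or_nonempty with rfl | hne
  · simp
  have hb0 : 0 ≤ b := by
    obtain ⟨i, hi⟩ := hne
    exact (hp i hi).1.trans (hp i hi).2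
  set S := ∑ i ∈ s, p i with hS
  have hS0 : 0 ≤ S := Finset.sum_nonneg fun i hi => (hp i hi).1
  have hSq : ∑ i ∈ s, q i = S := by simpa using hmom 1 hk
  -- Twice the Taylor error of one product. That error is at most `2 * (b * ‖z‖) ^ k * S`, where `2`
  -- bounds the last factor `‖z‖`.
  set Δ := 4 * (b * ‖z‖) ^ k * S with hΔ
  have hnorm : ∀ r : ι → ℝ, (∀ i ∈ s, r i ∈ Set.Icc 0 b) → ∀ i ∈ s,
      ‖(r i : ℂ) * z‖ = r i * ‖z‖ ∧ ‖(r i : ℂ) * z‖ ≤ 1 / 2 := by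
    intro r hr i hi
    have h1 : ‖(r i : ℂ) * z‖ = r i * ‖z‖ := by
      rw [norm_mul, Complex.norm_real, Real.norm_eq_abs, abs_of_nonneg (hr i hi).1]
    refine ⟨h1, h1 ▸ le_trans ?_ hb⟩
    exact mul_le_mul_of_nonneg_right (hr i hi).2 (norm_nonneg _)
  have herr : ∀ r : ι → ℝ, (∀ i ∈ s, r i ∈ Set.Icc 0 b) → ∑ i ∈ s, r i = S →
      ‖∑ i ∈ s, (Complex.log (1 + r i * z) - Complex.logTaylor (k + 1) (r i * z))‖ ≤
        2 * (b * ‖z‖) ^ k * S := by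
    intro r hr hrS
    refine (norm_sum_le _ _).trans ?_
    rw [← hrS, Finset.mul_sum]
    refine Finset.sum_le_sum fun i hi => ?_
    obtain ⟨h1, h2⟩ := hnorm r hr i hi
    refine (norm_log_one_add_sub_logTaylor_le hk h2).trans ?_
    rw [h1, pow_succ]
    have h3 : (r i * ‖z‖) ^ k ≤ (b * ‖z‖) ^ k := by
      have := (hr i hi).1
      have := (hr i hi).2
      gcongr
    calc (r i * ‖z‖) ^ k * (r i * ‖z‖) ≤ (b * ‖z‖) ^ k * (r i * 2) := by
          have := (hr i hi).1
          gcongr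
      _ = 2 * (b * ‖z‖) ^ k * r i := by ring
  have hexp : ∀ r : ι → ℝ, (∀ i ∈ s, r i ∈ Set.Icc 0 b) →
      ∏ i ∈ s, (1 + r i * z) = Complex.exp (∑ i ∈ s, Complex.log (1 + r i * z)) := by
    intro r hr
    rw [Complex.exp_sum]
    refine Finset.prod_congr rfl fun i hi => ?_
    rw [Complex.exp_log]
    intro h0
    have h1 : (r i : ℂ) * z = -1 := by linear_combination h0
    have := (hnorm r hr i hi).2
    rw [h1] at this
    norm_num at this
  -- Summed over the points, the truncated logarithm is a linear combination of the power sums up to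
  -- `k`.
  have htay : ∑ i ∈ s, Complex.logTaylor (k + 1) (p i * z) =
      ∑ i ∈ s, Complex.logTaylor (k + 1) (q i * z) := by
    simp only [Complex.logTaylor]
    rw [Finset.sum_comm, Finset.sum_comm (s := s)]
    refine Finset.sum_congr rfl fun l hl => ?_
    have h1 := hmom l (Nat.lt_succ_iff.1 (Finset.mem_range.1 hl))
    have h2 : ∀ r : ι → ℝ, ∑ i ∈ s, (-1 : ℂ) ^ (l + 1) * (r i * z) ^ l / l =
        (-1) ^ (l + 1) * z ^ l / l * ((∑ i ∈ s, r i ^ l : ℝ) : ℂ) := by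
      intro r
      push_cast
      rw [Finset.mul_sum]
      refine Finset.sum_congr rfl fun i _ => ?_
      rw [mul_pow]; ring
    rw [h2, h2, h1]
  have hone : ∀ r : ι → ℝ, (∀ i ∈ s, ‖1 + r i * z‖ ≤ 1) → ‖∏ i ∈ s, (1 + r i * z)‖ ≤ 1 := by
    intro r hr
    rw [norm_prod]
    exact Finset.prod_le_one (fun _ _ => norm_nonneg _) hr
  -- `‖exp E - 1‖ ≤ 2 * ‖E‖` needs `‖E‖ ≤ 1`. For `Δ > 1` the claimed bound `2 * Δ` is weaker than
  -- the trivial bound `2`.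
  rcases le_or_gt Δ 1 with h1 | h1
  · set E := ∑ i ∈ s, Complex.log (1 + p i * z) - ∑ i ∈ s, Complex.log (1 + q i * z) with hE
    have hEn : ‖E‖ ≤ Δ := by
      have : E = (∑ i ∈ s, (Complex.log (1 + p i * z) - Complex.logTaylor (k + 1) (p i * z))) -
          ∑ i ∈ s, (Complex.log (1 + q i * z) - Complex.logTaylor (k + 1) (q i * z)) := by
        rw [Finset.sum_sub_distrib, Finset.sum_sub_distrib, htay, hE]; ring
      rw [this]
      refine (norm_sub_le _ _).trans ?_
      have h1 := herr p hp rfl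
      have h2 := herr q hq hSq
      rw [hΔ]; linarith
    have hsplit : ∏ i ∈ s, (1 + p i * z) - ∏ i ∈ s, (1 + q i * z) =
        (∏ i ∈ s, (1 + q i * z)) * (Complex.exp E - 1) := by
      rw [mul_sub, mul_one, hexp p hp, hexp q hq, ← Complex.exp_add, hE]
      congr 2; ring
    rw [hsplit, norm_mul]
    calc _ ≤ 1 * (2 * ‖E‖) := by
          gcongr
          · exact hone q hq1
          · exact Complex.norm_exp_sub_one_le (hEn.trans h1)
      _ ≤ 2 * Δ := by linarith
      _ = _ := by rw [hΔ]; ring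
  · refine (norm_sub_le _ _).trans ?_
    have h1 := hone p hp1
    have h2 := hone q hq1
    have h3 : 8 * (b * ‖z‖) ^ k * S = 2 * Δ := by rw [hΔ]; ring
    rw [h3]; linarith

/-- Newton's identities: power sums determine elementary symmetric functions. -/
theorem esymm_eq_of_psum_eq {ι : Type*} [Fintype ι] (p q : ι → ℝ) (k : ℕ)
    (hmom : ∀ l ≤ k, ∑ i, q i ^ l = ∑ i, p i ^ l) :
    ∀ l ≤ k, MvPolynomial.aeval q (MvPolynomial.esymm ι ℝ l) =
      MvPolynomial.aeval p (MvPolynomial.esymm ι ℝ l) := by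
  intro l
  induction l using Nat.strong_induction_on with
  | _ l ih =>
    intro hl
    rcases Nat.eq_zero_or_pos l with rfl | hpos
    · simp
    have key : ∀ r : ι → ℝ, (l : ℝ) * MvPolynomial.aeval r (MvPolynomial.esymm ι ℝ l) =
        (-1) ^ (l + 1) * ∑ a ∈ Finset.HasAntidiagonal.antidiagonal l with a.1 < l,
          (-1) ^ a.1 * MvPolynomial.aeval r (MvPolynomial.esymm ι ℝ a.1) * ∑ i, r i ^ a.2 := by
      intro r
      have := congrArg (MvPolynomial.aeval r) (MvPolynomial.mul_esymm_eq_sum ι ℝ l)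
      simpa [MvPolynomial.psum] using this
    have h1 := key q
    have h2 := key p
    have h3 : (l : ℝ) ≠ 0 := by positivity
    apply mul_left_cancel₀ h3
    rw [h1, h2]
    congr 1
    refine Finset.sum_congr rfl fun a ha => ?_
    rw [Finset.mem_filter, Finset.HasAntidiagonal.mem_antidiagonal] at ha
    rw [ih a.1 ha.2 (by omega), hmom a.2 (by omega)]

/-- The algebra is left general because the expansion is used at a complex `z` and also at the real
point `4`. -/
theorem prod_one_add_mul_eq_sum_esymm {ι : Type*} [Fintype ι] (p : ι → ℝ) {S : Type*} [CommRing S]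
    [Algebra ℝ S] (z : S) :
    ∏ i, (1 + algebraMap ℝ S (p i) * z) = ∑ l ∈ Finset.range (Fintype.card ι + 1),
      algebraMap ℝ S (MvPolynomial.aeval p (MvPolynomial.esymm ι ℝ l)) * z ^ l := by
  rw [Finset.prod_one_add, Finset.sum_powerset, Finset.card_univ]
  refine Finset.sum_congr rfl fun l _ => ?_
  rw [MvPolynomial.esymm]
  simp only [map_sum, map_prod, MvPolynomial.aeval_X]
  rw [Finset.sum_mul]
  refine Finset.sum_congr rfl fun t ht => ?_
  rw [Finset.prod_mul_distrib, Finset.prod_const, (Finset.mem_powersetCard.1 ht).2]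

/-- Products `∏ (1 + p z)` with equal low power sums are close, for bounded `∑ p`. -/
theorem norm_prod_sub_prod_le_of_sum {ι : Type*} [Fintype ι] (p q : ι → ℝ) (z : ℂ)
    {k : ℕ} (hk : 1 ≤ k) (hz : ‖z‖ ≤ 2) (hp : ∀ i, 0 ≤ p i) (hq : ∀ i, 0 ≤ q i)
    (hmom : ∀ l ≤ k, ∑ i, q i ^ l = ∑ i, p i ^ l) :
    ‖∏ i, (1 + p i * z) - ∏ i, (1 + q i * z)‖ ≤
      2 * (1 / 2) ^ k * Real.exp (4 * ∑ i, p i) := by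
  have hSq : ∑ i, q i = ∑ i, p i := by simpa using hmom 1 hk
  set e : (ι → ℝ) → ℕ → ℝ := fun r l => MvPolynomial.aeval r (MvPolynomial.esymm ι ℝ l) with he
  have henn : ∀ r : ι → ℝ, (∀ i, 0 ≤ r i) → ∀ l, 0 ≤ e r l := by
    intro r hr l
    simp only [he, MvPolynomial.esymm, map_sum, map_prod, MvPolynomial.aeval_X]
    exact Finset.sum_nonneg fun t _ => Finset.prod_nonneg fun i _ => hr i
  -- The point `4` is twice the bound for `‖z‖`, so that every coefficient beyond `k` gains a factor
  -- `(1/2) ^ k` in the comparison.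
  have hexp : ∀ r : ι → ℝ, (∀ i, 0 ≤ r i) → ∑ l ∈ Finset.range (Fintype.card ι + 1), e r l * 4 ^ l ≤
      Real.exp (4 * ∑ i, r i) := by
    intro r hr
    have := prod_one_add_mul_eq_sum_esymm r (4 : ℝ)
    simp only [Algebra.algebraMap_self, RingHom.id_apply] at this
    rw [← this, Finset.mul_sum, Real.exp_sum]
    refine Finset.prod_le_prod (fun i _ => by have := hr i; positivity) fun i _ => ?_
    have := Real.add_one_le_exp (4 * r i)
    linarith
  have h1 := prod_one_add_mul_eq_sum_esymm p z
  have h2 := prod_one_add_mul_eq_sum_esymm q z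
  simp only [Complex.coe_algebraMap] at h1 h2
  rw [h1, h2, ← Finset.sum_sub_distrib]
  calc _ ≤ ∑ l ∈ Finset.range (Fintype.card ι + 1), (1 / 2) ^ k * (e p l * 4 ^ l + e q l * 4 ^ l) := by
        refine (norm_sum_le _ _).trans (Finset.sum_le_sum fun l _ => ?_)
        have hp' := henn p hp l
        have hq' := henn q hq l
        -- Up to `k` the coefficients agree by Newton's identities. Beyond `k`, `‖z‖ ^ l ≤ (1/2) ^ l
        -- * 4 ^ l`.
        rcases le_or_gt l k with hl | hl
        · rw [esymm_eq_of_psum_eq p q k hmom l hl, sub_self, norm_zero]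
          positivity
        · rw [← sub_mul, norm_mul, norm_pow, ← Complex.ofReal_sub, Complex.norm_real,
            Real.norm_eq_abs]
          have hz' : ‖z‖ ^ l ≤ (1 / 2) ^ k * 4 ^ l := by
            calc ‖z‖ ^ l ≤ 2 ^ l := by gcongr
              _ = (1 / 2) ^ l * 4 ^ l := by rw [← mul_pow]; norm_num
              _ ≤ (1 / 2) ^ k * 4 ^ l := by
                  gcongr ?_ * _
                  exact pow_le_pow_of_le_one (by norm_num) (by norm_num) hl.le
          have habs : |e p l - e q l| ≤ e p l + e q l := by
            rw [abs_le]; constructor <;> linarith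
          calc |e p l - e q l| * ‖z‖ ^ l ≤ (e p l + e q l) * ((1 / 2) ^ k * 4 ^ l) := by gcongr
            _ = _ := by ring
    _ ≤ (1 / 2) ^ k * (Real.exp (4 * ∑ i, p i) + Real.exp (4 * ∑ i, p i)) := by
        rw [← Finset.mul_sum, Finset.sum_add_distrib]
        have := hexp q hq
        rw [hSq] at this
        gcongr
        exact hexp p hp
    _ = _ := by ring

theorem normSq_one_add_mul_exp_sub_one (p ξ : ℝ) :
    ‖1 + (p : ℂ) * (Complex.exp (ξ * Complex.I) - 1)‖ ^ 2 =
      1 - 2 * (p * (1 - p)) * (1 - Real.cos ξ) := by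
  rw [← Complex.normSq_eq_norm_sq, Complex.exp_mul_I, ← Complex.ofReal_cos, ← Complex.ofReal_sin,
    Complex.normSq_apply]
  simp only [Complex.add_re, Complex.one_re, Complex.mul_re, Complex.sub_re, Complex.ofReal_re,
    Complex.ofReal_im, Complex.I_re, Complex.I_im, Complex.add_im, Complex.one_im, Complex.mul_im,
    Complex.sub_im]
  linear_combination p ^ 2 * Real.sin_sq_add_cos_sq ξ

theorem norm_one_add_mul_exp_sub_one_le {p : ℝ} (hp : p ∈ Set.Icc 0 1) (ξ : ℝ) :
    ‖1 + (p : ℂ) * (Complex.exp (ξ * Complex.I) - 1)‖ ≤ 1 := by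
  have h := normSq_one_add_mul_exp_sub_one p ξ
  have h1 : 0 ≤ 2 * (p * (1 - p)) * (1 - Real.cos ξ) :=
    mul_nonneg (mul_nonneg (by norm_num) (mul_nonneg hp.1 (by linarith [hp.2])))
      (by linarith [Real.cos_le_one ξ])
  rw [← sq_le_one_iff₀ (norm_nonneg _)]
  linarith

/-- The characteristic function of a Poisson binomial distribution decays with the variance. -/
theorem norm_cf_le {n : ℕ} (p : Fin n → unitInterval) {ξ : ℝ} (hξ : |ξ| ≤ Real.pi) :
    ‖cf p ξ‖ ≤ Real.exp (-(var (pbd p) * ξ ^ 2 / 5)) := by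
  -- From `1 - cos ξ ≥ 2 * ξ ^ 2 / π ^ 2` and `π ^ 2 < 10`.
  have hcos : 2 * ξ ^ 2 / 10 ≤ 1 - Real.cos ξ := by
    have h1 := Real.cos_le_one_sub_mul_cos_sq hξ
    have h2 : 2 / 10 ≤ 2 / Real.pi ^ 2 := by
      gcongr
      nlinarith [Real.pi_lt_d2, Real.pi_pos]
    nlinarith [sq_nonneg ξ]
  have hsq : ‖cf p ξ‖ ^ 2 ≤ Real.exp (-(var (pbd p) * ξ ^ 2 / 5)) ^ 2 := by
    rw [cf, norm_prod, ← Finset.prod_pow, ← Real.exp_nat_mul, var_pbd, Finset.sum_mul,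
      Finset.sum_div, ← Finset.sum_neg_distrib, Finset.mul_sum, Real.exp_sum]
    refine Finset.prod_le_prod (fun i _ => by positivity) fun i _ => ?_
    rw [normSq_one_add_mul_exp_sub_one]
    have h0 : 0 ≤ (p i : ℝ) * (1 - p i) := mul_nonneg (p i).2.1 (by linarith [(p i).2.2])
    have h1 := Real.add_one_le_exp (((2 : ℕ) : ℝ) * -((p i : ℝ) * (1 - p i) * ξ ^ 2 / 5))
    push_cast at h1 ⊢
    nlinarith
  exact le_of_sq_le_sq hsq (Real.exp_nonneg _)

theorem norm_exp_sub_one_le_abs (ξ : ℝ) : ‖Complex.exp (ξ * Complex.I) - 1‖ ≤ |ξ| := by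
  have := Real.norm_exp_I_mul_ofReal_sub_one_le (x := ξ)
  rwa [mul_comm, Real.norm_eq_abs] at this

theorem norm_exp_sub_one_le_two (ξ : ℝ) : ‖Complex.exp (ξ * Complex.I) - 1‖ ≤ 2 := by
  refine (norm_sub_le _ _).trans ?_
  rw [Complex.norm_exp_ofReal_mul_I]
  norm_num

end PoissonBinomial

namespace PoissonBinomial

/-! ### The partition -/

theorem log_inv_pos {ε : ℝ} (h0 : 0 < ε) (h1 : ε ≤ 1 / 4) : 1 < Real.log (1 / ε) := by
  have h4 : 4 ≤ 1 / ε := by rw [le_div_iff₀ h0]; linarith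
  have : Real.log 4 ≤ Real.log (1 / ε) := Real.log_le_log (by norm_num) h4
  have h2 : Real.log 4 = 2 * Real.log 2 := by
    rw [show (4 : ℝ) = 2 ^ 2 by norm_num, Real.log_pow]; norm_num
  linarith [Real.log_two_gt_d9]

section Partition

variable {ε V : ℝ}

theorem R_pos (h0 : 0 < ε) (h1 : ε ≤ 1 / 4) (hV : 0 ≤ V) : 0 < R ε V := by
  have := log_inv_pos h0 h1
  unfold R
  split_ifs with h
  · norm_num
  · have : 0 < V := lt_of_le_of_ne hV (Ne.symm h)
    exact lt_min (by norm_num) (Real.sqrt_pos.2 (by positivity))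

theorem R_le : R ε V ≤ 1 / 4 := by
  unfold R
  split_ifs
  · exact le_rfl
  · exact min_le_left _ _

theorem mul_R_sq_le (h0 : 0 < ε) (h1 : ε ≤ 1 / 4) (hV : 0 ≤ V) :
    V * R ε V ^ 2 ≤ Real.log (1 / ε) := by
  have hl := log_inv_pos h0 h1
  have hR := R_pos h0 h1 hV
  by_cases h : V = 0
  · rw [h, zero_mul]; linarith
  · have hVp : 0 < V := lt_of_le_of_ne hV (Ne.symm h)
    have h2 : R ε V ≤ √(Real.log (1 / ε) / V) := by
      unfold R; rw [if_neg h]; exact min_le_right _ _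
    have h3 : R ε V ^ 2 ≤ Real.log (1 / ε) / V := by
      rw [← Real.sq_sqrt (show 0 ≤ Real.log (1 / ε) / V by positivity)]
      gcongr
    rw [le_div_iff₀ hVp] at h3
    linarith

/-- When the cap `1/4` is inactive, `R` is the frequency at which `V * ξ ^ 2` reaches `log (1/ε)`.
At a large multiple of `R` the characteristic function is therefore a large power of `ε`. -/
theorem mul_R_sq_eq (h0 : 0 < ε) (h1 : ε ≤ 1 / 4) (hV : 0 ≤ V) (hR : R ε V < 1 / 4) :
    V * R ε V ^ 2 = Real.log (1 / ε) := by
  have hl := log_inv_pos h0 h1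
  unfold R at hR ⊢
  split_ifs at hR ⊢ with h
  · exact absurd hR (lt_irrefl _)
  · have hVp : 0 < V := lt_of_le_of_ne hV (Ne.symm h)
    rw [min_eq_right (by
      by_contra hc
      rw [min_eq_left (le_of_not_ge hc)] at hR
      exact lt_irrefl _ hR), Real.sq_sqrt (by positivity)]
    field_simp

theorem B_zero : B ε V 0 = R ε V := by simp [B]

theorem B_succ (i : ℕ) : B ε V (i + 1) = B ε V i ^ 2 := by
  rw [B, B, ← pow_mul, pow_succ]

theorem B_pos (h0 : 0 < ε) (h1 : ε ≤ 1 / 4) (hV : 0 ≤ V) (i : ℕ) : 0 < B ε V i :=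
  pow_pos (R_pos h0 h1 hV) _

theorem B_le (h0 : 0 < ε) (h1 : ε ≤ 1 / 4) (hV : 0 ≤ V) (i : ℕ) : B ε V i ≤ 1 / 4 := by
  have hR := R_pos h0 h1 hV
  have hR' := R_le (ε := ε) (V := V)
  calc B ε V i ≤ R ε V ^ 1 := pow_le_pow_of_le_one hR.le (by linarith) Nat.one_le_two_pow
    _ ≤ 1 / 4 := by simpa using hR'

theorem B_strictAnti (h0 : 0 < ε) (h1 : ε ≤ 1 / 4) (hV : 0 ≤ V) : StrictAnti (B ε V) := by
  refine strictAnti_nat_of_succ_lt fun i => ?_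
  rw [B_succ]
  have := B_pos h0 h1 hV i
  have := B_le h0 h1 hV i
  nlinarith

variable {ℓ : ℕ}

theorem leftEnd_nonneg (h0 : 0 < ε) (h1 : ε ≤ 1 / 4) (hV : 0 ≤ V) (i : ℕ) :
    0 ≤ leftEnd ε V ℓ i := by
  unfold leftEnd
  split_ifs
  · exact (B_pos h0 h1 hV i).le
  · exact le_rfl

theorem rightEnd_succ (i : ℕ) : rightEnd ε V (i + 1) = B ε V i := by simp [rightEnd]

theorem rightEnd_pos (h0 : 0 < ε) (h1 : ε ≤ 1 / 4) (hV : 0 ≤ V) (i : ℕ) :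
    0 < rightEnd ε V i := by
  unfold rightEnd
  split_ifs
  · norm_num
  · exact B_pos h0 h1 hV _

theorem rightEnd_le (h0 : 0 < ε) (h1 : ε ≤ 1 / 4) (hV : 0 ≤ V) (i : ℕ) :
    rightEnd ε V i ≤ 1 / 2 := by
  unfold rightEnd
  split_ifs
  · exact le_rfl
  · linarith [B_le h0 h1 hV (i - 1)]

theorem leftEnd_lt_rightEnd (h0 : 0 < ε) (h1 : ε ≤ 1 / 4) (hV : 0 ≤ V) (i : ℕ) :
    leftEnd ε V ℓ i < rightEnd ε V i := by
  unfold leftEnd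
  split_ifs
  · rcases i with _ | i
    · simp only [rightEnd, if_pos]; linarith [B_le h0 h1 hV 0]
    · rw [rightEnd_succ]; exact B_strictAnti h0 h1 hV (Nat.lt_succ_self i)
  · exact rightEnd_pos h0 h1 hV i

theorem rightEnd_le_leftEnd (h0 : 0 < ε) (h1 : ε ≤ 1 / 4) (hV : 0 ≤ V) {i j : ℕ} (hij : i < j)
    (hj : j ≤ ℓ + 1) : rightEnd ε V j ≤ leftEnd ε V ℓ i := by
  obtain ⟨j, rfl⟩ : ∃ j', j = j' + 1 := ⟨j - 1, by omega⟩
  rw [rightEnd_succ, leftEnd, if_pos (by omega)]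
  exact (B_strictAnti h0 h1 hV).antitone (by omega)

open Classical in
/-- The index of the interval that contains the number `v ∈ [0, 1/2]`. -/
noncomputable def level (ε V : ℝ) (ℓ : ℕ) (v : ℝ) : ℕ := sInf {i | leftEnd ε V ℓ i ≤ v}

theorem leftEnd_last : leftEnd ε V ℓ (ℓ + 1) = 0 := by simp [leftEnd]

theorem leftEnd_level_le {v : ℝ} (hv : 0 ≤ v) : leftEnd ε V ℓ (level ε V ℓ v) ≤ v :=
  Nat.sInf_mem (s := {i | leftEnd ε V ℓ i ≤ v}) ⟨ℓ + 1, by simpa [leftEnd_last] using hv⟩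

theorem level_le {v : ℝ} (hv : 0 ≤ v) : level ε V ℓ v ≤ ℓ + 1 :=
  Nat.sInf_le (by simpa [leftEnd_last] using hv)

/-- The level is minimal, so `v` lies below the left end of the preceding interval, which is the
right end of this one. -/
theorem lt_rightEnd_level {v : ℝ} (hv : 0 ≤ v) (h : level ε V ℓ v ≠ 0) :
    v < rightEnd ε V (level ε V ℓ v) := by
  obtain ⟨i, hi⟩ := Nat.exists_eq_succ_of_ne_zero h
  have h1 : i ∉ {i | leftEnd ε V ℓ i ≤ v} := Nat.notMem_of_lt_sInf (by
    change i < level ε V ℓ v; omega)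
  have h2 : i ≤ ℓ := by have := level_le (ε := ε) (V := V) (ℓ := ℓ) hv; omega
  simp only [Set.mem_ofPred_eq, not_le, leftEnd, h2, if_true] at h1
  rw [hi, Nat.succ_eq_add_one, rightEnd_succ]
  exact h1

theorem le_rightEnd_level {v : ℝ} (hv : v ∈ Set.Icc 0 (1 / 2)) :
    v ≤ rightEnd ε V (level ε V ℓ v) := by
  by_cases h : level ε V ℓ v = 0
  · rw [h]; simpa [rightEnd] using hv.2
  · exact (lt_rightEnd_level hv.1 h).le

/-- Different closed intervals have at most an end point in common. -/
theorem eq_end_of_mem (h0 : 0 < ε) (h1 : ε ≤ 1 / 4) (hV : 0 ≤ V) {i j : ℕ} (hij : i ≠ j)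
    (hi : i ≤ ℓ + 1) (hj : j ≤ ℓ + 1) {v : ℝ}
    (hvi : v ∈ Set.Icc (leftEnd ε V ℓ i) (rightEnd ε V i))
    (hvj : v ∈ Set.Icc (leftEnd ε V ℓ j) (rightEnd ε V j)) :
    v = leftEnd ε V ℓ i ∨ v = rightEnd ε V i := by
  rcases lt_or_gt_of_ne hij with h | h
  · left
    have := rightEnd_le_leftEnd (ℓ := ℓ) h0 h1 hV h hj
    linarith [hvi.1, hvj.2]
  · right
    have := rightEnd_le_leftEnd (ℓ := ℓ) h0 h1 hV h hi
    linarith [hvi.2, hvj.1]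

end Partition

/-! ### Folding the parameter range at `1/2` -/

/-- `v` or `1 - v`. -/
noncomputable def fold (s : Bool) (v : ℝ) : ℝ := if s then v else 1 - v

theorem fold_fold (s : Bool) (v : ℝ) : fold s (fold s v) = v := by
  cases s <;> simp [fold]

theorem fold_mul (s : Bool) (v : ℝ) : fold s v * (1 - fold s v) = v * (1 - v) := by
  cases s <;> simp [fold]; ring

/-- The side of `1/2` on which `v` lies. -/
noncomputable def side (v : ℝ) : Bool := decide (v ≤ 1 / 2)

theorem fold_side_mem {v : ℝ} (hv : v ∈ Set.Icc 0 1) : fold (side v) v ∈ Set.Icc 0 (1 / 2) := by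
  by_cases h : v ≤ 1 / 2
  · rw [side, decide_eq_true h, fold, if_pos rfl]
    exact ⟨hv.1, h⟩
  · rw [side, decide_eq_false h, fold, if_neg (by simp)]
    constructor <;> linarith [hv.2]

theorem fold_mem {s : Bool} {v : ℝ} (hv : v ∈ Set.Icc 0 1) : fold s v ∈ Set.Icc 0 1 := by
  have h1 := hv.1
  have h2 := hv.2
  cases s <;> simp [fold] <;> constructor <;> linarith

/-- Since `1 + (1 - v) * (exp (iξ) - 1) = exp (iξ) * (1 + v * (exp (-iξ) - 1))`, folding reverses
the frequency and multiplies both products by the same number of norm `1`. -/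
theorem norm_prod_fold {ι : Type*} (T : Finset ι) (s : Bool) (x y : ι → ℝ) (ξ : ℝ) :
    ‖∏ j ∈ T, (1 + (fold s (x j) : ℂ) * (Complex.exp (ξ * Complex.I) - 1)) -
      ∏ j ∈ T, (1 + (fold s (y j) : ℂ) * (Complex.exp (ξ * Complex.I) - 1))‖ =
    ‖∏ j ∈ T, (1 + (x j : ℂ) * (Complex.exp ((if s then ξ else -ξ : ℝ) * Complex.I) - 1)) -
      ∏ j ∈ T, (1 + (y j : ℂ) * (Complex.exp ((if s then ξ else -ξ : ℝ) * Complex.I) - 1))‖ := by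
  cases s
  · have h : ∀ v : ℝ, 1 + (fold false v : ℂ) * (Complex.exp (ξ * Complex.I) - 1) =
        Complex.exp (ξ * Complex.I) *
          (1 + (v : ℂ) * (Complex.exp ((-ξ : ℝ) * Complex.I) - 1)) := by
      intro v
      have : Complex.exp (ξ * Complex.I) * Complex.exp ((-ξ : ℝ) * Complex.I) = 1 := by
        rw [← Complex.exp_add]; simp
      simp only [fold, Bool.false_eq_true, if_false]
      push_cast at this ⊢
      linear_combination -(v : ℂ) * this
    simp only [h, Finset.prod_mul_distrib, Bool.false_eq_true, if_false]
    rw [← mul_sub, norm_mul, norm_prod]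
    simp [Complex.norm_exp_ofReal_mul_I]
  · simp [fold]

end PoissonBinomial

namespace PoissonBinomial

/-! ### Moving the parameters within their intervals -/

section Regroup

variable {n : ℕ}

/-- The parameters, folded into `[0, 1/2]`. -/
noncomputable def folded (p : Fin n → unitInterval) (j : Fin n) : ℝ := fold (side (p j)) (p j)

/-- The indices of the parameters on the given side, in the interval with the given index. -/
noncomputable def cell (ε : ℝ) (ℓ : ℕ) (p : Fin n → unitInterval) (c : Bool × ℕ) :
    Finset (Fin n) :=
  Finset.univ.filter fun j =>
    (side (p j), level ε (var (pbd p)) ℓ (folded p j)) = c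

theorem folded_mem (p : Fin n → unitInterval) (j : Fin n) : folded p j ∈ Set.Icc 0 (1 / 2) :=
  fold_side_mem (p j).2

theorem sum_cells {M : Type*} [AddCommMonoid M] (ε : ℝ) (ℓ : ℕ) (p : Fin n → unitInterval)
    (F : Fin n → M) :
    ∑ j, F j = ∑ c ∈ (Finset.univ : Finset Bool) ×ˢ Finset.range (ℓ + 2), ∑ j ∈ cell ε ℓ p c, F j := by
  classical
  refine (Finset.sum_fiberwise_of_maps_to (fun j _ => ?_) F).symm
  rw [Finset.mem_product, Finset.mem_range]
  exact ⟨Finset.mem_univ _, Nat.lt_succ_of_le (level_le (folded_mem p j).1)⟩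

theorem prod_cells {M : Type*} [CommMonoid M] (ε : ℝ) (ℓ : ℕ) (p : Fin n → unitInterval)
    (F : Fin n → M) :
    ∏ j, F j = ∏ c ∈ (Finset.univ : Finset Bool) ×ˢ Finset.range (ℓ + 2), ∏ j ∈ cell ε ℓ p c, F j := by
  classical
  refine (Finset.prod_fiberwise_of_maps_to (fun j _ => ?_) F).symm
  rw [Finset.mem_product, Finset.mem_range]
  exact ⟨Finset.mem_univ _, Nat.lt_succ_of_le (level_le (folded_mem p j).1)⟩

/-- `y` arises from the folded parameters of `p` by moving them within their intervals, keeping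
the first `k i` power sums in the `i`-th interval and the sum in the last one. -/
structure IsRegrouping (ε : ℝ) (ℓ : ℕ) (k : ℕ → ℕ) (p : Fin n → unitInterval) (y : Fin n → ℝ) :
    Prop where
  mem : ∀ c, ∀ j ∈ cell ε ℓ p c,
    y j ∈ Set.Icc (leftEnd ε (var (pbd p)) ℓ c.2) (rightEnd ε (var (pbd p)) c.2)
  moments : ∀ s, ∀ i ≤ ℓ, ∀ l ≤ k i,
    ∑ j ∈ cell ε ℓ p (s, i), y j ^ l = ∑ j ∈ cell ε ℓ p (s, i), folded p j ^ l
  few : ∀ s, ∀ i ≤ ℓ, ((cell ε ℓ p (s, i)).image y \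
    {leftEnd ε (var (pbd p)) ℓ i, rightEnd ε (var (pbd p)) i}).card ≤ k i
  sum_last : ∀ s, ∑ j ∈ cell ε ℓ p (s, ℓ + 1), y j = ∑ j ∈ cell ε ℓ p (s, ℓ + 1), folded p j
  sq_last : ∀ s, ∑ j ∈ cell ε ℓ p (s, ℓ + 1), folded p j ^ 2 ≤ ∑ j ∈ cell ε ℓ p (s, ℓ + 1), y j ^ 2
  one_last : ∀ s, ∀ i ∈ cell ε ℓ p (s, ℓ + 1), ∀ j ∈ cell ε ℓ p (s, ℓ + 1),
    y i ∈ Set.Ioo 0 (B ε (var (pbd p)) ℓ) → y j ∈ Set.Ioo 0 (B ε (var (pbd p)) ℓ) → i = j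

theorem folded_mem_cell {ε : ℝ} {ℓ : ℕ} {p : Fin n → unitInterval} {c : Bool × ℕ} {j : Fin n}
    (hj : j ∈ cell ε ℓ p c) : folded p j ∈
      Set.Icc (leftEnd ε (var (pbd p)) ℓ c.2) (rightEnd ε (var (pbd p)) c.2) := by
  have h := (Finset.mem_filter.1 hj).2
  rw [← h]
  exact ⟨leftEnd_level_le (folded_mem p j).1, le_rightEnd_level (folded_mem p j)⟩

theorem exists_isRegrouping (ε : ℝ) (ℓ : ℕ) (k : ℕ → ℕ) (p : Fin n → unitInterval) :
    ∃ y, IsRegrouping ε ℓ k p y := by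
  classical
  set V := var (pbd p)
  have h1 : ∀ c : Bool × ℕ, c.2 ≤ ℓ → ∃ u : cell ε ℓ p c → ℝ,
      (∀ j, u j ∈ Set.Icc (leftEnd ε V ℓ c.2) (rightEnd ε V c.2)) ∧
      (∀ l ≤ k c.2, ∑ j, u j ^ l = ∑ j : cell ε ℓ p c, folded p j ^ l) ∧
      (Finset.univ.image u \ {leftEnd ε V ℓ c.2, rightEnd ε V c.2}).card ≤ k c.2 := fun c _ =>
    exists_few_distinct (k c.2) _ _ (fun j : cell ε ℓ p c => folded p j)
      (fun j => folded_mem_cell j.2)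
  have h2 : ∀ c : Bool × ℕ, c.2 = ℓ + 1 → ∃ u : cell ε ℓ p c → ℝ,
      (∀ j, u j ∈ Set.Icc 0 (B ε V ℓ)) ∧
      ∑ j, u j = ∑ j : cell ε ℓ p c, folded p j ∧
      ∑ j : cell ε ℓ p c, folded p j ^ 2 ≤ ∑ j, u j ^ 2 ∧
      ∀ i j, u i ∈ Set.Ioo 0 (B ε V ℓ) → u j ∈ Set.Ioo 0 (B ε V ℓ) → i = j := fun c hc =>
    exists_le_one_inside (B ε V ℓ) (fun j : cell ε ℓ p c => folded p j)
      (fun j => by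
        have := folded_mem_cell j.2
        rwa [hc, leftEnd_last, rightEnd_succ] at this)
  -- The cells are independent of each other. Levels above `ℓ + 1` have empty cells, so the last
  -- branch only makes `u` total.
  set u : ∀ c, cell ε ℓ p c → ℝ := fun c =>
    if h : c.2 ≤ ℓ then (h1 c h).choose else if h : c.2 = ℓ + 1 then (h2 c h).choose
    else fun j => folded p j with hu
  set y : Fin n → ℝ := fun j =>
    u (side (p j), level ε V ℓ (folded p j)) ⟨j, Finset.mem_filter.2 ⟨Finset.mem_univ _, rfl⟩⟩
    with hy
  have hyu : ∀ c, ∀ j : cell ε ℓ p c, y j = u c j := by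
    rintro c ⟨j, hj⟩
    obtain rfl := (Finset.mem_filter.1 hj).2
    rfl
  have hsum : ∀ c, ∀ F : ℝ → ℝ, ∑ j ∈ cell ε ℓ p c, F (y j) = ∑ j, F (u c j) := by
    intro c F
    rw [← Finset.sum_coe_sort (cell ε ℓ p c)]
    exact Finset.sum_congr rfl fun j _ => by rw [hyu]
  have hu1 : ∀ c (h : c.2 ≤ ℓ), u c = (h1 c h).choose := fun c h => by simp [hu, h]
  have hu2 : ∀ c (h : c.2 = ℓ + 1), u c = (h2 c h).choose := fun c h => by simp [hu, h]
  have himg : ∀ c, (cell ε ℓ p c).image y = Finset.univ.image (u c) := by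
    intro c
    ext v
    simp only [Finset.mem_image, Finset.mem_univ, true_and, Subtype.exists]
    constructor
    · rintro ⟨j, hj, rfl⟩
      exact ⟨j, hj, (hyu c ⟨j, hj⟩).symm⟩
    · rintro ⟨j, hj, rfl⟩
      exact ⟨j, hj, hyu c ⟨j, hj⟩⟩
  refine ⟨y, ?_, ?_, ?_, ?_, ?_, ?_⟩
  · intro c j hj
    have hc : c.2 ≤ ℓ + 1 := by
      rw [← (Finset.mem_filter.1 hj).2]
      exact level_le (folded_mem p j).1
    rw [hyu c ⟨j, hj⟩]
    by_cases h : c.2 ≤ ℓ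
    · rw [hu1 c h]; exact (h1 c h).choose_spec.1 _
    · have h' : c.2 = ℓ + 1 := by omega
      have := (h2 c h').choose_spec.1 ⟨j, hj⟩
      rw [hu2 c h']
      rwa [show leftEnd ε (var (pbd p)) ℓ c.2 = 0 by rw [h', leftEnd_last],
        show rightEnd ε (var (pbd p)) c.2 = B ε V ℓ by rw [h', rightEnd_succ]]
  · intro s i hi l hl
    rw [hsum (s, i) (fun v => v ^ l), hu1 (s, i) hi, (h1 (s, i) hi).choose_spec.2.1 l hl,
      Finset.sum_coe_sort (cell ε ℓ p (s, i)) (fun j => folded p j ^ l)]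
  · intro s i hi
    rw [himg, hu1 (s, i) hi]
    exact (h1 (s, i) hi).choose_spec.2.2
  · intro s
    rw [hsum (s, ℓ + 1) (fun v => v), hu2 (s, ℓ + 1) rfl, (h2 (s, ℓ + 1) rfl).choose_spec.2.1,
      Finset.sum_coe_sort (cell ε ℓ p (s, ℓ + 1)) (fun j => folded p j)]
  · intro s
    rw [hsum (s, ℓ + 1) (fun v => v ^ 2), hu2 (s, ℓ + 1) rfl,
      ← Finset.sum_coe_sort (cell ε ℓ p (s, ℓ + 1)) (fun j => folded p j ^ 2)]
    exact (h2 (s, ℓ + 1) rfl).choose_spec.2.2.1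
  · intro s i hi j hj
    rw [hyu (s, ℓ + 1) ⟨i, hi⟩, hyu (s, ℓ + 1) ⟨j, hj⟩, hu2 (s, ℓ + 1) rfl]
    intro h3 h4
    exact congrArg Subtype.val ((h2 (s, ℓ + 1) rfl).choose_spec.2.2.2 _ _ h3 h4)

/-- Unfolding the moved parameters. -/
noncomputable def unfolded (p : Fin n → unitInterval) (y : Fin n → ℝ) (j : Fin n) : unitInterval :=
  Set.projIcc 0 1 zero_le_one (fold (side (p j)) (y j))

end Regroup

section Properties

variable {n : ℕ} {p : Fin n → unitInterval} {ε : ℝ} {ℓ : ℕ} {k : ℕ → ℕ} {y : Fin n → ℝ}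

theorem folded_mul (p : Fin n → unitInterval) (j : Fin n) :
    folded p j * (1 - folded p j) = p j * (1 - p j) := fold_mul _ _

theorem fold_folded (p : Fin n → unitInterval) (j : Fin n) :
    fold (side (p j)) (folded p j) = p j := fold_fold _ _

theorem mem_cell_self (j : Fin n) :
    j ∈ cell ε ℓ p (side (p j), level ε (var (pbd p)) ℓ (folded p j)) :=
  Finset.mem_filter.2 ⟨Finset.mem_univ _, rfl⟩

theorem IsRegrouping.mem_half (hy : IsRegrouping ε ℓ k p y) (h0 : 0 < ε) (h1 : ε ≤ 1 / 4)
    (j : Fin n) : y j ∈ Set.Icc 0 (1 / 2) := by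
  have h := hy.mem _ j (mem_cell_self j)
  exact ⟨(leftEnd_nonneg h0 h1 (var_nonneg p) _).trans h.1,
    h.2.trans (rightEnd_le h0 h1 (var_nonneg p) _)⟩

theorem IsRegrouping.coe_unfolded (hy : IsRegrouping ε ℓ k p y) (h0 : 0 < ε) (h1 : ε ≤ 1 / 4)
    (j : Fin n) :
    (unfolded p y j : ℝ) = fold (side (p j)) (y j) := by
  have h := hy.mem_half h0 h1 j
  rw [unfolded, Set.projIcc_of_mem]
  exact fold_mem ⟨h.1, by linarith [h.2]⟩

end Properties

end PoissonBinomial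

namespace PoissonBinomial

/-! ### Mean, variance and characteristic function after regrouping -/

section Regrouped

variable {n : ℕ} {p : Fin n → unitInterval} {ε : ℝ} {ℓ : ℕ} {k : ℕ → ℕ} {y : Fin n → ℝ}

theorem snd_le_of_mem_cells {c : Bool × ℕ}
    (hc : c ∈ (Finset.univ : Finset Bool) ×ˢ Finset.range (ℓ + 2)) : c.2 ≤ ℓ ∨ c.2 = ℓ + 1 := by
  have := Finset.mem_range.1 (Finset.mem_product.1 hc).2
  omega

theorem IsRegrouping.sum_cell (hy : IsRegrouping ε ℓ k p y) (hk : ∀ i ≤ ℓ, 2 ≤ k i)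
    {c : Bool × ℕ} (hc : c ∈ (Finset.univ : Finset Bool) ×ˢ Finset.range (ℓ + 2)) :
    ∑ j ∈ cell ε ℓ p c, y j = ∑ j ∈ cell ε ℓ p c, folded p j := by
  obtain ⟨s, i⟩ := c
  rcases snd_le_of_mem_cells hc with h | h
  · simpa using hy.moments s i h 1 (by linarith [hk i h])
  · obtain rfl : i = ℓ + 1 := h
    exact hy.sum_last s

theorem IsRegrouping.sum_eq (hy : IsRegrouping ε ℓ k p y) (hk : ∀ i ≤ ℓ, 2 ≤ k i) :
    ∑ j, y j = ∑ j, folded p j := by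
  rw [sum_cells ε ℓ p y, sum_cells ε ℓ p (folded p)]
  exact Finset.sum_congr rfl fun c hc => hy.sum_cell hk hc

/-- On `[0, 1/2]`, `v ≤ 2 * v * (1 - v)`. -/
theorem sum_folded_le (p : Fin n → unitInterval) (T : Finset (Fin n)) :
    ∑ j ∈ T, folded p j ≤ 2 * var (pbd p) := by
  rw [var_pbd, Finset.mul_sum]
  refine (Finset.sum_le_sum_of_subset_of_nonneg (Finset.subset_univ T)
    fun j _ _ => (folded_mem p j).1).trans (Finset.sum_le_sum fun j _ => ?_)
  rw [← folded_mul]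
  have := folded_mem p j
  nlinarith [this.1, this.2]

theorem IsRegrouping.mean_eq (hy : IsRegrouping ε ℓ k p y) (h0 : 0 < ε) (h1 : ε ≤ 1 / 4)
    (hk : ∀ i ≤ ℓ, 2 ≤ k i) : mean (pbd (unfolded p y)) = mean (pbd p) := by
  rw [mean_pbd, mean_pbd, sum_cells ε ℓ p, sum_cells ε ℓ p]
  refine Finset.sum_congr rfl fun c hc => ?_
  have h := hy.sum_cell hk hc
  have hside : ∀ j ∈ cell ε ℓ p c, side (p j) = c.1 := fun j hj => by
    rw [← (Finset.mem_filter.1 hj).2]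
  have hq : ∑ j ∈ cell ε ℓ p c, (unfolded p y j : ℝ) = ∑ j ∈ cell ε ℓ p c, fold c.1 (y j) :=
    Finset.sum_congr rfl fun j hj => by rw [hy.coe_unfolded h0 h1, hside j hj]
  have hp : ∑ j ∈ cell ε ℓ p c, (p j : ℝ) = ∑ j ∈ cell ε ℓ p c, fold c.1 (folded p j) :=
    Finset.sum_congr rfl fun j hj => by rw [← hside j hj, fold_folded]
  rw [hq, hp]
  cases c.1
  · simp only [fold, Bool.false_eq_true, if_false, Finset.sum_sub_distrib]
    rw [h]
  · simpa [fold] using h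

theorem IsRegrouping.var_eq (hy : IsRegrouping ε ℓ k p y) (h0 : 0 < ε) (h1 : ε ≤ 1 / 4) :
    var (pbd (unfolded p y)) = ∑ j, y j - ∑ j, y j ^ 2 := by
  rw [var_pbd, ← Finset.sum_sub_distrib]
  refine Finset.sum_congr rfl fun j _ => ?_
  rw [hy.coe_unfolded h0 h1, fold_mul]
  ring

theorem var_eq_folded (p : Fin n → unitInterval) :
    var (pbd p) = ∑ j, folded p j - ∑ j, folded p j ^ 2 := by
  rw [var_pbd, ← Finset.sum_sub_distrib]
  refine Finset.sum_congr rfl fun j _ => ?_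
  rw [← folded_mul]
  ring

/-- Second moments change only in the last cells. They do not decrease there, and as all points are
at most `B ℓ`, the new sum of squares is at most `B ℓ` times the sum. -/
theorem IsRegrouping.sq_cell (hy : IsRegrouping ε ℓ k p y) (h0 : 0 < ε) (h1 : ε ≤ 1 / 4)
    (hk : ∀ i ≤ ℓ, 2 ≤ k i)
    {c : Bool × ℕ} (hc : c ∈ (Finset.univ : Finset Bool) ×ˢ Finset.range (ℓ + 2)) :
    ∑ j ∈ cell ε ℓ p c, folded p j ^ 2 ≤ ∑ j ∈ cell ε ℓ p c, y j ^ 2 ∧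
    ∑ j ∈ cell ε ℓ p c, y j ^ 2 ≤ ∑ j ∈ cell ε ℓ p c, folded p j ^ 2 +
      B ε (var (pbd p)) ℓ * ∑ j ∈ cell ε ℓ p c, folded p j := by
  have hB := B_pos h0 h1 (var_nonneg p) ℓ
  have hS : 0 ≤ ∑ j ∈ cell ε ℓ p c, folded p j :=
    Finset.sum_nonneg fun j _ => (folded_mem p j).1
  have hsum := hy.sum_cell hk hc
  obtain ⟨s, i⟩ := c
  rcases snd_le_of_mem_cells hc with h | h
  · rw [hy.moments s i h 2 (hk i h)]
    refine ⟨le_rfl, ?_⟩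
    have : 0 ≤ B ε (var (pbd p)) ℓ * ∑ j ∈ cell ε ℓ p (s, i), folded p j := by positivity
    linarith
  · obtain rfl : i = ℓ + 1 := h
    refine ⟨hy.sq_last s, ?_⟩
    have : ∑ j ∈ cell ε ℓ p (s, ℓ + 1), y j ^ 2 ≤
        B ε (var (pbd p)) ℓ * ∑ j ∈ cell ε ℓ p (s, ℓ + 1), y j := by
      rw [Finset.mul_sum]
      refine Finset.sum_le_sum fun j hj => ?_
      have := hy.mem _ j hj
      rw [leftEnd_last, rightEnd_succ] at this
      nlinarith [this.1, this.2]
    rw [hsum] at this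
    have : 0 ≤ ∑ j ∈ cell ε ℓ p (s, ℓ + 1), folded p j ^ 2 :=
      Finset.sum_nonneg fun j _ => sq_nonneg _
    linarith

theorem IsRegrouping.var_le (hy : IsRegrouping ε ℓ k p y) (h0 : 0 < ε) (h1 : ε ≤ 1 / 4)
    (hk : ∀ i ≤ ℓ, 2 ≤ k i) : var (pbd (unfolded p y)) ≤ var (pbd p) := by
  rw [hy.var_eq h0 h1, hy.sum_eq hk, var_eq_folded p]
  have : ∑ j, folded p j ^ 2 ≤ ∑ j, y j ^ 2 := by
    rw [sum_cells ε ℓ p, sum_cells ε ℓ p]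
    exact Finset.sum_le_sum fun c hc => (hy.sq_cell h0 h1 hk hc).1
  linarith

theorem IsRegrouping.var_ge (hy : IsRegrouping ε ℓ k p y) (h0 : 0 < ε) (h1 : ε ≤ 1 / 4)
    (hk : ∀ i ≤ ℓ, 2 ≤ k i) :
    var (pbd p) - B ε (var (pbd p)) ℓ * (2 * var (pbd p)) ≤ var (pbd (unfolded p y)) := by
  have hB := B_pos h0 h1 (var_nonneg p) ℓ
  have h2 : ∑ j, y j ^ 2 ≤ ∑ j, folded p j ^ 2 + B ε (var (pbd p)) ℓ * ∑ j, folded p j := by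
    rw [sum_cells ε ℓ p, sum_cells ε ℓ p (fun j => folded p j ^ 2), sum_cells ε ℓ p (folded p),
      Finset.mul_sum, ← Finset.sum_add_distrib]
    exact Finset.sum_le_sum fun c hc => (hy.sq_cell h0 h1 hk hc).2
  have h3 := mul_le_mul_of_nonneg_left (sum_folded_le p Finset.univ) hB.le
  rw [hy.var_eq h0 h1, hy.sum_eq hk]
  linarith [var_eq_folded p]

/-- Telescoping over cells, not over single parameters, so that power sums within a cell can be
exploited. On the side beyond `1/2` the frequency is reversed by `norm_prod_fold`. -/
theorem IsRegrouping.norm_cf_sub_le (hy : IsRegrouping ε ℓ k p y) (h0 : 0 < ε) (h1 : ε ≤ 1 / 4)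
    (ξ : ℝ) :
    ‖cf p ξ - cf (unfolded p y) ξ‖ ≤
      ∑ c ∈ (Finset.univ : Finset Bool) ×ˢ Finset.range (ℓ + 2),
        ‖∏ j ∈ cell ε ℓ p c,
          (1 + (folded p j : ℂ) * (Complex.exp ((if c.1 then ξ else -ξ : ℝ) * Complex.I) - 1)) -
        ∏ j ∈ cell ε ℓ p c,
          (1 + (y j : ℂ) * (Complex.exp ((if c.1 then ξ else -ξ : ℝ) * Complex.I) - 1))‖ := by
  have hnorm : ∀ (r : Fin n → unitInterval) c, ‖∏ j ∈ cell ε ℓ p c,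
      (1 + ((r j : ℝ) : ℂ) * (Complex.exp (ξ * Complex.I) - 1))‖ ≤ 1 := by
    intro r c
    rw [norm_prod]
    exact Finset.prod_le_one (fun _ _ => norm_nonneg _)
      fun i _ => norm_one_add_mul_exp_sub_one_le (r i).2 ξ
  rw [cf, cf, prod_cells ε ℓ p, prod_cells ε ℓ p]
  refine (norm_prod_sub_prod_le_sum _ _ _ (fun c _ => hnorm p c) (fun c _ => hnorm _ c)).trans ?_
  refine Finset.sum_le_sum fun c hc => ?_
  rw [← norm_prod_fold]
  have hside : ∀ j ∈ cell ε ℓ p c, side (p j) = c.1 := fun j hj => by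
    rw [← (Finset.mem_filter.1 hj).2]
  refine le_of_eq ?_
  congr 2
  · refine Finset.prod_congr rfl fun j hj => ?_
    rw [← hside j hj, fold_folded]
  · refine Finset.prod_congr rfl fun j hj => ?_
    rw [← hside j hj, hy.coe_unfolded h0 h1]

theorem IsRegrouping.norm_cell_le_of_small (hy : IsRegrouping ε ℓ k p y) (h0 : 0 < ε)
    (h1 : ε ≤ 1 / 4) {s : Bool} {i m : ℕ} (hm : 1 ≤ m) (ξ : ℝ)
    (hsmall : rightEnd ε (var (pbd p)) i * ‖Complex.exp (ξ * Complex.I) - 1‖ ≤ 1 / 2)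
    (hmom : ∀ l ≤ m,
      ∑ j ∈ cell ε ℓ p (s, i), y j ^ l = ∑ j ∈ cell ε ℓ p (s, i), folded p j ^ l) :
    ‖∏ j ∈ cell ε ℓ p (s, i), (1 + (folded p j : ℂ) * (Complex.exp (ξ * Complex.I) - 1)) -
      ∏ j ∈ cell ε ℓ p (s, i), (1 + (y j : ℂ) * (Complex.exp (ξ * Complex.I) - 1))‖ ≤
    8 * (rightEnd ε (var (pbd p)) i * ‖Complex.exp (ξ * Complex.I) - 1‖) ^ m *
      ∑ j ∈ cell ε ℓ p (s, i), folded p j := by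
  refine norm_prod_sub_prod_le_of_small _ _ _ _ hm (norm_exp_sub_one_le_two ξ) hsmall
    (fun j hj => ⟨(folded_mem p j).1, (folded_mem_cell hj).2⟩)
    (fun j hj => ⟨(hy.mem_half h0 h1 j).1, (hy.mem _ j hj).2⟩)
    (fun j _ => ?_) (fun j _ => ?_) hmom
  · have := folded_mem p j
    exact norm_one_add_mul_exp_sub_one_le ⟨this.1, by linarith [this.2]⟩ ξ
  · have := hy.mem_half h0 h1 j
    exact norm_one_add_mul_exp_sub_one_le ⟨this.1, by linarith [this.2]⟩ ξ

theorem IsRegrouping.norm_cell_le_of_sum (hy : IsRegrouping ε ℓ k p y) (h0 : 0 < ε)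
    (h1 : ε ≤ 1 / 4) {s : Bool} {i m : ℕ} (hm : 1 ≤ m) (ξ : ℝ)
    (hmom : ∀ l ≤ m,
      ∑ j ∈ cell ε ℓ p (s, i), y j ^ l = ∑ j ∈ cell ε ℓ p (s, i), folded p j ^ l) :
    ‖∏ j ∈ cell ε ℓ p (s, i), (1 + (folded p j : ℂ) * (Complex.exp (ξ * Complex.I) - 1)) -
      ∏ j ∈ cell ε ℓ p (s, i), (1 + (y j : ℂ) * (Complex.exp (ξ * Complex.I) - 1))‖ ≤
    2 * (1 / 2) ^ m * Real.exp (4 * (2 * var (pbd p))) := by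
  have := norm_prod_sub_prod_le_of_sum (fun j : cell ε ℓ p (s, i) => folded p j)
    (fun j : cell ε ℓ p (s, i) => y j) (Complex.exp (ξ * Complex.I) - 1) hm
    (norm_exp_sub_one_le_two ξ) (fun j => (folded_mem p j).1) (fun j => (hy.mem_half h0 h1 j).1)
    (fun l hl => by
      rw [Finset.sum_coe_sort (cell ε ℓ p (s, i)) (fun j => y j ^ l),
        Finset.sum_coe_sort (cell ε ℓ p (s, i)) (fun j => folded p j ^ l)]
      exact hmom l hl)
  rw [Finset.prod_coe_sort (cell ε ℓ p (s, i))
      (fun j => 1 + (folded p j : ℂ) * (Complex.exp (ξ * Complex.I) - 1)),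
    Finset.prod_coe_sort (cell ε ℓ p (s, i))
      (fun j => 1 + (y j : ℂ) * (Complex.exp (ξ * Complex.I) - 1)),
    Finset.sum_coe_sort (cell ε ℓ p (s, i)) (fun j => folded p j)] at this
  refine this.trans ?_
  have h := sum_folded_le p (cell ε ℓ p (s, i))
  gcongr

end Regrouped

end PoissonBinomial

namespace PoissonBinomial

/-! ### Total variation distance after regrouping -/

section Closeness

variable {n : ℕ} {p : Fin n → unitInterval} {ε : ℝ} {ℓ : ℕ} {k : ℕ → ℕ} {y : Fin n → ℝ}

/-- The cells other than the first on each side contribute little. -/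
theorem IsRegrouping.norm_cell_succ_le (hy : IsRegrouping ε ℓ k p y) (h0 : 0 < ε)
    (h1 : ε ≤ 1 / 4) (hk : ∀ i ≤ ℓ, 2 ≤ k i) {m : ℕ}
    (hB : B ε (var (pbd p)) ℓ ≤ ε ^ (4 * m + 1))
    (hBk : ∀ i ≤ ℓ, B ε (var (pbd p)) i ^ k i ≤ ε ^ (4 * m))
    {s : Bool} {i : ℕ} (hi : i ≤ ℓ) (ξ : ℝ) :
    ‖∏ j ∈ cell ε ℓ p (s, i + 1), (1 + (folded p j : ℂ) * (Complex.exp (ξ * Complex.I) - 1)) -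
      ∏ j ∈ cell ε ℓ p (s, i + 1), (1 + (y j : ℂ) * (Complex.exp (ξ * Complex.I) - 1))‖ ≤
    8 * ε ^ m * ∑ j ∈ cell ε ℓ p (s, i + 1), folded p j := by
  have hz := norm_exp_sub_one_le_two ξ
  set V := var (pbd p)
  have hV : 0 ≤ V := var_nonneg p
  have hb := B_pos h0 h1 hV i
  have hb4 := B_le h0 h1 hV i
  have hS : 0 ≤ ∑ j ∈ cell ε ℓ p (s, i + 1), folded p j :=
    Finset.sum_nonneg fun j _ => (folded_mem p j).1
  have hsmall : rightEnd ε V (i + 1) * ‖Complex.exp (ξ * Complex.I) - 1‖ ≤ 1 / 2 := by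
    rw [rightEnd_succ]; nlinarith [norm_nonneg (Complex.exp (ξ * Complex.I) - 1)]
  have hle : rightEnd ε V (i + 1) * ‖Complex.exp (ξ * Complex.I) - 1‖ ≤ 2 * B ε V i := by
    rw [rightEnd_succ]; nlinarith [norm_nonneg (Complex.exp (ξ * Complex.I) - 1)]
  have hnn : 0 ≤ rightEnd ε V (i + 1) * ‖Complex.exp (ξ * Complex.I) - 1‖ := by
    rw [rightEnd_succ]; positivity
  -- Cells up to level `ℓ` keep `k` power sums. The last one keeps only the sum, and its error is
  -- paid for by the smallness of `B ℓ`.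
  rcases Nat.lt_or_ge i ℓ with h | h
  · refine (hy.norm_cell_le_of_small h0 h1 (m := k (i + 1)) (by linarith [hk (i + 1) h]) ξ hsmall
      (hy.moments s (i + 1) h)).trans ?_
    have hpow : (rightEnd ε V (i + 1) * ‖Complex.exp (ξ * Complex.I) - 1‖) ^ k (i + 1) ≤ ε ^ m := by
      -- Fourth powers turn the right end of the cell into its left end, which the hypothesis
      -- controls: `(2 * B i) ^ 4 ≤ B i ^ 2 = B (i + 1)`, because `16 * B i ^ 2 ≤ 1`.
      refine le_of_pow_le_pow_left₀ (n := 4) (by norm_num) (by positivity) ?_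
      rw [← pow_mul, ← pow_mul]
      calc _ ≤ (2 * B ε V i) ^ (k (i + 1) * 4) := by gcongr
        _ = ((2 * B ε V i) ^ 4) ^ k (i + 1) := pow_mul' _ _ _
        _ ≤ (B ε V (i + 1)) ^ k (i + 1) := by
            rw [B_succ]
            gcongr
            have h16 : B ε V i ^ 2 ≤ 1 / 16 := by nlinarith
            calc (2 * B ε V i) ^ 4 = B ε V i ^ 2 * (16 * B ε V i ^ 2) := by ring
              _ ≤ B ε V i ^ 2 * 1 := by gcongr; linarith
              _ = B ε V i ^ 2 := mul_one _
        _ ≤ ε ^ (4 * m) := hBk _ h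
        _ = ε ^ (m * 4) := by rw [mul_comm]
    gcongr
  · obtain rfl : i = ℓ := le_antisymm hi h
    refine (hy.norm_cell_le_of_small h0 h1 (m := 1) le_rfl ξ hsmall (fun l hl => ?_)).trans ?_
    · interval_cases l
      · simp
      · simpa using hy.sum_last s
    have : (rightEnd ε V (i + 1) * ‖Complex.exp (ξ * Complex.I) - 1‖) ^ 1 ≤ ε ^ m := by
      rw [pow_one]
      calc _ ≤ 2 * B ε V i := hle
        _ ≤ 2 * (ε ^ (4 * m) * ε) := by rw [← pow_succ]; gcongr
        _ ≤ ε ^ (4 * m) := by nlinarith [pow_pos h0 (4 * m)]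
        _ ≤ ε ^ m := pow_le_pow_of_le_one h0.le (by linarith) (by omega)
    gcongr

/-- All cells except the two next to `1/2` are covered by `norm_cell_succ_le`. The summand `2 * ε ^
m` leaves room for a bound on those two that does not involve the sum of their parameters. -/
theorem IsRegrouping.norm_cf_sub_le_of_first (hy : IsRegrouping ε ℓ k p y) (h0 : 0 < ε)
    (h1 : ε ≤ 1 / 4) (hk : ∀ i ≤ ℓ, 2 ≤ k i) {m : ℕ}
    (hB : B ε (var (pbd p)) ℓ ≤ ε ^ (4 * m + 1))
    (hBk : ∀ i ≤ ℓ, B ε (var (pbd p)) i ^ k i ≤ ε ^ (4 * m)) (ξ : ℝ)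
    (hfirst : ∀ s : Bool,
      ‖∏ j ∈ cell ε ℓ p (s, 0),
          (1 + (folded p j : ℂ) * (Complex.exp ((if s then ξ else -ξ : ℝ) * Complex.I) - 1)) -
        ∏ j ∈ cell ε ℓ p (s, 0),
          (1 + (y j : ℂ) * (Complex.exp ((if s then ξ else -ξ : ℝ) * Complex.I) - 1))‖ ≤
      8 * ε ^ m * ∑ j ∈ cell ε ℓ p (s, 0), folded p j + 2 * ε ^ m) :
    ‖cf p ξ - cf (unfolded p y) ξ‖ ≤ ε ^ m * (16 * var (pbd p) + 4) := by
  have hεm := pow_pos h0 m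
  have hcell : ∀ c ∈ (Finset.univ : Finset Bool) ×ˢ Finset.range (ℓ + 2),
      ‖∏ j ∈ cell ε ℓ p c,
          (1 + (folded p j : ℂ) * (Complex.exp ((if c.1 then ξ else -ξ : ℝ) * Complex.I) - 1)) -
        ∏ j ∈ cell ε ℓ p c,
          (1 + (y j : ℂ) * (Complex.exp ((if c.1 then ξ else -ξ : ℝ) * Complex.I) - 1))‖ ≤
      8 * ε ^ m * ∑ j ∈ cell ε ℓ p c, folded p j + (if c.2 = 0 then 2 * ε ^ m else 0) := by
    rintro ⟨s, i⟩ hc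
    rcases i with _ | i
    · simpa using hfirst s
    · have hi : i ≤ ℓ := by
        rcases snd_le_of_mem_cells hc with h | h <;> simp only at h <;> omega
      simpa using hy.norm_cell_succ_le h0 h1 hk hB hBk hi (if s then ξ else -ξ)
  refine (hy.norm_cf_sub_le h0 h1 ξ).trans ((Finset.sum_le_sum hcell).trans ?_)
  rw [Finset.sum_add_distrib, ← Finset.mul_sum, ← sum_cells, Finset.sum_product]
  have := sum_folded_le p Finset.univ
  simp
  nlinarith

theorem exp_mul_log_inv {ε : ℝ} (h0 : 0 < ε) (m : ℕ) :
    Real.exp (-(m * Real.log (1 / ε))) = ε ^ m := by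
  rw [one_div, Real.log_inv, mul_neg, neg_neg, ← Real.log_pow, Real.exp_log (by positivity)]

/-- The constant `K` is the square of the number of multiples of `R` up to which the
characteristic functions are compared factor by factor. -/
theorem IsRegrouping.norm_cf_sub_le_pow (hy : IsRegrouping ε ℓ k p y) (h0 : 0 < ε)
    (h1 : ε ≤ 1 / 4) (hk : ∀ i ≤ ℓ, 2 ≤ k i) {m K : ℕ} (hm : 2 ≤ m) (hK : 10 * (m + 1) ≤ K)
    (hVm : var (pbd p) ≤ (1 / ε) ^ m)
    (hB : B ε (var (pbd p)) ℓ ≤ ε ^ (4 * m + 1))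
    (hBk : ∀ i ≤ ℓ, B ε (var (pbd p)) i ^ k i ≤ ε ^ (4 * m * (K ^ 2 * (8 * K ^ 4 + 1))))
    {ξ : ℝ} (hξ : |ξ| ≤ Real.pi) :
    ‖cf p ξ - cf (unfolded p y) ξ‖ ≤ ε ^ m * (16 * var (pbd p) + 4) := by
  have hεm := pow_pos h0 m
  have hε1 : ε ≤ 1 := by linarith
  set V := var (pbd p) with hVdef
  have hV : 0 ≤ V := var_nonneg p
  have hR := R_pos h0 h1 hV
  have hR4 := R_le (ε := ε) (V := V)
  have hlog := log_inv_pos h0 h1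
  have hK1 : (10 : ℝ) * (m + 1) ≤ K := by exact_mod_cast hK
  have hKpos : 0 < (K : ℝ) := by have : (0 : ℝ) ≤ m := by positivity
                                 linarith
  have hK1' : (1 : ℝ) ≤ K := by have : (0 : ℝ) ≤ m := by positivity
                                linarith
  have hM1 : 1 ≤ K ^ 2 * (8 * K ^ 4 + 1) := Nat.one_le_iff_ne_zero.2 (by
    have : K ≠ 0 := by omega
    positivity)
  have hBk' : ∀ i ≤ ℓ, B ε V i ^ k i ≤ ε ^ (4 * m) := fun i hi =>
    (hBk i hi).trans (pow_le_pow_of_le_one h0.le hε1 (Nat.le_mul_of_pos_right _ hM1))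
  have hS : ∀ c, 0 ≤ ∑ j ∈ cell ε ℓ p c, folded p j := fun c =>
    Finset.sum_nonneg fun j _ => (folded_mem p j).1
  -- For small `R` the frequencies split at `K * R`: below, the factor `‖z‖` makes the expansion
  -- converge fast; above, both characteristic functions are tiny. For `R > 1 / K ^ 2` the variance
  -- is `O(log (1/ε))` and symmetric functions are compared at all frequencies.
  rcases le_or_gt ((K : ℝ) ^ 2 * R ε V) 1 with hsm | hbig
  · rcases le_or_gt |ξ| (K * R ε V) with hnear | hfar
    · refine hy.norm_cf_sub_le_of_first h0 h1 hk hB hBk' ξ fun s => ?_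
      set ξ' : ℝ := if s then ξ else -ξ with hξ'
      have hξabs : |ξ'| = |ξ| := by rw [hξ']; split_ifs <;> simp
      have hz : ‖Complex.exp (ξ' * Complex.I) - 1‖ ≤ K * R ε V :=
        (norm_exp_sub_one_le_abs ξ').trans (by rw [hξabs]; exact hnear)
      have hKR : (K : ℝ) * R ε V ≤ 1 := by nlinarith
      have hle : rightEnd ε V 0 * ‖Complex.exp (ξ' * Complex.I) - 1‖ ≤ K * R ε V / 2 := by
        simp only [rightEnd, if_true]; linarith
      have hnn : 0 ≤ rightEnd ε V 0 * ‖Complex.exp (ξ' * Complex.I) - 1‖ := by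
        simp only [rightEnd, if_true]; positivity
      refine (hy.norm_cell_le_of_small h0 h1 (m := k 0) (by linarith [hk 0 (Nat.zero_le _)]) ξ'
        (by linarith) (hy.moments s 0 (Nat.zero_le _))).trans ?_
      have hpow : (rightEnd ε V 0 * ‖Complex.exp (ξ' * Complex.I) - 1‖) ^ k 0 ≤ ε ^ m := by
        -- Squares suffice here: `(K * R / 2) ^ 2 ≤ R = B 0`, because `K ^ 2 * R ≤ 1`.
        refine le_of_pow_le_pow_left₀ (n := 2) (by norm_num) (by positivity) ?_
        rw [← pow_mul, ← pow_mul]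
        calc _ ≤ (K * R ε V / 2) ^ (k 0 * 2) := by gcongr
          _ = ((K * R ε V / 2) ^ 2) ^ k 0 := pow_mul' _ _ _
          _ ≤ (B ε V 0) ^ k 0 := by
              rw [B_zero]
              gcongr
              nlinarith
          _ ≤ ε ^ (4 * m) := hBk' _ (Nat.zero_le _)
          _ ≤ ε ^ (m * 2) := pow_le_pow_of_le_one h0.le hε1 (by omega)
      have hS0 := hS (s, 0)
      calc _ ≤ 8 * ε ^ m * ∑ j ∈ cell ε ℓ p (s, 0), folded p j := by gcongr
        _ ≤ _ := by linarith
    · have hRlt : R ε V < 1 / 4 := by nlinarith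
      have hVR := mul_R_sq_eq h0 h1 hV hRlt
      have hVbig : 16 ≤ V := by nlinarith
      -- The variance lost by regrouping is at most `1`. As `V ≥ 16`, at least half of it survives,
      -- and both characteristic functions decay.
      have hBV : B ε V ℓ * (2 * V) ≤ 1 := by
        have h2 : (1 / ε) ^ m * ε ^ m = 1 := by rw [← mul_pow, one_div_mul_cancel h0.ne', one_pow]
        have h3 : B ε V ℓ ≤ ε ^ m * ε := by
          rw [← pow_succ]
          exact hB.trans (pow_le_pow_of_le_one h0.le hε1 (by omega))
        have h4 : B ε V ℓ * V ≤ (ε ^ m * ε) * (1 / ε) ^ m := by gcongr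
        have h5 : (ε ^ m * ε) * (1 / ε) ^ m = ε := by linear_combination ε * h2
        linarith
      have hVq : V / 2 ≤ var (pbd (unfolded p y)) := by
        have := hy.var_ge h0 h1 hk
        rw [← hVdef] at this
        linarith
      have hsq : (K * R ε V) ^ 2 ≤ ξ ^ 2 := by
        rw [← sq_abs ξ]; gcongr
      -- The factor `10` makes up for the `1/5` in the decay rate and for the halved variance.
      have hKm : 10 * m * Real.log (1 / ε) ≤ V * ξ ^ 2 := by
        calc 10 * m * Real.log (1 / ε) ≤ (K : ℝ) ^ 2 * Real.log (1 / ε) := by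
              have : (0 : ℝ) ≤ m := by positivity
              gcongr
              nlinarith
          _ = V * (K * R ε V) ^ 2 := by rw [← hVR]; ring
          _ ≤ V * ξ ^ 2 := by gcongr
      have hbound : ∀ r : Fin n → unitInterval, V / 2 ≤ var (pbd r) → ‖cf r ξ‖ ≤ ε ^ m := by
        intro r hr
        refine (norm_cf_le r hξ).trans ?_
        rw [← exp_mul_log_inv h0, Real.exp_le_exp]
        nlinarith [sq_nonneg ξ]
      refine (norm_sub_le _ _).trans ?_
      have ha := hbound p (by rw [← hVdef]; linarith)
      have hb := hbound _ hVq
      nlinarith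
  · refine hy.norm_cf_sub_le_of_first h0 h1 hk hB hBk' ξ fun s => ?_
    refine (hy.norm_cell_le_of_sum h0 h1 (m := k 0) (by linarith [hk 0 (Nat.zero_le _)]) _
      (hy.moments s 0 (Nat.zero_le _))).trans ?_
    have hhalf : (1 / 2 : ℝ) ^ k 0 ≤ ε ^ (m * (8 * K ^ 4 + 1)) := by
      refine le_of_pow_le_pow_left₀ (n := K ^ 2) (by
        have : K ≠ 0 := by omega
        positivity) (by positivity) ?_
      rw [← pow_mul, ← pow_mul]
      -- A power of `1/2` with constant exponent lies below `R`, since `2 ^ K ^ 2 > K ^ 2 > 1 / R`.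
      -- This converts the hypothesis on `B 0 ^ k 0` into a bound on `(1/2) ^ k 0`.
      have h2K : ((1 : ℝ) / 2) ^ (K ^ 2) ≤ R ε V := by
        have h3 : ((K ^ 2 : ℕ) : ℝ) < ((2 ^ (K ^ 2) : ℕ) : ℝ) := by
          exact_mod_cast Nat.lt_two_pow_self
        push_cast at h3
        rw [one_div, inv_pow, inv_le_comm₀ (by positivity) hR]
        have : (R ε V)⁻¹ ≤ (K : ℝ) ^ 2 := by
          rw [inv_le_iff_one_le_mul₀ hR]; linarith
        linarith
      calc ((1 : ℝ) / 2) ^ (k 0 * K ^ 2) = (((1 : ℝ) / 2) ^ (K ^ 2)) ^ k 0 := pow_mul' _ _ _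
        _ ≤ B ε V 0 ^ k 0 := by rw [B_zero]; gcongr
        _ ≤ _ := hBk 0 (Nat.zero_le _)
        _ ≤ ε ^ (m * (8 * K ^ 4 + 1) * K ^ 2) := by
            refine pow_le_pow_of_le_one h0.le hε1 ?_
            nlinarith [Nat.zero_le (m * (8 * K ^ 4 + 1) * K ^ 2)]
    have hVlog : V ≤ K ^ 4 * Real.log (1 / ε) := by
      have h2 := mul_R_sq_le h0 h1 hV
      have h3 : (1 : ℝ) ≤ (K ^ 2 * R ε V) ^ 2 := by nlinarith
      calc V = V * 1 := (mul_one V).symm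
        _ ≤ V * (K ^ 2 * R ε V) ^ 2 := by gcongr
        _ = K ^ 4 * (V * R ε V ^ 2) := by ring
        _ ≤ _ := by gcongr
    -- The growth `exp (8 * V)` of the symmetric function bound costs at most `ε ^ (-8 * K ^ 4)`;
    -- the factor `8 * K ^ 4 + 1` in the exponent of `hBk` was put there to pay for it.
    have hexp : Real.exp (4 * (2 * V)) * ε ^ (8 * K ^ 4) ≤ 1 := by
      rw [← exp_mul_log_inv h0, ← Real.exp_add, Real.exp_le_one_iff]
      push_cast
      linarith
    have hS0 := hS (s, 0)
    calc 2 * (1 / 2) ^ k 0 * Real.exp (4 * (2 * V))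
        ≤ 2 * ε ^ (m * (8 * K ^ 4 + 1)) * Real.exp (4 * (2 * V)) := by gcongr
      _ ≤ 2 * ε ^ (m + 8 * K ^ 4) * Real.exp (4 * (2 * V)) := by
          gcongr ?_ * ?_ * _
          refine pow_le_pow_of_le_one h0.le hε1 ?_
          nlinarith [Nat.zero_le (K ^ 4)]
      _ = 2 * ε ^ m * (Real.exp (4 * (2 * V)) * ε ^ (8 * K ^ 4)) := by rw [pow_add]; ring
      _ ≤ 2 * ε ^ m * 1 := by gcongr
      _ ≤ _ := by
          have : 0 ≤ 8 * ε ^ m * ∑ j ∈ cell ε ℓ p (s, 0), folded p j := by positivity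
          linarith

/-- The window half-width `4 * (V + 1) / ε` makes the Chebyshev term at most `ε ^ 2 / 8`. The window
length and the factor `16 * V + 4` each cost up to `ε ^ (-A)` and bounded powers of `1/ε`, which `m
≥ 2 * A + 10` outweighs. -/
theorem IsRegrouping.dTV_lt (hy : IsRegrouping ε ℓ k p y) (h0 : 0 < ε)
    (h1 : ε ≤ 1 / 4) (hk : ∀ i ≤ ℓ, 2 ≤ k i) {A m K : ℕ} (hm : 2 * A + 10 ≤ m)
    (hK : 10 * (m + 1) ≤ K) (hVA : var (pbd p) ≤ (1 / ε) ^ A)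
    (hB : B ε (var (pbd p)) ℓ ≤ ε ^ (4 * m + 1))
    (hBk : ∀ i ≤ ℓ, B ε (var (pbd p)) i ^ k i ≤ ε ^ (4 * m * (K ^ 2 * (8 * K ^ 4 + 1)))) :
    dTV (pbd p) (pbd (unfolded p y)) < ε ^ 2 := by
  set V := var (pbd p) with hVdef
  have hV : 0 ≤ V := var_nonneg p
  have hinv : 1 ≤ 1 / ε := by rw [le_div_iff₀ h0]; linarith
  have hVm : V ≤ (1 / ε) ^ m := hVA.trans (pow_le_pow_right₀ hinv (by omega))
  have hT : 0 < 4 * (V + 1) / ε := by positivity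
  have hmain := dTV_pbd_le p (unfolded p y) (ε ^ m * (16 * V + 4)) (4 * (V + 1) / ε) hT
    (fun ξ hξ => hy.norm_cf_sub_le_pow h0 h1 hk (by omega) hK hVm hB hBk hξ)
    (hy.mean_eq h0 h1 hk) (hy.var_le h0 h1 hk)
  refine hmain.trans_lt ?_
  rw [← hVdef]
  have hA1 : 1 ≤ (1 / ε) ^ A := one_le_pow₀ hinv
  have hεA : (1 / ε) ^ A * ε ^ A = 1 := by
    rw [← mul_pow, one_div_mul_cancel h0.ne', one_pow]
  have hVε : (V + 1) * ε ^ A ≤ 2 := by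
    have : (V + 1) * ε ^ A ≤ (2 * (1 / ε) ^ A) * ε ^ A := by
      gcongr; linarith
    rw [mul_assoc, hεA] at this
    linarith
  have hterm1 : (2 * (4 * (V + 1) / ε) + 1) * (ε ^ m * (16 * V + 4)) ≤ ε ^ 2 / 2 := by
    have e1 : ε ^ m ≤ ε ^ A * ε ^ A * ε ^ 10 := by
      rw [← pow_add, ← pow_add]
      exact pow_le_pow_of_le_one h0.le (by linarith) (by omega)
    have e2 : 2 * (4 * (V + 1) / ε) + 1 ≤ 9 * (V + 1) / ε := by
      have : 1 ≤ (V + 1) / ε := by rw [le_div_iff₀ h0]; linarith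
      have h3 : 2 * (4 * (V + 1) / ε) = 8 * ((V + 1) / ε) := by ring
      have h4 : 9 * (V + 1) / ε = 9 * ((V + 1) / ε) := by ring
      linarith
    have e4 : ε ^ 7 ≤ (1 / 4) ^ 7 := by gcongr
    calc _ ≤ (9 * (V + 1) / ε) * ((ε ^ A * ε ^ A * ε ^ 10) * (16 * (V + 1))) := by
          gcongr
          linarith
      _ = 144 * ε ^ 9 * (((V + 1) * ε ^ A) * ((V + 1) * ε ^ A)) := by
          field_simp
          ring
      _ ≤ 144 * ε ^ 9 * (2 * 2) := by gcongr
      _ = ε ^ 2 * (576 * ε ^ 7) := by ring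
      _ ≤ ε ^ 2 * (1 / 2) := by gcongr; linarith
      _ = _ := by ring
  have hterm2 : 2 * (V / (4 * (V + 1) / ε) ^ 2) ≤ ε ^ 2 / 8 := by
    rw [show 2 * (V / (4 * (V + 1) / ε) ^ 2) = ε ^ 2 / 8 * (V / (V + 1) ^ 2) by
      field_simp; ring]
    have : V / (V + 1) ^ 2 ≤ 1 := by
      rw [div_le_one (by positivity)]; nlinarith
    have h2 : 0 ≤ ε ^ 2 / 8 := by positivity
    nlinarith
  have : 0 < ε ^ 2 := by positivity
  linarith

end Closeness

end PoissonBinomial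

namespace PoissonBinomial

/-! ### Counting parameters -/

section Count

variable {ε V : ℝ} {ℓ : ℕ}

theorem mem_set_I (h0 : 0 < ε) (h1 : ε ≤ 1 / 4) (hV : 0 ≤ V) {i : Fin (ℓ + 2)} {v : ℝ}
    (hv : v ∈ (IntervalName.I i : IntervalName ℓ).set ε V) :
    v ∈ Set.Icc (leftEnd ε V ℓ i) (rightEnd ε V i) ∧ 0 < v := by
  have hi := i.2
  simp only [IntervalName.set] at hv
  split_ifs at hv with h2 h3
  · refine ⟨hv, lt_of_lt_of_le ?_ hv.1⟩
    rw [leftEnd, if_pos (by omega)]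
    exact B_pos h0 h1 hV _
  · refine ⟨⟨hv.1, hv.2.le⟩, lt_of_lt_of_le ?_ hv.1⟩
    rw [leftEnd, if_pos (by omega)]
    exact B_pos h0 h1 hV _
  · refine ⟨⟨hv.1.le, hv.2.le⟩, lt_of_le_of_lt (leftEnd_nonneg h0 h1 hV _) hv.1⟩

theorem mem_set_J {i : Fin (ℓ + 2)} {v : ℝ}
    (hv : v ∈ (IntervalName.J i : IntervalName ℓ).set ε V) :
    1 - v ∈ Set.Ico (leftEnd ε V ℓ i) (rightEnd ε V i) := by
  simp only [IntervalName.set] at hv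
  constructor <;> linarith [hv.1, hv.2]

theorem mem_set_I_last {v : ℝ} :
    v ∈ (IntervalName.I (Fin.last (ℓ + 1)) : IntervalName ℓ).set ε V ↔
      v ∈ Set.Ioo 0 (B ε V ℓ) := by
  simp [IntervalName.set, leftEnd, rightEnd]

theorem mem_set_J_last {v : ℝ} :
    v ∈ (IntervalName.J (Fin.last (ℓ + 1)) : IntervalName ℓ).set ε V \ {1} ↔
      1 - v ∈ Set.Ioo 0 (B ε V ℓ) := by
  simp only [IntervalName.set, leftEnd, rightEnd, Fin.val_last, Set.mem_sdiff, Set.mem_Ioc,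
    Set.mem_singleton_iff, Set.mem_Ioo]
  simp
  constructor
  · rintro ⟨⟨h1, h2⟩, h3⟩
    exact ⟨lt_of_le_of_ne h2 h3, by linarith⟩
  · rintro ⟨h1, h2⟩
    exact ⟨⟨by linarith, h1.le⟩, h1.ne⟩

variable {n : ℕ}

/-- Each parameter in `S` contributes at least `b / 2` to the variance. -/
theorem numParams_le_of_le (q : Fin n → unitInterval) (S : Set ℝ) {b : ℝ} (hb : 0 < b)
    (hS : ∀ j, (q j : ℝ) ∈ S → b ≤ 2 * ((q j : ℝ) * (1 - q j))) :
    (numParams q S : ℝ) ≤ 2 * var (pbd q) / b := by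
  classical
  rw [le_div_iff₀ hb, var_pbd, Finset.mul_sum, numParams, Set.ncard_eq_toFinset_card',
    ← nsmul_eq_mul, ← Finset.sum_const]
  refine (Finset.sum_le_sum fun j hj => ?_).trans
    (Finset.sum_le_sum_of_subset_of_nonneg (Finset.subset_univ _) fun j _ _ => ?_)
  · exact hS j (by simpa using hj)
  · have := (q j).2
    exact mul_nonneg (by norm_num) (mul_nonneg this.1 (by linarith [this.2]))

theorem numParams_I_le (h0 : 0 < ε) (h1 : ε ≤ 1 / 4) (hV : 0 ≤ V) (q : Fin n → unitInterval)
    (hq : var (pbd q) ≤ V) {i : Fin (ℓ + 2)} (hi : (i : ℕ) ≤ ℓ) :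
    (numParams q ((IntervalName.I i : IntervalName ℓ).set ε V) : ℝ) ≤ 2 * V / B ε V i := by
  have hB := B_pos h0 h1 hV i
  refine (numParams_le_of_le q _ hB fun j hj => ?_).trans (by gcongr)
  have h := (mem_set_I h0 h1 hV hj).1
  rw [leftEnd, if_pos hi] at h
  nlinarith [h.1, h.2, rightEnd_le h0 h1 hV i]

theorem numParams_J_le (h0 : 0 < ε) (h1 : ε ≤ 1 / 4) (hV : 0 ≤ V) (q : Fin n → unitInterval)
    (hq : var (pbd q) ≤ V) {i : Fin (ℓ + 2)} (hi : (i : ℕ) ≤ ℓ) :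
    (numParams q ((IntervalName.J i : IntervalName ℓ).set ε V) : ℝ) ≤ 2 * V / B ε V i := by
  have hB := B_pos h0 h1 hV i
  refine (numParams_le_of_le q _ hB fun j hj => ?_).trans (by gcongr)
  have h := mem_set_J hj
  rw [leftEnd, if_pos hi] at h
  nlinarith [h.1, h.2, rightEnd_le h0 h1 hV i]

theorem numParams_eq_sum (q : Fin n → unitInterval) (S : Set ℝ) [DecidablePred (· ∈ S)] :
    (numParams q S : ℝ) = ∑ j, if (q j : ℝ) ∈ S then 1 else 0 := by
  classical
  rw [numParams, Set.ncard_eq_toFinset_card', Finset.sum_boole]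
  congr 2
  ext j
  simp

/-- The parameters other than `1` make up little of the mean. -/
theorem mean_sub_ones (h0 : 0 < ε) (h1 : ε ≤ 1 / 4) (hV : 0 ≤ V) (q : Fin n → unitInterval)
    (hq : var (pbd q) ≤ V)
    (hl : numParams q ((IntervalName.J (Fin.last (ℓ + 1)) : IntervalName ℓ).set ε V \ {1}) ≤ 1) :
    (numParams q {1} : ℝ) ≤ mean (pbd q) ∧
      mean (pbd q) ≤ numParams q {1} + (V / B ε V ℓ + 1) := by
  classical
  have hB := B_pos h0 h1 hV ℓ
  rw [numParams_eq_sum, mean_pbd]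
  constructor
  · refine Finset.sum_le_sum fun j _ => ?_
    have := (q j).2
    split_ifs with h
    · rw [Set.mem_singleton_iff.1 h]
    · exact this.1
  · have hl' : (numParams q
        ((IntervalName.J (Fin.last (ℓ + 1)) : IntervalName ℓ).set ε V \ {1}) : ℝ) ≤ 1 := by
      exact_mod_cast hl
    have hVB : (∑ j, (q j : ℝ) * (1 - q j)) / B ε V ℓ ≤ V / B ε V ℓ := by
      rw [← var_pbd]; gcongr
    rw [numParams_eq_sum] at hl'
    refine le_trans ?_ (add_le_add le_rfl (add_le_add hVB hl'))
    rw [Finset.sum_div, ← Finset.sum_add_distrib, ← Finset.sum_add_distrib]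
    refine Finset.sum_le_sum fun j _ => ?_
    have hj := (q j).2
    have hnn : 0 ≤ (q j : ℝ) * (1 - q j) / B ε V ℓ :=
      div_nonneg (mul_nonneg hj.1 (by linarith [hj.2])) hB.le
    by_cases hj1 : (q j : ℝ) = 1
    · simp [hj1]
    rw [if_neg (show (q j : ℝ) ∉ ({1} : Set ℝ) from hj1)]
    -- A parameter at distance at least `B ℓ` from `1` is paid for by its share of the variance
    -- divided by `B ℓ`. Any other one different from `1` is the single parameter counted by `hl'`.
    by_cases hj2 : B ε V ℓ ≤ 1 - q j
    · have : (q j : ℝ) ≤ (q j : ℝ) * (1 - q j) / B ε V ℓ := by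
        rw [le_div_iff₀ hB]; nlinarith [hj.1]
      have h3 : (0 : ℝ) ≤ if (q j : ℝ) ∈ (IntervalName.J (Fin.last (ℓ + 1)) :
        IntervalName ℓ).set ε V \ {1} then 1 else 0 := by split_ifs <;> norm_num
      linarith
    · rw [if_pos (mem_set_J_last.2 ⟨by
        have := lt_of_le_of_ne hj.2 hj1
        linarith, by linarith⟩)]
      linarith [hj.2]

/-- The parameters other than `0` make up little of `n` minus the mean. -/
theorem sub_mean_sub_zeros (h0 : 0 < ε) (h1 : ε ≤ 1 / 4) (hV : 0 ≤ V) (q : Fin n → unitInterval)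
    (hq : var (pbd q) ≤ V)
    (hl : numParams q ((IntervalName.I (Fin.last (ℓ + 1)) : IntervalName ℓ).set ε V) ≤ 1) :
    (numParams q {0} : ℝ) ≤ n - mean (pbd q) ∧
      n - mean (pbd q) ≤ numParams q {0} + (V / B ε V ℓ + 1) := by
  classical
  have hB := B_pos h0 h1 hV ℓ
  have hn : (n : ℝ) - mean (pbd q) = ∑ j, (1 - (q j : ℝ)) := by
    rw [mean_pbd]; simp
  rw [numParams_eq_sum, hn]
  constructor
  · refine Finset.sum_le_sum fun j _ => ?_
    have := (q j).2
    split_ifs with h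
    · rw [Set.mem_singleton_iff.1 h]; norm_num
    · linarith [this.2]
  · have hl' : (numParams q
        ((IntervalName.I (Fin.last (ℓ + 1)) : IntervalName ℓ).set ε V) : ℝ) ≤ 1 := by
      exact_mod_cast hl
    have hVB : (∑ j, (q j : ℝ) * (1 - q j)) / B ε V ℓ ≤ V / B ε V ℓ := by
      rw [← var_pbd]; gcongr
    rw [numParams_eq_sum] at hl'
    refine le_trans ?_ (add_le_add le_rfl (add_le_add hVB hl'))
    rw [Finset.sum_div, ← Finset.sum_add_distrib, ← Finset.sum_add_distrib]
    refine Finset.sum_le_sum fun j _ => ?_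
    have hj := (q j).2
    have hnn : 0 ≤ (q j : ℝ) * (1 - q j) / B ε V ℓ :=
      div_nonneg (mul_nonneg hj.1 (by linarith [hj.2])) hB.le
    by_cases hj1 : (q j : ℝ) = 0
    · simp only [hj1, Set.mem_singleton_iff, if_true]
      have h3 : (0 : ℝ) ≤ if (0 : ℝ) ∈ (IntervalName.I (Fin.last (ℓ + 1)) :
        IntervalName ℓ).set ε V then 1 else 0 := by split_ifs <;> norm_num
      norm_num
      exact h3
    rw [if_neg (show (q j : ℝ) ∉ ({0} : Set ℝ) from hj1)]
    by_cases hj2 : B ε V ℓ ≤ q j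
    · have : 1 - (q j : ℝ) ≤ (q j : ℝ) * (1 - q j) / B ε V ℓ := by
        rw [le_div_iff₀ hB]; nlinarith [hj.2]
      have h3 : (0 : ℝ) ≤ if (q j : ℝ) ∈ (IntervalName.I (Fin.last (ℓ + 1)) :
        IntervalName ℓ).set ε V then 1 else 0 := by split_ifs <;> norm_num
      linarith
    · rw [if_pos (mem_set_I_last.2 ⟨lt_of_le_of_ne hj.1 (Ne.symm hj1), by linarith⟩)]
      linarith [hj.1]

end Count

/-! ### Counting parameters after regrouping -/

section CountRegrouped

variable {n : ℕ} {p : Fin n → unitInterval} {ε : ℝ} {ℓ : ℕ} {k : ℕ → ℕ} {y : Fin n → ℝ}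

theorem card_le_of_subset_union {S : Set ℝ} {T : Finset ℝ} {a b : ℝ} {m : ℕ} (f : ℝ → ℝ)
    (hT : (T \ {a, b}).card ≤ m)
    (hS : ∀ v ∈ S, ∃ u, (u ∈ T ∨ u = a ∨ u = b) ∧ v = f u) : S.ncard ≤ m + 2 := by
  classical
  have hsub : S ⊆ ↑(((T \ {a, b}) ∪ {a, b}).image f) := by
    intro v hv
    obtain ⟨u, hu, rfl⟩ := hS v hv
    simp only [Finset.coe_image]
    refine ⟨u, ?_, rfl⟩
    simp only [Finset.sdiff_union_self_eq_union, Finset.coe_union, Set.mem_union, Finset.mem_coe,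
      Finset.mem_insert, Finset.mem_singleton]
    exact hu
  calc S.ncard ≤ (↑(((T \ {a, b}) ∪ {a, b}).image f) : Set ℝ).ncard :=
        Set.ncard_le_ncard hsub (Finset.finite_toSet _)
    _ = (((T \ {a, b}) ∪ {a, b}).image f).card := Set.ncard_coe_finset _
    _ ≤ ((T \ {a, b}) ∪ {a, b}).card := Finset.card_image_le
    _ ≤ (T \ {a, b}).card + ({a, b} : Finset ℝ).card := Finset.card_union_le _ _
    _ ≤ m + 2 := add_le_add hT Finset.card_le_two

/-- Points may have moved to the boundary of their cell and so into the closed interval of another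
one, but closed intervals share only end points. This is why two values per interval are added to `k
i`. -/
theorem IsRegrouping.mem_image_or (hy : IsRegrouping ε ℓ k p y) (h0 : 0 < ε) (h1 : ε ≤ 1 / 4)
    {j : Fin n} {i : ℕ} (hi : i ≤ ℓ)
    (hv : y j ∈ Set.Icc (leftEnd ε (var (pbd p)) ℓ i) (rightEnd ε (var (pbd p)) i)) :
    y j ∈ (cell ε ℓ p (side (p j), i)).image y ∨ y j = leftEnd ε (var (pbd p)) ℓ i ∨
      y j = rightEnd ε (var (pbd p)) i := by
  by_cases h : level ε (var (pbd p)) ℓ (folded p j) = i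
  · left
    refine Finset.mem_image_of_mem y ?_
    rw [← h]
    exact mem_cell_self j
  · right
    exact eq_end_of_mem h0 h1 (var_nonneg p) (Ne.symm h) (by omega) (level_le (folded_mem p j).1) hv
      (hy.mem _ j (mem_cell_self j))

theorem IsRegrouping.numDistinct_I_le (hy : IsRegrouping ε ℓ k p y) (h0 : 0 < ε)
    (h1 : ε ≤ 1 / 4) {i : Fin (ℓ + 2)} (hi : (i : ℕ) ≤ ℓ) :
    numDistinct (unfolded p y) ((IntervalName.I i : IntervalName ℓ).set ε (var (pbd p))) ≤
      k i + 2 := by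
  refine card_le_of_subset_union id (hy.few true i hi) ?_
  rintro _ ⟨⟨j, rfl⟩, hv⟩
  have hv' := (mem_set_I h0 h1 (var_nonneg p) hv).1
  refine ⟨_, ?_, rfl⟩
  have hm := hy.mem_half h0 h1 j
  simp only [hy.coe_unfolded h0 h1] at hv' ⊢
  rcases hs : side (p j) with _ | _
  -- A parameter from the other side of `1/2` can lie in `I i` only if it equals `1/2`, the right
  -- end of `I 0`.
  · right; right
    simp only [hs, fold, Bool.false_eq_true, if_false] at hv' ⊢
    linarith [hv'.2, hm.2, rightEnd_le h0 h1 (var_nonneg p) i]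
  · simp only [hs, fold, if_true] at hv' ⊢
    have := hy.mem_image_or h0 h1 hi hv'
    rwa [hs] at this

theorem IsRegrouping.numDistinct_J_le (hy : IsRegrouping ε ℓ k p y) (h0 : 0 < ε)
    (h1 : ε ≤ 1 / 4) {i : Fin (ℓ + 2)} (hi : (i : ℕ) ≤ ℓ) :
    numDistinct (unfolded p y) ((IntervalName.J i : IntervalName ℓ).set ε (var (pbd p))) ≤
      k i + 2 := by
  refine card_le_of_subset_union (fun v => 1 - v) (hy.few false i hi) ?_
  rintro _ ⟨⟨j, rfl⟩, hv⟩
  have hv' := mem_set_J hv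
  have hm := hy.mem_half h0 h1 j
  refine ⟨1 - (unfolded p y j : ℝ), ?_, by ring⟩
  simp only [hy.coe_unfolded h0 h1] at hv' ⊢
  rcases hs : side (p j) with _ | _
  · simp only [hs, fold, Bool.false_eq_true, if_false, sub_sub_cancel] at hv' ⊢
    have := hy.mem_image_or h0 h1 hi ⟨hv'.1, hv'.2.le⟩
    rwa [hs] at this
  · exfalso
    simp only [hs, fold, if_true] at hv'
    linarith [hv'.2, hm.2, rightEnd_le h0 h1 (var_nonneg p) i]

/-- Points of all other cells stay at or above their left ends, which are at least `B ℓ`. -/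
theorem IsRegrouping.mem_cell_last (hy : IsRegrouping ε ℓ k p y) (h0 : 0 < ε) (h1 : ε ≤ 1 / 4)
    {j : Fin n} (hv : y j < B ε (var (pbd p)) ℓ) : j ∈ cell ε ℓ p (side (p j), ℓ + 1) := by
  have hl := level_le (ε := ε) (V := var (pbd p)) (ℓ := ℓ) (folded_mem p j).1
  have hm := hy.mem _ j (mem_cell_self j)
  have : level ε (var (pbd p)) ℓ (folded p j) = ℓ + 1 := by
    by_contra h
    have h2 := (B_strictAnti h0 h1 (var_nonneg p)).antitone
      (show level ε (var (pbd p)) ℓ (folded p j) ≤ ℓ by omega)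
    have h3 := hm.1
    rw [leftEnd, if_pos (by simp only; omega)] at h3
    linarith
  rw [← this]
  exact mem_cell_self j

theorem IsRegrouping.numParams_I_last_le (hy : IsRegrouping ε ℓ k p y) (h0 : 0 < ε)
    (h1 : ε ≤ 1 / 4) : numParams (unfolded p y)
      ((IntervalName.I (Fin.last (ℓ + 1)) : IntervalName ℓ).set ε (var (pbd p))) ≤ 1 := by
  have key : ∀ j, (unfolded p y j : ℝ) ∈
      ((IntervalName.I (Fin.last (ℓ + 1)) : IntervalName ℓ).set ε (var (pbd p))) →
      j ∈ cell ε ℓ p (true, ℓ + 1) ∧ y j ∈ Set.Ioo 0 (B ε (var (pbd p)) ℓ) := by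
    intro j hj
    rw [mem_set_I_last, hy.coe_unfolded h0 h1] at hj
    have hm := hy.mem_half h0 h1 j
    rcases hs : side (p j) with _ | _
    · exfalso
      simp only [hs, fold, Bool.false_eq_true, if_false] at hj
      linarith [hj.2, hm.2, B_le h0 h1 (var_nonneg p) ℓ]
    · simp only [hs, fold, if_true] at hj
      refine ⟨?_, hj⟩
      rw [← hs]
      exact hy.mem_cell_last h0 h1 hj.2
  rw [numParams, Set.ncard_le_one (Set.toFinite _)]
  intro i hi j hj
  exact hy.one_last true i (key i hi).1 j (key j hj).1 (key i hi).2 (key j hj).2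

theorem IsRegrouping.numParams_J_last_le (hy : IsRegrouping ε ℓ k p y) (h0 : 0 < ε)
    (h1 : ε ≤ 1 / 4) : numParams (unfolded p y)
      ((IntervalName.J (Fin.last (ℓ + 1)) : IntervalName ℓ).set ε (var (pbd p)) \ {1}) ≤ 1 := by
  have key : ∀ j, (unfolded p y j : ℝ) ∈
      ((IntervalName.J (Fin.last (ℓ + 1)) : IntervalName ℓ).set ε (var (pbd p)) \ {1}) →
      j ∈ cell ε ℓ p (false, ℓ + 1) ∧ y j ∈ Set.Ioo 0 (B ε (var (pbd p)) ℓ) := by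
    intro j hj
    rw [mem_set_J_last, hy.coe_unfolded h0 h1] at hj
    have hm := hy.mem_half h0 h1 j
    rcases hs : side (p j) with _ | _
    · simp only [hs, fold, Bool.false_eq_true, if_false, sub_sub_cancel] at hj
      refine ⟨?_, hj⟩
      rw [← hs]
      exact hy.mem_cell_last h0 h1 hj.2
    · exfalso
      simp only [hs, fold, if_true] at hj
      linarith [hj.2, hm.2, B_le h0 h1 (var_nonneg p) ℓ]
  rw [numParams, Set.ncard_le_one (Set.toFinite _)]
  intro i hi j hj
  exact hy.one_last false i (key i hi).1 j (key j hj).1 (key i hi).2 (key j hj).2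

end CountRegrouped

/-! ### The structure theorem -/

/-- A structured approximation in which the number of distinct parameters is controlled by given
numbers `k i`. -/
structure IsGoodApprox {n : ℕ} (ε : ℝ) (ℓ : ℕ) (k : ℕ → ℕ) (p q : Fin n → unitInterval) :
    Prop where
  dTV_lt : dTV (pbd p) (pbd q) < ε ^ 2
  mean_eq : mean (pbd q) = mean (pbd p)
  var_ge : var (pbd p) - ε ^ 3 ≤ var (pbd q)
  var_le : var (pbd q) ≤ var (pbd p)
  distinct_I : ∀ i : Fin (ℓ + 2), (i : ℕ) ≤ ℓ →
    numDistinct q ((IntervalName.I i : IntervalName ℓ).set ε (var (pbd p))) ≤ k i + 2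
  distinct_J : ∀ i : Fin (ℓ + 2), (i : ℕ) ≤ ℓ →
    numDistinct q ((IntervalName.J i : IntervalName ℓ).set ε (var (pbd p))) ≤ k i + 2
  last_I :
    numParams q ((IntervalName.I (Fin.last (ℓ + 1)) : IntervalName ℓ).set ε (var (pbd p))) ≤ 1
  last_J :
    numParams q ((IntervalName.J (Fin.last (ℓ + 1)) : IntervalName ℓ).set ε (var (pbd p)) \ {1}) ≤ 1

/-- Depth and numbers of power sums remain free, subject to two inequalities, so that they can be
chosen by integer arithmetic from an estimate of the variance. `E` depends on `A` alone. -/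
theorem exists_isGoodApprox (A : ℕ) : ∃ E : ℕ, 1 ≤ E ∧ ∀ (n : ℕ) (p : Fin n → unitInterval) (ε : ℝ),
    0 < ε → ε ≤ 1 / 4 → var (pbd p) ≤ (1 / ε) ^ A → ∀ (ℓ : ℕ) (k : ℕ → ℕ), (∀ i ≤ ℓ, 2 ≤ k i) →
      B ε (var (pbd p)) ℓ ≤ ε ^ E → (∀ i ≤ ℓ, B ε (var (pbd p)) i ^ k i ≤ ε ^ E) →
      ∃ q, IsGoodApprox ε ℓ k p q := by
  set m := 2 * A + 10 with hm
  set K := 10 * (m + 1) with hK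
  have hKK : 1 ≤ K ^ 2 * (8 * K ^ 4 + 1) := Nat.one_le_iff_ne_zero.2 (by
    have : K ≠ 0 := by omega
    positivity)
  have hE : 4 * m + 1 ≤ 4 * m * (K ^ 2 * (8 * K ^ 4 + 1)) + 1 :=
    Nat.add_le_add_right (Nat.le_mul_of_pos_right _ hKK) 1
  refine ⟨4 * m * (K ^ 2 * (8 * K ^ 4 + 1)) + 1, by omega, ?_⟩
  intro n p ε h0 h1 hV ℓ k hk hB hBk
  obtain ⟨y, hy⟩ := exists_isRegrouping ε ℓ k p
  have hε1 : ε ≤ 1 := by linarith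
  have hB' : B ε (var (pbd p)) ℓ ≤ ε ^ (4 * m + 1) := hB.trans (pow_le_pow_of_le_one h0.le hε1 hE)
  refine ⟨unfolded p y, ?_, hy.mean_eq h0 h1 hk, ?_, hy.var_le h0 h1 hk,
    fun i hi => hy.numDistinct_I_le h0 h1 hi, fun i hi => hy.numDistinct_J_le h0 h1 hi,
    hy.numParams_I_last_le h0 h1, hy.numParams_J_last_le h0 h1⟩
  · exact hy.dTV_lt h0 h1 hk le_rfl le_rfl hV hB' fun i hi =>
      (hBk i hi).trans (pow_le_pow_of_le_one h0.le hε1 (Nat.le_succ _))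
  · have h2 := hy.var_ge h0 h1 hk
    have hεA : (1 / ε) ^ A * ε ^ A = 1 := by
      rw [← mul_pow, one_div_mul_cancel h0.ne', one_pow]
    have hVn := var_nonneg p
    have h3 : B ε (var (pbd p)) ℓ ≤ ε ^ A * ε ^ 4 := by
      rw [← pow_add]
      exact hB'.trans (pow_le_pow_of_le_one h0.le hε1 (by omega))
    have h4 : B ε (var (pbd p)) ℓ * (2 * var (pbd p)) ≤ (ε ^ A * ε ^ 4) * (2 * (1 / ε) ^ A) := by
      gcongr
    have h5 : (ε ^ A * ε ^ 4) * (2 * (1 / ε) ^ A) = 2 * ε * ε ^ 3 := by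
      linear_combination 2 * ε ^ 4 * hεA
    have h6 : 0 < ε ^ 3 := by positivity
    nlinarith

end PoissonBinomial

namespace PoissonBinomial

/-! ### Mixed radix digits -/

/-- The mixed radix digits of `x`, the least significant one first. -/
def digs : List ℕ → ℕ → List ℕ
  | [], _ => []
  | r :: rs, x => x % r :: digs rs (x / r)

theorem length_digs (rs : List ℕ) (x : ℕ) : (digs rs x).length = rs.length := by
  induction rs generalizing x with
  | nil => rfl
  | cons r rs ih => simp [digs, ih]

theorem digs_injOn {rs : List ℕ} {x y : ℕ} (hx : x < rs.prod) (hy : y < rs.prod)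
    (h : digs rs x = digs rs y) : x = y := by
  induction rs generalizing x y with
  | nil => simp at hx hy; omega
  | cons r rs ih =>
    rw [List.prod_cons] at hx hy
    simp only [digs, List.cons.injEq] at h
    have := ih (Nat.div_lt_of_lt_mul hx) (Nat.div_lt_of_lt_mul hy) h.2
    rw [← Nat.div_add_mod x r, ← Nat.div_add_mod y r, this, h.1]

theorem exists_digs_eq {rs ds : List ℕ} (h : List.Forall₂ (· < ·) ds rs) :
    ∃ x < rs.prod, digs rs x = ds := by
  induction h with
  | nil => exact ⟨0, by simp, rfl⟩
  | @cons d r ds rs hd _ ih =>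
    obtain ⟨x, hx, hxe⟩ := ih
    refine ⟨d + r * x, ?_, ?_⟩
    · rw [List.prod_cons]
      nlinarith
    · rw [digs, Nat.add_mul_mod_self_left, Nat.mod_eq_of_lt hd,
        Nat.add_mul_div_left _ _ (by omega), Nat.div_eq_of_lt hd, zero_add, hxe]

/-! ### Decoding digits to lists of multiplicities -/

/-- A digit position: its radix, the code that is listed with the accumulated value, and how the
accumulator is carried over from the position before: it is multiplied by `keep`, and `base` is
added. -/
structure Slot where
  radix : ℕ
  code : ℕ
  keep : ℕ
  base : ℕ

/-- The nonzero values of the accumulator, with the codes. -/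
def decode : ℕ → List Slot → List ℕ → List (ℕ × ℕ)
  | a, σ :: σs, d :: ds =>
    if a * σ.keep + σ.base + d = 0 then decode (a * σ.keep + σ.base + d) σs ds
    else (a * σ.keep + σ.base + d, σ.code) :: decode (a * σ.keep + σ.base + d) σs ds
  | _, _, _ => []

/-- A block of positions that encodes a nondecreasing list of `count` numbers, through their
differences. -/
structure Block where
  code : ℕ
  base : ℕ
  radix : ℕ
  count : ℕ

/-- The `t`-th position of a block. -/
def Block.slot (b : Block) (t : ℕ) : Slot :=
  ⟨b.radix, b.code, if t = 0 then 0 else 1, if t = 0 then b.base else 0⟩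

/-- The positions of a block. -/
def Block.slots (b : Block) : List Slot := (List.range b.count).map b.slot

/-- The positions of a list of blocks. -/
def slots (bs : List Block) : List Slot := bs.flatMap Block.slots

/-- Partial sums. -/
def partialSums : ℕ → List ℕ → List ℕ
  | _, [] => []
  | a, d :: ds => (a + d) :: partialSums (a + d) ds

theorem length_partialSums (a : ℕ) (ds : List ℕ) : (partialSums a ds).length = ds.length := by
  induction ds generalizing a with
  | nil => rfl
  | cons d ds ih => simp [partialSums, ih]

theorem le_of_mem_partialSums {a : ℕ} {ds : List ℕ} {x : ℕ} (hx : x ∈ partialSums a ds) :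
    a ≤ x := by
  induction ds generalizing a with
  | nil => simp [partialSums] at hx
  | cons d ds ih =>
    simp only [partialSums, List.mem_cons] at hx
    rcases hx with rfl | hx
    · omega
    · have := ih hx; omega

theorem pairwise_partialSums (a : ℕ) (ds : List ℕ) : (partialSums a ds).Pairwise (· ≤ ·) := by
  induction ds generalizing a with
  | nil => exact List.Pairwise.nil
  | cons d ds ih =>
    exact List.Pairwise.cons (fun x hx => le_of_mem_partialSums hx) (ih _)

theorem partialSums_injective (a : ℕ) : Function.Injective (partialSums a) := by
  intro ds es h
  induction ds generalizing a es with
  | nil => cases es <;> simp_all [partialSums]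
  | cons d ds ih =>
    cases es with
    | nil => simp [partialSums] at h
    | cons e es =>
      simp only [partialSums, List.cons.injEq] at h
      obtain rfl : d = e := by omega
      rw [ih _ h.2]

theorem exists_partialSums_eq {a r : ℕ} {l : List ℕ} (hl : l.Pairwise (· ≤ ·))
    (h : ∀ x ∈ l, a ≤ x ∧ x < a + r) :
    ∃ ds : List ℕ, (∀ d ∈ ds, d < r) ∧ partialSums a ds = l := by
  suffices H : ∀ a', a ≤ a' → (∀ x ∈ l, a' ≤ x) →
      ∃ ds : List ℕ, (∀ d ∈ ds, d < r) ∧ partialSums a' ds = l from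
    H a le_rfl fun x hx => (h x hx).1
  induction l with
  | nil => exact fun _ _ _ => ⟨[], by simp, rfl⟩
  | cons y l ih =>
    intro a' ha' h'
    rw [List.pairwise_cons] at hl
    have hy := h y (by simp)
    have hy' := h' y (by simp)
    obtain ⟨ds, hds, he⟩ := ih hl.2 (fun x hx => h x (by simp [hx])) y hy.1 hl.1
    refine ⟨(y - a') :: ds, ?_, ?_⟩
    · intro d hd
      rcases List.mem_cons.1 hd with rfl | hd
      · omega
      · exact hds d hd
    · rw [partialSums, Nat.add_sub_cancel' hy', he]

/-- The nonzero elements of a list, paired with a code. -/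
def tag (c : ℕ) (l : List ℕ) : List (ℕ × ℕ) := (l.filter (· ≠ 0)).map fun x => (x, c)

theorem tag_cons (c x : ℕ) (l : List ℕ) :
    tag c (x :: l) = if x = 0 then tag c l else (x, c) :: tag c l := by
  by_cases h : x = 0
  · simp [tag, h]
  · rw [if_neg h, tag, List.filter_cons_of_pos (by simpa using h)]
    rfl

theorem decode_append_of_keep (a c r : ℕ) (m : ℕ) (ds : List ℕ) (hm : ds.length = m)
    (σs : List Slot) (es : List ℕ) :
    ∃ a', decode a (List.replicate m ⟨r, c, 1, 0⟩ ++ σs) (ds ++ es) =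
      tag c (partialSums a ds) ++ decode a' σs es := by
  induction ds generalizing a m with
  | nil => subst hm; exact ⟨a, by simp [tag, partialSums]⟩
  | cons d ds ih =>
    subst hm
    obtain ⟨a', h⟩ := ih (a + d) _ rfl
    refine ⟨a', ?_⟩
    rw [List.length_cons, List.replicate_succ, List.cons_append, List.cons_append, decode,
      mul_one, add_zero, h, partialSums, tag_cons]
    split_ifs <;> rfl

/-- The first position of a block has `keep = 0`: the accumulator of the preceding block is dropped
and counting restarts at `base`. All later positions add their digit to the accumulator. -/
theorem decode_block (b : Block) (a : ℕ) (ds : List ℕ) (hd : ds.length = b.count)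
    (σs : List Slot) (es : List ℕ) :
    ∃ a', decode a (b.slots ++ σs) (ds ++ es) =
      tag b.code (partialSums b.base ds) ++ decode a' σs es := by
  cases ds with
  | nil =>
    rw [List.length_nil] at hd
    exact ⟨a, by simp [Block.slots, ← hd, tag, partialSums]⟩
  | cons d ds =>
    rw [List.length_cons] at hd
    have hs : b.slots = ⟨b.radix, b.code, 0, b.base⟩ ::
        List.replicate ds.length ⟨b.radix, b.code, 1, 0⟩ := by
      rw [Block.slots, ← hd, List.range_succ_eq_map, List.map_cons, List.map_map]
      congr 1
      rw [List.eq_replicate_iff]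
      simp [Block.slot]
    obtain ⟨a', h⟩ := decode_append_of_keep (b.base + d) b.code b.radix _ ds rfl σs es
    refine ⟨a', ?_⟩
    rw [hs, List.cons_append, List.cons_append, decode, mul_zero, zero_add, h, partialSums, tag_cons]
    split_ifs <;> rfl

theorem map_radix_slots (b : Block) : b.slots.map Slot.radix = List.replicate b.count b.radix := by
  rw [List.eq_replicate_iff]
  simp [Block.slots, Block.slot]

/-- The list encoded by the number `x`. -/
def config (bs : List Block) (x : ℕ) : List (ℕ × ℕ) :=
  decode 0 (slots bs) (digs ((slots bs).map Slot.radix) x)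

/-- The number of lists encoded by a list of blocks. -/
def numConfigs (bs : List Block) : ℕ := ((slots bs).map Slot.radix).prod

theorem numConfigs_cons (b : Block) (bs : List Block) :
    numConfigs (b :: bs) = b.radix ^ b.count * numConfigs bs := by
  rw [numConfigs, slots, List.flatMap_cons, List.map_append, List.prod_append, map_radix_slots,
    List.prod_replicate]
  rfl

theorem numConfigs_eq (bs : List Block) :
    numConfigs bs = (bs.map fun b => b.radix ^ b.count).prod := by
  induction bs with
  | nil => rfl
  | cons b bs ih => rw [numConfigs_cons, ih, List.map_cons, List.prod_cons]

theorem length_slots (bs : List Block) : (slots bs).length = (bs.map Block.count).sum := by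
  induction bs with
  | nil => rfl
  | cons b bs ih =>
    rw [slots, List.flatMap_cons, List.length_append, List.map_cons, List.sum_cons, ← ih]
    simp [Block.slots, slots]

/-- All differences in such a list are below the radix, so they are admissible digits. The converse
fails, as sums of digits may leave the range; such strings only add superfluous multisets. -/
theorem exists_decode_eq (bs : List Block) (l : Block → List ℕ)
    (hl : ∀ b ∈ bs, (l b).length = b.count ∧ (l b).Pairwise (· ≤ ·) ∧
      ∀ x ∈ l b, b.base ≤ x ∧ x < b.base + b.radix) (a : ℕ) :
    ∃ ds, List.Forall₂ (· < ·) ds ((slots bs).map Slot.radix) ∧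
      decode a (slots bs) ds = bs.flatMap fun b => tag b.code (l b) := by
  induction bs generalizing a with
  | nil => exact ⟨[], List.Forall₂.nil, by simp [slots, decode]⟩
  | cons b bs ih =>
    obtain ⟨h1, h2, h3⟩ := hl b (by simp)
    obtain ⟨ds, hds, he⟩ := exists_partialSums_eq h2 h3
    have hlen : ds.length = b.count := by rw [← h1, ← he, length_partialSums]
    have key : ∀ es, ∃ a', decode a (slots (b :: bs)) (ds ++ es) =
        tag b.code (l b) ++ decode a' (slots bs) es := by
      intro es
      obtain ⟨a', h⟩ := decode_block b a ds hlen (slots bs) es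
      exact ⟨a', by rw [← he, ← h]; rfl⟩
    -- the value carried into the remaining blocks does not matter
    have hind : ∀ (bs : List Block) (a a' : ℕ) (es : List ℕ),
        decode a (slots bs) es = decode a' (slots bs) es := by
      intro bs
      induction bs with
      | nil => intros; simp [slots, decode]
      | cons b bs ih' =>
        intro a a' es
        rcases hc : b.count with _ | c
        · have : slots (b :: bs) = slots bs := by simp [slots, Block.slots, hc]
          rw [this]; exact ih' _ _ _
        · have : slots (b :: bs) = b.slot 0 ::
              (((List.range c).map fun t => b.slot (t + 1)) ++ slots bs) := by
            simp [slots, Block.slots, hc, List.range_succ_eq_map, Function.comp_def]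
          rw [this]
          cases es with
          | nil => simp [decode]
          | cons e es => simp [decode, Block.slot]
    obtain ⟨es, hes, hdec⟩ := ih (fun b hb => hl b (by simp [hb])) 0
    obtain ⟨a', h⟩ := key es
    refine ⟨ds ++ es, ?_, ?_⟩
    · rw [slots, List.flatMap_cons, List.map_append, map_radix_slots]
      refine List.rel_append ?_ hes
      rw [← hlen]
      clear hlen he h key
      induction ds with
      | nil => exact List.Forall₂.nil
      | cons d ds ihd =>
        exact List.Forall₂.cons (hds d (by simp)) (ihd fun d hd => hds d (by simp [hd]))
    · rw [h, hind bs a' 0, hdec, List.flatMap_cons]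

theorem exists_config_eq (bs : List Block) (l : Block → List ℕ)
    (hl : ∀ b ∈ bs, (l b).length = b.count ∧ (l b).Pairwise (· ≤ ·) ∧
      ∀ x ∈ l b, b.base ≤ x ∧ x < b.base + b.radix) :
    ∃ x < numConfigs bs, config bs x = bs.flatMap fun b => tag b.code (l b) := by
  obtain ⟨ds, hds, h⟩ := exists_decode_eq bs l hl 0
  obtain ⟨x, hx, rfl⟩ := exists_digs_eq hds
  exact ⟨x, hx, h⟩

theorem mem_decode {a : ℕ} {bs : List Block} {ds : List ℕ} {x : ℕ × ℕ}
    (hx : x ∈ decode a (slots bs) ds) : x.2 ∈ bs.map Block.code := by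
  have H : ∀ (σs : List Slot) (a : ℕ) (ds : List ℕ), x ∈ decode a σs ds →
      x.2 ∈ σs.map Slot.code := by
    intro σs
    induction σs with
    | nil => intro a ds h; simp [decode] at h
    | cons σ σs ih =>
      intro a ds h
      cases ds with
      | nil => simp [decode] at h
      | cons d ds =>
        rw [decode] at h
        rw [List.map_cons]
        split_ifs at h
        · exact List.mem_cons_of_mem _ (ih _ _ h)
        · rcases List.mem_cons.1 h with rfl | h
          · simp
          · exact List.mem_cons_of_mem _ (ih _ _ h)
  have := H _ _ _ hx
  simp only [slots, Block.slots, List.mem_map, List.mem_flatMap] at this ⊢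
  obtain ⟨σ, ⟨b, hb, t, -, rfl⟩, h⟩ := this
  exact ⟨b, hb, h⟩

theorem length_decode_le (a : ℕ) (σs : List Slot) (ds : List ℕ) :
    (decode a σs ds).length ≤ σs.length := by
  induction σs generalizing a ds with
  | nil => simp [decode]
  | cons σ σs ih =>
    cases ds with
    | nil => simp [decode]
    | cons d ds =>
      rw [decode]
      split_ifs
      · exact (ih _ _).trans (by simp)
      · simpa using ih _ _

/-- The length determines how many zeros were removed. -/
theorem filter_ne_zero_perm_imp {l l' : List ℕ} (hlen : l.length = l'.length)
    (h : (l.filter (· ≠ 0)).Perm (l'.filter (· ≠ 0))) : l.Perm l' := by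
  have hz : ∀ l : List ℕ, l.filter (fun x => !decide (x ≠ 0)) =
      List.replicate (l.length - (l.filter (· ≠ 0)).length) 0 := by
    intro l
    rw [List.eq_replicate_iff]
    constructor
    · have := List.length_eq_length_filter_add (l := l) (fun x => decide (x ≠ 0))
      omega
    · intro b hb; simpa using (List.mem_filter.1 hb).2
  have h1 := List.filter_append_perm (fun x => decide (x ≠ 0)) l
  have h2 := List.filter_append_perm (fun x => decide (x ≠ 0)) l'
  refine h1.symm.trans (List.Perm.trans ?_ h2)
  rw [hz l, hz l', hlen, h.length_eq]
  exact h.append_right _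

/-- The codes tell the blocks apart. Within a block, the nonzero values and the known number of
positions determine the sorted list, and its differences are the digits. -/
theorem decode_inj (bs : List Block) (hbs : (bs.map Block.code).Nodup) {a a' : ℕ} {ds ds' : List ℕ}
    (hd : ds.length = (slots bs).length) (hd' : ds'.length = (slots bs).length)
    (h : (decode a (slots bs) ds).Perm (decode a' (slots bs) ds')) : ds = ds' := by
  induction bs generalizing a a' ds ds' with
  | nil =>
    simp only [slots, List.flatMap_nil, List.length_nil, List.length_eq_zero_iff] at hd hd'
    rw [hd, hd']
  | cons b bs ih =>
    rw [List.map_cons, List.nodup_cons] at hbs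
    have hs : slots (b :: bs) = b.slots ++ slots bs := rfl
    have hbl : b.slots.length = b.count := by simp [Block.slots]
    rw [hs, List.length_append, hbl] at hd hd'
    have e : ds = ds.take b.count ++ ds.drop b.count := (List.take_append_drop _ _).symm
    have e' : ds' = ds'.take b.count ++ ds'.drop b.count := (List.take_append_drop _ _).symm
    have l1 : (ds.take b.count).length = b.count := by rw [List.length_take]; omega
    have l1' : (ds'.take b.count).length = b.count := by rw [List.length_take]; omega
    obtain ⟨a1, h1⟩ := decode_block b a (ds.take b.count) l1 (slots bs) (ds.drop b.count)
    obtain ⟨a1', h1'⟩ := decode_block b a' (ds'.take b.count) l1' (slots bs) (ds'.drop b.count)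
    rw [e, e', hs, h1, h1'] at h
    have f1 : ∀ l : List ℕ, (tag b.code l).filter (fun x => x.2 = b.code) = tag b.code l := by
      intro l
      rw [List.filter_eq_self]
      intro x hx
      simp only [tag, List.mem_map] at hx
      obtain ⟨y, -, rfl⟩ := hx
      simp
    have f1' : ∀ l : List ℕ, (tag b.code l).filter (fun x => ¬ x.2 = b.code) = [] := by
      intro l
      rw [List.filter_eq_nil_iff]
      intro x hx
      simp only [tag, List.mem_map] at hx
      obtain ⟨y, -, rfl⟩ := hx
      simp
    have f2 : ∀ a ds, (decode a (slots bs) ds).filter (fun x => x.2 = b.code) = [] := by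
      intro a ds
      rw [List.filter_eq_nil_iff]
      intro x hx hxb
      exact hbs.1 ((decide_eq_true_iff.1 hxb) ▸ mem_decode hx)
    have f2' : ∀ a ds, (decode a (slots bs) ds).filter (fun x => ¬ x.2 = b.code) =
        decode a (slots bs) ds := by
      intro a ds
      rw [List.filter_eq_self]
      intro x hx
      rw [decide_eq_true_iff]
      intro hxb
      exact hbs.1 (hxb ▸ mem_decode hx)
    have p1 := h.filter (fun x => decide (x.2 = b.code))
    have p2 := h.filter (fun x => decide (¬ x.2 = b.code))
    rw [List.filter_append, List.filter_append, f1, f1, f2, f2, List.append_nil,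
      List.append_nil] at p1
    rw [List.filter_append, List.filter_append, f1', f1', f2', f2', List.nil_append,
      List.nil_append] at p2
    have p3 : ((partialSums b.base (ds.take b.count)).filter (· ≠ 0)).Perm
        ((partialSums b.base (ds'.take b.count)).filter (· ≠ 0)) := by
      have := p1.map Prod.fst
      simpa [tag, Function.comp_def] using this
    have p4 := filter_ne_zero_perm_imp (by
      rw [length_partialSums, length_partialSums, l1, l1']) p3
    have p5 := partialSums_injective _ (p4.eq_of_pairwise
      (fun _ _ _ _ h1 h2 => le_antisymm h1 h2)
      (pairwise_partialSums _ _) (pairwise_partialSums _ _))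
    rw [e, e', p5, ih hbs.2 (by rw [List.length_drop]; omega) (by rw [List.length_drop]; omega) p2]

theorem config_injOn (bs : List Block) (hbs : (bs.map Block.code).Nodup) {x x' : ℕ}
    (hx : x < numConfigs bs) (hx' : x' < numConfigs bs)
    (h : (config bs x).Perm (config bs x')) : x = x' :=
  digs_injOn hx hx' (decode_inj bs hbs (by simp [length_digs]) (by simp [length_digs]) h)

end PoissonBinomial

namespace PoissonBinomial

/-! ### Interval names and their codes -/

/-- The interval name with the given code. -/
def nameOf (ℓ c : ℕ) : IntervalName ℓ :=
  if c = 0 then .zero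
  else if c = 1 then .one
  else if h : (c - 2) / 2 < ℓ + 2 then
    if c % 2 = 0 then .I ⟨(c - 2) / 2, h⟩ else .J ⟨(c - 2) / 2, h⟩
  else .zero

theorem code_nameOf {ℓ c : ℕ} (hc : c < 2 * ℓ + 6) : (nameOf ℓ c).code = c := by
  unfold nameOf
  split_ifs with h1 h2 h3 h4
  · simp [IntervalName.code, h1]
  · simp [IntervalName.code, h2]
  · simp only [IntervalName.code]; omega
  · simp only [IntervalName.code]; omega
  · omega

theorem nameOf_code {ℓ : ℕ} (ν : IntervalName ℓ) : nameOf ℓ ν.code = ν := by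
  cases ν with
  | zero => simp [nameOf, IntervalName.code]
  | one => simp [nameOf, IntervalName.code]
  | I i =>
    have hi := i.2
    have h : (2 * (i : ℕ) + 2 - 2) / 2 = i := by omega
    simp [nameOf, IntervalName.code]
  | J i =>
    have hi := i.2
    have h : (2 * (i : ℕ) + 1) / 2 = i := by omega
    have h2 : (2 * (i : ℕ) + 3) % 2 = 1 := by omega
    simp [nameOf, IntervalName.code, h, h2]

theorem code_lt {ℓ : ℕ} (ν : IntervalName ℓ) : ν.code < 2 * ℓ + 6 := by
  cases ν with
  | zero => simp [IntervalName.code]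
  | one => simp only [IntervalName.code]; omega
  | I i => have := i.2; simp only [IntervalName.code]; omega
  | J i => have := i.2; simp only [IntervalName.code]; omega

theorem rightEnd_injective {ε V : ℝ} (h0 : 0 < ε) (h1 : ε ≤ 1 / 4) (hV : 0 ≤ V) :
    Function.Injective (rightEnd ε V) := by
  refine (strictAnti_nat_of_succ_lt fun i => ?_).injective
  have h := leftEnd_lt_rightEnd (ℓ := i) h0 h1 hV i
  rwa [leftEnd, if_pos le_rfl, ← rightEnd_succ] at h

/-- The end points determine the interval. -/
theorem ends_injective {ε V : ℝ} (h0 : 0 < ε) (h1 : ε ≤ 1 / 4) (hV : 0 ≤ V) {ℓ : ℕ} :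
    Function.Injective fun ν : IntervalName ℓ => (ν.low ε V, ν.high ε V) := by
  have hl := fun i => leftEnd_lt_rightEnd (ℓ := ℓ) h0 h1 hV i
  have hr := fun i => rightEnd_le h0 h1 hV i
  have hinj := rightEnd_injective h0 h1 hV
  intro ν ν' h
  simp only [Prod.mk.injEq] at h
  obtain ⟨ha, hb⟩ := h
  cases ν with
  | zero =>
    cases ν' with
    | zero => rfl
    | one => simp [IntervalName.low] at ha
    | I i => simp only [IntervalName.low, IntervalName.high] at ha hb; linarith [hl i]
    | J i => simp only [IntervalName.low, IntervalName.high] at ha hb; linarith [hl i]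
  | one =>
    cases ν' with
    | zero => simp [IntervalName.low] at ha
    | one => rfl
    | I i => simp only [IntervalName.low, IntervalName.high] at ha hb; linarith [hl i]
    | J i => simp only [IntervalName.low, IntervalName.high] at ha hb; linarith [hl i]
  | I i =>
    cases ν' with
    | zero => simp only [IntervalName.low, IntervalName.high] at ha hb; linarith [hl i]
    | one => simp only [IntervalName.low, IntervalName.high] at ha hb; linarith [hl i]
    | I j => rw [Fin.ext (hinj hb)]
    | J j => simp only [IntervalName.low, IntervalName.high] at ha hb; linarith [hl i, hr i, hr j]
  | J i =>
    cases ν' with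
    | zero => simp only [IntervalName.low, IntervalName.high] at ha hb; linarith [hl i]
    | one => simp only [IntervalName.low, IntervalName.high] at ha hb; linarith [hl i]
    | I j => simp only [IntervalName.low, IntervalName.high] at ha hb; linarith [hl j, hr i, hr j]
    | J j =>
      simp only [IntervalName.low] at ha
      rw [Fin.ext (hinj (by linarith : rightEnd ε V i = rightEnd ε V j))]

/-- The name of an interval that contains `v`. -/
noncomputable def classify (ε V : ℝ) (ℓ : ℕ) (v : ℝ) : IntervalName ℓ :=
  if v = 0 then .zero
  else if v = 1 then .one
  else if v ≤ 1 / 2 then .I (Fin.ofNat (ℓ + 2) (level ε V ℓ v))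
  else .J (Fin.ofNat (ℓ + 2) (level ε V ℓ (1 - v)))

theorem mem_classify {ε V : ℝ} {ℓ : ℕ} {v : ℝ}
    (hv : v ∈ Set.Icc 0 1) : v ∈ (classify ε V ℓ v).set ε V := by
  unfold classify
  split_ifs with h2 h3 h4
  · simpa [IntervalName.set] using h2
  · simpa [IntervalName.set] using h3
  · have hlev := level_le (ε := ε) (V := V) (ℓ := ℓ) hv.1
    have hval : ((Fin.ofNat (ℓ + 2) (level ε V ℓ v) : Fin (ℓ + 2)) : ℕ) = level ε V ℓ v := by
      simp only [Fin.ofNat]; exact Nat.mod_eq_of_lt (by omega)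
    have hl := leftEnd_level_le (ε := ε) (V := V) (ℓ := ℓ) hv.1
    have hr := le_rightEnd_level (ε := ε) (V := V) (ℓ := ℓ) ⟨hv.1, h4⟩
    simp only [IntervalName.set, hval]
    split_ifs with h5 h6
    · exact ⟨hl, hr⟩
    · exact ⟨hl, lt_rightEnd_level hv.1 h5⟩
    · refine ⟨?_, lt_rightEnd_level hv.1 h5⟩
      rw [leftEnd, if_neg h6]
      exact lt_of_le_of_ne hv.1 (Ne.symm h2)
  · have hv' : (1 - v) ∈ Set.Icc 0 (1 / 2) := ⟨by linarith [hv.2], by linarith⟩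
    have hlev := level_le (ε := ε) (V := V) (ℓ := ℓ) hv'.1
    have hval : ((Fin.ofNat (ℓ + 2) (level ε V ℓ (1 - v)) : Fin (ℓ + 2)) : ℕ) =
        level ε V ℓ (1 - v) := by
      simp only [Fin.ofNat]; exact Nat.mod_eq_of_lt (by omega)
    have hl := leftEnd_level_le (ε := ε) (V := V) (ℓ := ℓ) hv'.1
    simp only [IntervalName.set, hval]
    have hr : 1 - v < rightEnd ε V (level ε V ℓ (1 - v)) := by
      by_cases h : level ε V ℓ (1 - v) = 0
      · rw [h]; simp only [rightEnd, if_true]; linarith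
      · exact lt_rightEnd_level hv'.1 h
    constructor <;> linarith

theorem eq_of_classify_zero {ε V : ℝ} {ℓ : ℕ} {v : ℝ} (h : classify ε V ℓ v = .zero) : v = 0 := by
  unfold classify at h
  split_ifs at h with h1
  exact h1

theorem eq_of_classify_one {ε V : ℝ} {ℓ : ℕ} {v : ℝ} (h : classify ε V ℓ v = .one) : v = 1 := by
  unfold classify at h
  split_ifs at h with h1 h2
  exact h2

theorem ne_one_of_classify_J {ε V : ℝ} {ℓ : ℕ} {v : ℝ} {i : Fin (ℓ + 2)}
    (h : classify ε V ℓ v = .J i) : v ≠ 1 := by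
  rintro rfl
  simp [classify] at h

/-! ### The set of multisets encoded by blocks -/

/-- The triple that a pair of a multiplicity and a code stands for. -/
noncomputable def triple (ε V : ℝ) (ℓ : ℕ) (y : ℕ × ℕ) : ℕ × ℝ × ℝ :=
  (y.1, (nameOf ℓ y.2).low ε V, (nameOf ℓ y.2).high ε V)

/-- The lists encoded by blocks, with names in place of codes. -/
def namedConfigs (ℓ : ℕ) (bs : List Block) : List (List (ℕ × IntervalName ℓ)) :=
  (List.range (numConfigs bs)).map fun x => (config bs x).map fun y => (y.1, nameOf ℓ y.2)

theorem toTriples_named (ε V : ℝ) (ℓ : ℕ) (l : List (ℕ × ℕ)) :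
    toTriples ε V (l.map fun y => (y.1, nameOf ℓ y.2)) =
      (l.map (triple ε V ℓ) : List (ℕ × ℝ × ℝ)) := by
  rw [toTriples, List.map_map]
  rfl

theorem triple_injOn {ε V : ℝ} (h0 : 0 < ε) (h1 : ε ≤ 1 / 4) (hV : 0 ≤ V) (ℓ : ℕ) :
    Set.InjOn (triple ε V ℓ) {y | y.2 < 2 * ℓ + 6} := by
  rintro ⟨a, c⟩ hc ⟨a', c'⟩ hc' h
  simp only [triple, Prod.mk.injEq] at h
  have h2 := ends_injective h0 h1 hV (a₁ := nameOf ℓ c) (a₂ := nameOf ℓ c')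
    (Prod.ext h.2.1 h.2.2)
  have h3 := congrArg IntervalName.code h2
  rw [code_nameOf hc, code_nameOf hc'] at h3
  exact Prod.ext h.1 h3

theorem perm_of_map_triple {ε V : ℝ} (h0 : 0 < ε) (h1 : ε ≤ 1 / 4) (hV : 0 ≤ V) {ℓ : ℕ}
    {l l' : List (ℕ × ℕ)} (hl : ∀ y ∈ l, y.2 < 2 * ℓ + 6) (hl' : ∀ y ∈ l', y.2 < 2 * ℓ + 6)
    (h : (l.map (triple ε V ℓ)).Perm (l'.map (triple ε V ℓ))) : l.Perm l' := by
  have hinv := (triple_injOn h0 h1 hV ℓ).leftInvOn_invFunOn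
  have key : ∀ l : List (ℕ × ℕ), (∀ y ∈ l, y.2 < 2 * ℓ + 6) →
      (l.map (triple ε V ℓ)).map (Function.invFunOn (triple ε V ℓ) {y | y.2 < 2 * ℓ + 6}) = l := by
    intro l hl
    rw [List.map_map]
    conv_rhs => rw [← List.map_id l]
    exact List.map_congr_left fun y hy => hinv (hl y hy)
  have := h.map (Function.invFunOn (triple ε V ℓ) {y | y.2 < 2 * ℓ + 6})
  rwa [key l hl, key l' hl'] at this

/-- Distinctness survives the passage from codes to real end points because the end points determine
the interval. -/
theorem nodup_toTriples {ε V : ℝ} (h0 : 0 < ε) (h1 : ε ≤ 1 / 4) (hV : 0 ≤ V) {ℓ : ℕ}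
    {bs : List Block} (hbs : (bs.map Block.code).Nodup) (hc : ∀ b ∈ bs, b.code < 2 * ℓ + 6) :
    ((namedConfigs ℓ bs).map (toTriples ε V)).Nodup := by
  have hlt : ∀ x, ∀ y ∈ config bs x, y.2 < 2 * ℓ + 6 := by
    intro x y hy
    obtain ⟨b, hb, h⟩ := List.mem_map.1 (mem_decode hy)
    rw [← h]; exact hc b hb
  rw [namedConfigs, List.map_map]
  refine List.Nodup.map_on ?_ List.nodup_range
  intro x hx x' hx' h
  simp only [Function.comp_apply, toTriples_named, Multiset.coe_eq_coe] at h
  exact config_injOn bs hbs (List.mem_range.1 hx) (List.mem_range.1 hx')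
    (perm_of_map_triple h0 h1 hV (hlt x) (hlt x') h)

theorem encode_named {ℓ : ℕ} {l : List (ℕ × ℕ)} (hl : ∀ y ∈ l, y.2 < 2 * ℓ + 6) :
    encode (l.map fun y => (y.1, nameOf ℓ y.2)) = l.length :: l.flatMap fun y => [y.1, y.2] := by
  rw [encode, List.length_map, List.flatMap_map]
  congr 1
  refine List.flatMap_congr fun y hy => ?_
  rw [code_nameOf (hl y hy)]

/-- The codes of the blocks are distinct and exhaust those that occur, so the classes partition `s`.
-/
theorem multiset_map_eq_sum {α β : Type*} (bs : List Block) (hbs : (bs.map Block.code).Nodup)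
    (s : Finset α) (cl : α → ℕ) (hcl : ∀ v ∈ s, cl v ∈ bs.map Block.code) (g : α → β) :
    s.val.map g = (bs.map fun b => (s.filter fun v => cl v = b.code).val.map g).sum := by
  classical
  induction bs generalizing s with
  | nil =>
    have : s = ∅ := Finset.eq_empty_of_forall_notMem fun v hv => by simpa using hcl v hv
    simp [this]
  | cons b bs ih =>
    rw [List.map_cons, List.nodup_cons] at hbs
    rw [List.map_cons, List.sum_cons]
    have h := ih hbs.2 (s.filter fun v => ¬ cl v = b.code) (fun v hv => by
      rw [Finset.mem_filter] at hv
      have := hcl v hv.1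
      rw [List.map_cons, List.mem_cons] at this
      exact this.resolve_left hv.2)
    have h2 : (bs.map fun b' => ((s.filter fun v => ¬ cl v = b.code).filter
        fun v => cl v = b'.code).val.map g) =
        bs.map fun b' => (s.filter fun v => cl v = b'.code).val.map g := by
      refine List.map_congr_left fun b' hb' => ?_
      rw [Finset.filter_filter]
      congr 2
      refine Finset.filter_congr fun v _ => ⟨fun h => h.2, fun h => ⟨fun h3 => hbs.1 ?_, h⟩⟩
      rw [← h3, h]
      exact List.mem_map_of_mem hb'
    rw [h2] at h
    rw [← h, Finset.filter_val, Finset.filter_val, ← Multiset.map_add, Multiset.filter_add_not]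

theorem coe_flatMap_eq_sum {α β : Type*} (bs : List α) (F : α → List β) :
    ((bs.flatMap F : List β) : Multiset β) = (bs.map fun b => (F b : Multiset β)).sum := by
  induction bs with
  | nil => rfl
  | cons b bs ih =>
    rw [List.flatMap_cons, ← Multiset.coe_add, ih, List.map_cons, List.sum_cons]

/-- A multiset of positive numbers can be encoded by a block. -/
structure Fits (b : Block) (m : Multiset ℕ) : Prop where
  card_le : m.card ≤ b.count
  mem : ∀ x ∈ m, x ≠ 0 ∧ b.base ≤ x ∧ x < b.base + b.radix
  pad : m.card < b.count → b.base = 0 ∧ 0 < b.radix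

/-- Unused positions are filled with zeros, which `tag` removes again. In sorted order they come
first, so padding requires that the block can start at `0`; this is the field `pad`. -/
theorem Fits.exists_list {b : Block} {m : Multiset ℕ} (h : Fits b m) :
    ∃ l : List ℕ, (l.length = b.count ∧ l.Pairwise (· ≤ ·) ∧
      ∀ x ∈ l, b.base ≤ x ∧ x < b.base + b.radix) ∧
      (tag b.code l : Multiset (ℕ × ℕ)) = m.map fun x => (x, b.code) := by
  refine ⟨List.replicate (b.count - m.card) 0 ++ m.sort (· ≤ ·), ⟨?_, ?_, ?_⟩, ?_⟩
  · have := h.card_le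
    simp only [List.length_append, List.length_replicate, Multiset.length_sort]
    omega
  · rw [List.pairwise_append]
    refine ⟨List.pairwise_replicate.2 (Or.inr le_rfl), Multiset.pairwise_sort _ _, ?_⟩
    intro x hx y _
    rw [List.eq_of_mem_replicate hx]
    exact Nat.zero_le _
  · intro x hx
    rcases List.mem_append.1 hx with hx | hx
    · have hpos : b.count - m.card ≠ 0 := (List.mem_replicate.1 hx).1
      obtain ⟨h1, h2⟩ := h.pad (by omega)
      rw [List.eq_of_mem_replicate hx]
      omega
    · exact (h.mem x ((Multiset.mem_sort _).1 hx)).2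
  · have hf : (List.replicate (b.count - m.card) 0 ++ m.sort (· ≤ ·)).filter (· ≠ 0) =
        m.sort (· ≤ ·) := by
      rw [List.filter_append, List.filter_eq_nil_iff.2, List.nil_append, List.filter_eq_self]
      · intro x hx
        simpa using (h.mem x ((Multiset.mem_sort _).1 hx)).1
      · intro x hx
        simp [List.eq_of_mem_replicate hx]
    rw [tag, hf, ← Multiset.map_coe, Multiset.sort_eq]

/-- The multiset that describes `q` is encoded by blocks into which the multiplicities fit. -/
theorem exists_describes {n : ℕ} {ε V : ℝ} {ℓ : ℕ}
    {bs : List Block} (hbs : (bs.map Block.code).Nodup)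
    (hall : ∀ c < 2 * ℓ + 6, c ∈ bs.map Block.code) (q : Fin n → unitInterval)
    (hfit : ∀ b ∈ bs, Fits b (((Finset.univ.image q).filter
      fun v : unitInterval => (classify ε V ℓ v).code = b.code).val.map fun v => {j | q j = v}.ncard)) :
    ∃ S, S ∈ (namedConfigs ℓ bs).map (toTriples ε V) ∧ Describes ε V ℓ S q := by
  classical
  choose! l hl hl' using fun b hb => (hfit b hb).exists_list
  obtain ⟨x, hx, hxe⟩ := exists_config_eq bs l hl
  refine ⟨_, List.mem_map_of_mem (List.mem_map_of_mem (List.mem_range.2 hx)),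
    fun v => classify ε V ℓ v, fun j => mem_classify (q j).2, ?_⟩
  rw [toTriples_named, hxe, ← Multiset.map_coe, coe_flatMap_eq_sum,
    multiset_map_eq_sum bs hbs (Finset.univ.image q) (fun v : unitInterval => (classify ε V ℓ v).code)
      (fun v _ => hall _ (code_lt _)), ← Multiset.coe_mapAddMonoidHom, map_list_sum, List.map_map]
  congr 1
  refine List.map_congr_left fun b hb => ?_
  simp only [Function.comp_apply, Multiset.coe_mapAddMonoidHom]
  rw [hl' b hb, Multiset.map_map, Multiset.map_map]
  refine Multiset.map_congr rfl fun v hv => ?_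
  have hv' : (classify ε V ℓ v).code = b.code := by
    rw [Finset.mem_val, Finset.mem_filter] at hv
    exact hv.2
  simp only [Function.comp_apply, triple, ← hv', nameOf_code]

end PoissonBinomial

namespace PoissonBinomial

/-! ### The blocks for the partition -/

/-- The blocks for the intervals of the partition: radix `r i` and `K i` positions for each of `I i`
and `J i`, one binary position for each of the last two intervals, and one position of radix `P` for
each of the parameters `0` and `1`, whose multiplicities start at `z` and `o`. -/
def blocks (ℓ : ℕ) (r K : ℕ → ℕ) (z o P : ℕ) : List Block :=
  (List.range (ℓ + 1)).flatMap (fun i => [⟨2 * i + 2, 0, r i, K i⟩, ⟨2 * i + 3, 0, r i, K i⟩]) ++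
    [⟨2 * ℓ + 4, 0, 2, 1⟩, ⟨2 * ℓ + 5, 0, 2, 1⟩, ⟨0, z, P, 1⟩, ⟨1, o, P, 1⟩]

/-- Every interval name has exactly one block. Uniqueness is needed for injectivity, existence for
describing arbitrary parameters. -/
theorem blocks_codes (ℓ : ℕ) (r K : ℕ → ℕ) (z o P : ℕ) :
    (blocks ℓ r K z o P).map Block.code = List.range' 2 (2 * ℓ + 4) ++ [0, 1] := by
  have h : ∀ m, ((List.range m).flatMap (fun i =>
      [(⟨2 * i + 2, 0, r i, K i⟩ : Block), ⟨2 * i + 3, 0, r i, K i⟩])).map Block.code =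
        List.range' 2 (2 * m) := by
    intro m
    induction m with
    | zero => rfl
    | succ m ih =>
      rw [List.range_succ, List.flatMap_append, List.map_append, ih,
        show 2 * (m + 1) = 2 * m + 1 + 1 by ring, List.range'_concat, List.range'_concat]
      simp
      omega
  rw [blocks, List.map_append, h, show 2 * ℓ + 4 = 2 * (ℓ + 1) + 1 + 1 by ring, List.range'_concat,
    List.range'_concat]
  simp
  omega

theorem blocks_nodup (ℓ : ℕ) (r K : ℕ → ℕ) (z o P : ℕ) :
    ((blocks ℓ r K z o P).map Block.code).Nodup := by
  rw [blocks_codes, List.nodup_append']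
  refine ⟨List.nodup_range', by simp, ?_⟩
  intro x hx hx'
  rw [List.mem_range'_1] at hx
  simp at hx'
  omega

theorem mem_blocks_codes {ℓ : ℕ} {r K : ℕ → ℕ} {z o P c : ℕ} :
    c ∈ (blocks ℓ r K z o P).map Block.code ↔ c < 2 * ℓ + 6 := by
  rw [blocks_codes, List.mem_append, List.mem_range'_1]
  simp
  omega

theorem ncard_le_numParams {n : ℕ} (q : Fin n → unitInterval) {S : Set ℝ} {v : unitInterval}
    (hv : (v : ℝ) ∈ S) : {j | q j = v}.ncard ≤ numParams q S := by
  refine Set.ncard_le_ncard (fun j hj => ?_) (Set.toFinite _)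
  simp only [Set.mem_ofPred_eq] at hj ⊢
  rwa [hj]

theorem ncard_ne_zero {n : ℕ} (q : Fin n → unitInterval) {v : unitInterval}
    (hv : v ∈ Finset.univ.image q) : {j | q j = v}.ncard ≠ 0 := by
  obtain ⟨j, -, hj⟩ := Finset.mem_image.1 hv
  exact (Set.ncard_pos (Set.toFinite _)).2 ⟨j, hj⟩ |>.ne'

theorem card_filter_le_numDistinct {n : ℕ} (q : Fin n → unitInterval) {S : Set ℝ}
    {s : Finset unitInterval} (hs : ∀ v ∈ s, v ∈ Finset.univ.image q ∧ (v : ℝ) ∈ S) :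
    s.card ≤ numDistinct q S := by
  classical
  rw [← Finset.card_image_of_injective s Subtype.val_injective, ← Set.ncard_coe_finset]
  refine Set.ncard_le_ncard (fun x hx => ?_) ((Set.finite_range _).inter_of_left _)
  obtain ⟨v, hv, rfl⟩ := Finset.mem_image.1 (Finset.mem_coe.1 hx)
  obtain ⟨h1, h2⟩ := hs v hv
  obtain ⟨j, -, hj⟩ := Finset.mem_image.1 h1
  exact ⟨⟨j, by simp only [hj]⟩, h2⟩

theorem numDistinct_le_numParams {n : ℕ} (q : Fin n → unitInterval) (S : Set ℝ) :
    numDistinct q S ≤ numParams q S := by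
  rw [numDistinct, numParams]
  have : Set.range (fun j => (q j : ℝ)) ∩ S = (fun j => (q j : ℝ)) '' {j | (q j : ℝ) ∈ S} := by
    ext x
    constructor
    · rintro ⟨⟨j, rfl⟩, h⟩; exact ⟨j, h, rfl⟩
    · rintro ⟨j, h, rfl⟩; exact ⟨⟨j, rfl⟩, h⟩
  rw [this]
  exact Set.ncard_image_le (Set.toFinite _)

/-- The multiplicities of parameters in a set fit into a block that starts at `0`. -/
theorem fits_of_numParams {n : ℕ} (q : Fin n → unitInterval) (S : Set ℝ) {b : Block}
    {s : Finset unitInterval} (hs : ∀ v ∈ s, v ∈ Finset.univ.image q ∧ (v : ℝ) ∈ S)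
    (hb : b.base = 0) (hK : numDistinct q S ≤ b.count) (hr : numParams q S < b.radix) :
    Fits b (s.val.map fun v => {j | q j = v}.ncard) := by
  refine ⟨?_, ?_, fun _ => ⟨hb, by omega⟩⟩
  · rw [Multiset.card_map]
    exact (card_filter_le_numDistinct q hs).trans hK
  · intro x hx
    obtain ⟨v, hv, rfl⟩ := Multiset.mem_map.1 hx
    obtain ⟨h1, h2⟩ := hs v hv
    exact ⟨ncard_ne_zero q h1, by omega, by have := ncard_le_numParams q h2; omega⟩

/-- The multiplicity of one value fits into a block around it. -/
theorem fits_of_single {n : ℕ} (q : Fin n → unitInterval) (v₀ : unitInterval) {b : Block}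
    {s : Finset unitInterval} (hs : ∀ v ∈ s, v ∈ Finset.univ.image q ∧ v = v₀)
    (hs' : v₀ ∈ Finset.univ.image q → v₀ ∈ s)
    (hb : b.base ≤ numParams q {(v₀ : ℝ)}) (hK : b.count = 1)
    (hr : numParams q {(v₀ : ℝ)} < b.base + b.radix) :
    Fits b (s.val.map fun v => {j | q j = v}.ncard) := by
  have hcard : {j | q j = v₀}.ncard = numParams q {(v₀ : ℝ)} := by
    rw [numParams]
    congr 1
    ext j
    simp [Subtype.ext_iff]
  refine ⟨?_, ?_, ?_⟩
  · rw [Multiset.card_map, hK]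
    exact Finset.card_le_one.2 fun a ha b hb => by rw [(hs a ha).2, (hs b hb).2]
  · intro x hx
    obtain ⟨v, hv, rfl⟩ := Multiset.mem_map.1 hx
    obtain ⟨h1, rfl⟩ := hs v hv
    exact ⟨ncard_ne_zero q h1, by rw [hcard]; exact ⟨hb, hr⟩⟩
  -- If the value does not occur at all, its multiplicity `0` bounds the base, so padding with a
  -- zero is legitimate.
  · intro h
    rw [Multiset.card_map, hK] at h
    have hempty : s = ∅ := Finset.card_eq_zero.1 (by change Multiset.card s.val = 0; omega)
    have hz : numParams q {(v₀ : ℝ)} = 0 := by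
      rw [← hcard, Set.ncard_eq_zero (Set.toFinite _)]
      ext j
      simp only [Set.mem_ofPred_eq, Set.mem_empty_iff_false, iff_false]
      intro hj
      have := hs' (Finset.mem_image.2 ⟨j, Finset.mem_univ _, hj⟩)
      rw [hempty] at this
      simp at this
    omega

/-- The number of parameters in an interval bounds each multiplicity and hence the radix; the number
of distinct ones bounds the number of positions. The values `0` and `1` may be very frequent, so
their multiplicities are only located in a window of length `P`. -/
theorem exists_describes_blocks {n : ℕ} {ε V : ℝ} {ℓ : ℕ} {r K : ℕ → ℕ} {z o P : ℕ} (q : Fin n → unitInterval)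
    (hI : ∀ i : Fin (ℓ + 2), (i : ℕ) ≤ ℓ →
      numDistinct q ((IntervalName.I i : IntervalName ℓ).set ε V) ≤ K i ∧
      numParams q ((IntervalName.I i : IntervalName ℓ).set ε V) < r i)
    (hJ : ∀ i : Fin (ℓ + 2), (i : ℕ) ≤ ℓ →
      numDistinct q ((IntervalName.J i : IntervalName ℓ).set ε V) ≤ K i ∧
      numParams q ((IntervalName.J i : IntervalName ℓ).set ε V) < r i)
    (hlI : numParams q ((IntervalName.I (Fin.last (ℓ + 1)) : IntervalName ℓ).set ε V) ≤ 1)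
    (hlJ : numParams q ((IntervalName.J (Fin.last (ℓ + 1)) : IntervalName ℓ).set ε V \ {1}) ≤ 1)
    (hz : z ≤ numParams q {0} ∧ numParams q {0} < z + P)
    (ho : o ≤ numParams q {1} ∧ numParams q {1} < o + P) :
    ∃ S, S ∈ (namedConfigs ℓ (blocks ℓ r K z o P)).map (toTriples ε V) ∧
      Describes ε V ℓ S q := by
  refine exists_describes (blocks_nodup ℓ r K z o P) (fun c hc => mem_blocks_codes.2 hc) q
    fun b hb => ?_
  -- membership of the values with a given name
  have hname : ∀ (ν : IntervalName ℓ) (v : unitInterval), (classify ε V ℓ v).code = ν.code →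
      classify ε V ℓ v = ν := fun ν v h => by
    rw [← nameOf_code (classify ε V ℓ v), h, nameOf_code]
  have hmem : ∀ (ν : IntervalName ℓ), b.code = ν.code → ∀ v ∈ (Finset.univ.image q).filter
      (fun v : unitInterval => (classify ε V ℓ v).code = b.code),
      v ∈ Finset.univ.image q ∧ (v : ℝ) ∈ ν.set ε V ∧ classify ε V ℓ v = ν := by
    intro ν hν v hv
    rw [Finset.mem_filter, hν] at hv
    have h2 := hname ν v hv.2
    exact ⟨hv.1, h2 ▸ mem_classify v.2, h2⟩
  have hIcode : ∀ i : Fin (ℓ + 2), (IntervalName.I i : IntervalName ℓ).code = 2 * i + 2 :=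
    fun _ => rfl
  have hJcode : ∀ i : Fin (ℓ + 2), (IntervalName.J i : IntervalName ℓ).code = 2 * i + 3 :=
    fun _ => rfl
  rw [blocks, List.mem_append, List.mem_flatMap] at hb
  rcases hb with ⟨i, hi, hb⟩ | hb
  · rw [List.mem_range] at hi
    simp only [List.mem_cons, List.not_mem_nil, or_false] at hb
    rcases hb with rfl | rfl
    · have hm := hmem (.I ⟨i, by omega⟩) rfl
      have h := hI ⟨i, by omega⟩ (by simp only; omega)
      exact fits_of_numParams q _ (fun v hv => ⟨(hm v hv).1, (hm v hv).2.1⟩) rfl h.1 h.2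
    · have hm := hmem (.J ⟨i, by omega⟩) rfl
      have h := hJ ⟨i, by omega⟩ (by simp only; omega)
      exact fits_of_numParams q _ (fun v hv => ⟨(hm v hv).1, (hm v hv).2.1⟩) rfl h.1 h.2
  · simp only [List.mem_cons, List.not_mem_nil, or_false] at hb
    rcases hb with rfl | rfl | rfl | rfl
    · have hm := hmem (.I (Fin.last (ℓ + 1))) (by rw [hIcode, Fin.val_last]; ring)
      exact fits_of_numParams q _ (fun v hv => ⟨(hm v hv).1, (hm v hv).2.1⟩) rfl
        ((numDistinct_le_numParams q _).trans hlI) (Nat.lt_succ_of_le hlI)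
    · have hm := hmem (.J (Fin.last (ℓ + 1))) (by rw [hJcode, Fin.val_last]; ring)
      exact fits_of_numParams q
        ((IntervalName.J (Fin.last (ℓ + 1)) : IntervalName ℓ).set ε V \ {1})
        (fun v hv => ⟨(hm v hv).1, (hm v hv).2.1, ne_one_of_classify_J (hm v hv).2.2⟩) rfl
        ((numDistinct_le_numParams q _).trans hlJ) (Nat.lt_succ_of_le hlJ)
    · have hm := hmem .zero rfl
      refine fits_of_single q 0 (fun v hv => ⟨(hm v hv).1, Subtype.ext ?_⟩)
        (fun h => Finset.mem_filter.2 ⟨h, ?_⟩) hz.1 rfl hz.2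
      · exact eq_of_classify_zero (hm v hv).2.2
      · simp [classify, IntervalName.code]
    · have hm := hmem .one rfl
      refine fits_of_single q 1 (fun v hv => ⟨(hm v hv).1, Subtype.ext ?_⟩)
        (fun h => Finset.mem_filter.2 ⟨h, ?_⟩) ho.1 rfl ho.2
      · exact eq_of_classify_one (hm v hv).2.2
      · simp [classify, IntervalName.code]

end PoissonBinomial

namespace PoissonBinomial

/-! ### Total correctness of programs -/

/-- The state after writing `v` to register `x`. -/
def State.setReg (s : State) (x v : ℕ) : State := { s with reg := Function.update s.reg x v }

/-- The state after writing `v` to memory address `a`. -/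
def State.setMem (s : State) (a v : ℕ) : State := { s with mem := Function.update s.mem a v }

/-- The state after writing `v` to the output. -/
def State.emit (s : State) (v : ℕ) : State := { s with out := s.out ++ [v] }

namespace State

@[simp] theorem reg_setReg (s : State) (x v y : ℕ) :
    (s.setReg x v).reg y = if y = x then v else s.reg y := Function.update_apply _ _ _ _

@[simp] theorem mem_setReg (s : State) (x v : ℕ) : (s.setReg x v).mem = s.mem := rfl

@[simp] theorem out_setReg (s : State) (x v : ℕ) : (s.setReg x v).out = s.out := rfl

@[simp] theorem reg_setMem (s : State) (a v : ℕ) : (s.setMem a v).reg = s.reg := rfl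

@[simp] theorem mem_setMem (s : State) (a v : ℕ) :
    (s.setMem a v).mem = Function.update s.mem a v := rfl

@[simp] theorem out_setMem (s : State) (a v : ℕ) : (s.setMem a v).out = s.out := rfl

@[simp] theorem reg_emit (s : State) (v : ℕ) : (s.emit v).reg = s.reg := rfl

@[simp] theorem mem_emit (s : State) (v : ℕ) : (s.emit v).mem = s.mem := rfl

@[simp] theorem out_emit (s : State) (v : ℕ) : (s.emit v).out = s.out ++ [v] := rfl

end State

/-- Started in state `s`, the program halts within `T` steps in a state that satisfies `Q`. -/
def Ends (w : ℕ) (c : Program) (s : State) (T : ℕ) (Q : State → Prop) : Prop :=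
  ∃ s' t, Run w c s s' t ∧ t ≤ T ∧ Q s'

/-- Consecutive execution; register `31` is used for the empty program. -/
def block : List Program → Program
  | [] => .const 31 0
  | c :: cs => .seq c (block cs)

namespace Ends

variable {w : ℕ} {s : State} {T T' : ℕ} {Q Q' : State → Prop} {cs : List Program}

theorem mono {c : Program} (h : Ends w c s T Q) (hT : T ≤ T') (hQ : ∀ s', Q s' → Q' s') :
    Ends w c s T' Q' := by
  obtain ⟨s', t, h1, h2, h3⟩ := h
  exact ⟨s', t, h1, h2.trans hT, hQ _ h3⟩

theorem nil (h : Q (s.setReg 31 0)) : Ends w (block []) s 1 Q :=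
  ⟨_, 1, Run.const 31 0 s, le_rfl, by simpa [State.setReg] using h⟩

theorem cons {c : Program} {R : State → Prop} (h : Ends w c s T R)
    (h' : ∀ s', R s' → Ends w (block cs) s' T' Q) : Ends w (block (c :: cs)) s (T + T') Q := by
  obtain ⟨s', t, h1, h2, h3⟩ := h
  obtain ⟨s'', t', h1', h2', h3'⟩ := h' s' h3
  exact ⟨s'', t + t', Run.seq h1 h1', by omega, h3'⟩

theorem const {x c : ℕ} (hc : c < 2 ^ w) (h : Ends w (block cs) (s.setReg x c) T Q) :
    Ends w (block (.const x c :: cs)) s (T + 1) Q := by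
  obtain ⟨s', t, h1, h2, h3⟩ := h
  refine ⟨s', 1 + t, Run.seq (Run.const x c s) ?_, by omega, h3⟩
  rwa [Nat.mod_eq_of_lt hc]

/-- The result `v` is supplied explicitly to keep states in a readable form; as it fits into a word,
the reduction modulo `2 ^ w` has no effect. The other rules follow the same pattern. -/
theorem op {o : BinOp} {x y z : ℕ} (v : ℕ) (hv : o.apply (s.reg y) (s.reg z) = v) (hc : v < 2 ^ w)
    (h : Ends w (block cs) (s.setReg x v) T Q) :
    Ends w (block (.op o x y z :: cs)) s (T + 1) Q := by
  obtain ⟨s', t, h1, h2, h3⟩ := h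
  refine ⟨s', 1 + t, Run.seq (Run.op o x y z s) ?_, by omega, h3⟩
  rwa [hv, Nat.mod_eq_of_lt hc]

theorem load {x y : ℕ} (v : ℕ) (hv : s.mem (s.reg y) = v)
    (h : Ends w (block cs) (s.setReg x v) T Q) :
    Ends w (block (.load x y :: cs)) s (T + 1) Q := by
  obtain ⟨s', t, h1, h2, h3⟩ := h
  refine ⟨s', 1 + t, Run.seq (Run.load x y s) ?_, by omega, h3⟩
  rwa [hv]

theorem store {x y : ℕ} (a v : ℕ) (ha : s.reg x = a) (hv : s.reg y = v)
    (h : Ends w (block cs) (s.setMem a v) T Q) :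
    Ends w (block (.store x y :: cs)) s (T + 1) Q := by
  obtain ⟨s', t, h1, h2, h3⟩ := h
  refine ⟨s', 1 + t, Run.seq (Run.store x y s) ?_, by omega, h3⟩
  rwa [ha, hv]

theorem emit {x : ℕ} (v : ℕ) (hv : s.reg x = v) (h : Ends w (block cs) (s.emit v) T Q) :
    Ends w (block (.emit x :: cs)) s (T + 1) Q := by
  obtain ⟨s', t, h1, h2, h3⟩ := h
  refine ⟨s', 1 + t, Run.seq (Run.emit x s) ?_, by omega, h3⟩
  rwa [hv]

theorem ite {x : ℕ} {c d : Program} (h1 : s.reg x ≠ 0 → Ends w c s T Q)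
    (h2 : s.reg x = 0 → Ends w d s T Q) : Ends w (.ite x c d) s (T + 1) Q := by
  by_cases h : s.reg x = 0
  · obtain ⟨s', t, h1, h2, h3⟩ := h2 h
    exact ⟨s', t + 1, Run.ite_false h h1, by omega, h3⟩
  · obtain ⟨s', t, h1, h2, h3⟩ := h1 h
    exact ⟨s', t + 1, Run.ite_true h h1, by omega, h3⟩

theorem loop_zero {x : ℕ} {c : Program} (h : s.reg x = 0) (hQ : Q s) : Ends w (.loop x c) s 1 Q :=
  ⟨s, 1, Run.loop_false h, le_rfl, hQ⟩

theorem loop_step {x : ℕ} {c : Program} {R : State → Prop} (h : s.reg x ≠ 0) (hc : Ends w c s T R)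
    (h' : ∀ s', R s' → Ends w (.loop x c) s' T' Q) : Ends w (.loop x c) s (T + T' + 1) Q := by
  obtain ⟨s', t, h1, h2, h3⟩ := hc
  obtain ⟨s'', t', h1', h2', h3'⟩ := h' s' h3
  exact ⟨s'', t + t' + 1, Run.loop_true h h1 h1', by omega, h3'⟩

/-- A loop that is executed `m` times. -/
theorem loop {x : ℕ} {c : Program} (m : ℕ) (Inv : ℕ → State → Prop)
    (h0 : Inv 0 s) (hstep : ∀ i < m, ∀ s, Inv i s → s.reg x ≠ 0 ∧ Ends w c s T (Inv (i + 1)))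
    (hend : ∀ s, Inv m s → s.reg x = 0) :
    Ends w (.loop x c) s (m * (T + 1) + 1) (Inv m) := by
  have key : ∀ j, j ≤ m → ∀ s, Inv (m - j) s → Ends w (.loop x c) s (j * (T + 1) + 1) (Inv m) := by
    intro j
    induction j with
    | zero =>
      intro _ s hs
      rw [Nat.sub_zero] at hs
      rw [zero_mul, zero_add]
      exact loop_zero (hend s hs) hs
    | succ j ih =>
      intro hj s hs
      obtain ⟨h1, h2⟩ := hstep (m - (j + 1)) (by omega) s hs
      refine (loop_step h1 h2 (T' := j * (T + 1) + 1) fun s' hs' => ih (by omega) s' ?_).mono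
        (by ring_nf; omega) fun _ h => h
      rwa [show m - j = m - (j + 1) + 1 by omega]
  have := key m le_rfl s (by simpa using h0)
  exact this

end Ends

/-! ### Integer logarithm

Throughout, register `10` holds `1` and register `11` holds `2`. -/

/-- `y := log₂ x` -/
def logProg (x y : ℕ) : Program :=
  block [.const y 0, .op .add 20 x y, .op .lt 21 10 20,
    .loop 21 (block [.op .div 20 20 11, .op .add y y 10, .op .lt 21 10 20])]

/-- After `i` halvings register `20` holds `v / 2 ^ i`, which exceeds `1` exactly as long as `i <
log₂ v`. -/
theorem logProg_ends {w : ℕ} {s : State} {x y : ℕ} (hxy : x ≠ y)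
    (hy : y ∉ [10, 11, 20, 21, 31]) (hw : 2 ≤ 2 ^ w)
    (h10 : s.reg 10 = 1) (h11 : s.reg 11 = 2) (hx0 : s.reg x ≠ 0) (hxw : s.reg x < 2 ^ w) :
    Ends w (logProg x y) s (5 * Nat.log 2 (s.reg x) + 5) fun s' =>
      s'.reg y = Nat.log 2 (s.reg x) ∧ s'.mem = s.mem ∧ s'.out = s.out ∧
      ∀ z, z ∉ [y, 20, 21, 31] → s'.reg z = s.reg z := by
  simp only [List.mem_cons, List.not_mem_nil, or_false, not_or] at hy
  obtain ⟨hy1, hy2, hy3, hy4, hy5⟩ := hy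
  set v := s.reg x with hv
  set m := Nat.log 2 v with hm
  have hlogw : ∀ i ≤ m, i < 2 ^ w := fun i hi => by
    have := Nat.log_lt_self 2 hx0
    omega
  have hone : ∀ a b : ℕ, (if a < b then 1 else 0) < 2 ^ w := fun a b => by split_ifs <;> omega
  refine Ends.mono (T := ((m * (4 + 1) + 1) + 1) + 1 + 1 + 1) ?_ (by omega) (fun _ h => h)
  refine Ends.const (by omega) ?_
  refine Ends.op v (by simp [hxy, BinOp.apply, ← hv]) hxw ?_
  refine Ends.op (if 1 < v then 1 else 0)
    (by simp [BinOp.apply, h10, Ne.symm hy1]) (hone _ _) ?_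
  refine Ends.cons (T := m * (4 + 1) + 1) (T' := 1) (Ends.loop m (fun i s' => s'.reg y = i ∧ s'.reg 20 = v / 2 ^ i ∧
    s'.reg 21 = (if 1 < v / 2 ^ i then 1 else 0) ∧ s'.mem = s.mem ∧ s'.out = s.out ∧
    ∀ z, z ∉ [y, 20, 21, 31] → s'.reg z = s.reg z) ?_ ?_ ?_) ?_
  · simp only [State.reg_setReg, State.mem_setReg, State.out_setReg, pow_zero, Nat.div_one]
    refine ⟨by simp [hy3, hy4], by simp, by simp, trivial, trivial, fun z hz => ?_⟩
    simp only [List.mem_cons, List.not_mem_nil, or_false, not_or] at hz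
    simp [hz]
  · rintro i hi s' ⟨g1, g2, g3, g4, g5, g6⟩
    have hbig : 2 ≤ v / 2 ^ i := by
      rw [Nat.le_div_iff_mul_le (by positivity), ← pow_succ']
      exact Nat.pow_le_of_le_log hx0 (by omega)
    have hz10 : s'.reg 10 = 1 := by rw [g6 10 (by simp [Ne.symm hy1]), h10]
    have hz11 : s'.reg 11 = 2 := by rw [g6 11 (by simp [Ne.symm hy2]), h11]
    refine ⟨by rw [g3, if_pos (by omega)]; simp, ?_⟩
    have hle : v / 2 ^ (i + 1) ≤ v := Nat.div_le_self _ _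
    refine Ends.op (v / 2 ^ (i + 1))
      (by simp only [BinOp.apply]; rw [g2, hz11, Nat.div_div_eq_div_mul, ← pow_succ]) (by omega) ?_
    refine Ends.op (i + 1) (by simp [BinOp.apply, hy3, g1, hz10]) (hlogw _ (by omega)) ?_
    refine Ends.op (if 1 < v / 2 ^ (i + 1) then 1 else 0)
      (by simp [BinOp.apply, hz10, Ne.symm hy1, Ne.symm hy3]) (hone _ _) ?_
    refine Ends.nil ?_
    simp only [State.reg_setReg, State.mem_setReg, State.out_setReg]
    refine ⟨by simp [hy4, hy5], by simp [Ne.symm hy3], by simp, g4, g5, fun z hz => ?_⟩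
    have hz' := g6 z hz
    simp only [List.mem_cons, List.not_mem_nil, or_false, not_or] at hz
    simp [hz, hz']
  · rintro s' ⟨-, -, g3, -⟩
    have : v / 2 ^ m < 2 := by
      rw [Nat.div_lt_iff_lt_mul (by positivity), ← pow_succ']
      exact Nat.lt_pow_succ_log_self (by norm_num) v
    rw [g3, if_neg (by omega)]
  · rintro s' ⟨g1, g2, g3, g4, g5, g6⟩
    refine Ends.nil ⟨by simp [hy5, g1], g4, g5, fun z hz => ?_⟩
    have hz' := g6 z hz
    simp only [List.mem_cons, List.not_mem_nil, or_false, not_or] at hz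
    simp [hz, hz']

end PoissonBinomial

namespace PoissonBinomial

/-! ### Lists in memory -/

/-- The memory that holds a list, from address `0` on. -/
def memOf (l : List ℕ) : ℕ → ℕ := fun a => l.getD a 0

theorem memOf_nil : memOf [] = fun _ => 0 := rfl

theorem memOf_append_zero (l : List ℕ) : memOf (l ++ [0]) = memOf l := by
  funext a
  simp only [memOf, List.getD_eq_getElem?_getD, List.getElem?_append, List.getElem?_cons,
    List.getElem?_nil]
  split_ifs with h1 h2
  · rfl
  · simp [List.getElem?_eq_none (not_lt.1 h1)]
  · simp [List.getElem?_eq_none (not_lt.1 h1)]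

theorem update_memOf (l : List ℕ) (x y : ℕ) (l' : List ℕ) :
    Function.update (memOf (l ++ x :: l')) l.length y = memOf (l ++ y :: l') := by
  funext a
  rw [Function.update_apply]
  simp only [memOf, List.getD_eq_getElem?_getD, List.getElem?_append]
  split_ifs with h1 h2
  · omega
  · simp [h1]
  · rfl
  · obtain ⟨j, hj⟩ : ∃ j, a - l.length = j + 1 := ⟨a - l.length - 1, by omega⟩
    simp [hj]

theorem update_memOf_append (l : List ℕ) (y : ℕ) :
    Function.update (memOf l) l.length y = memOf (l ++ [y]) := by
  rw [← memOf_append_zero l, update_memOf]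

theorem memOf_add (l l' : List ℕ) (j : ℕ) : memOf (l ++ l') (l.length + j) = memOf l' j := by
  simp [memOf, List.getD_eq_getElem?_getD, List.getElem?_append_right]

/-- The memory cells that describe digits and their positions. -/
def cells (es : List (ℕ × Slot)) : List ℕ :=
  es.flatMap fun e => [e.1, e.2.radix, e.2.code, e.2.keep, e.2.base]

theorem cells_cons (e : ℕ × Slot) (es : List (ℕ × Slot)) :
    cells (e :: es) = e.1 :: e.2.radix :: e.2.code :: e.2.keep :: e.2.base :: cells es := rfl

theorem cells_append (es es' : List (ℕ × Slot)) : cells (es ++ es') = cells es ++ cells es' :=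
  List.flatMap_append

theorem length_cells (es : List (ℕ × Slot)) : (cells es).length = 5 * es.length := by
  induction es with
  | nil => rfl
  | cons e es ih => simp only [cells_cons, List.length_cons, ih]; ring

/-- The positions with the mixed radix digits of `x`. -/
def entries : List Slot → ℕ → List (ℕ × Slot)
  | [], _ => []
  | σ :: σs, x => (x % σ.radix, σ) :: entries σs (x / σ.radix)

theorem length_entries (σs : List Slot) (x : ℕ) : (entries σs x).length = σs.length := by
  induction σs generalizing x with
  | nil => rfl
  | cons σ σs ih => simp [entries, ih]

theorem map_fst_entries (σs : List Slot) (x : ℕ) :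
    (entries σs x).map Prod.fst = digs (σs.map Slot.radix) x := by
  induction σs generalizing x with
  | nil => rfl
  | cons σ σs ih => simp [entries, digs, ih]

theorem map_snd_entries (σs : List Slot) (x : ℕ) : (entries σs x).map Prod.snd = σs := by
  induction σs generalizing x with
  | nil => rfl
  | cons σ σs ih => simp [entries, ih]

theorem entries_zero (σs : List Slot) : entries σs 0 = σs.map fun σ => (0, σ) := by
  induction σs with
  | nil => rfl
  | cons σ σs ih => simp [entries, ih]

/-! ### Writing a block to memory -/

/-- Append the positions of a block to the memory: address in register `8`, code, base, radix and
count in registers `13` to `16`. -/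
def pushProg : Program :=
  block [.const 17 0, .loop 16 (block [
    .op .add 8 8 10, .store 8 15, .op .add 8 8 10, .store 8 13, .op .add 8 8 10, .store 8 17,
    .op .add 8 8 10, .store 8 14, .op .add 8 8 10, .const 17 1, .const 14 0, .op .sub 16 16 10])]

/-- The address is advanced before the first store, so the digit cell is never written: memory
beyond the list is `0`, the required initial digit. After the first round registers `17` and `14`
hold `1` and `0`, the `keep` and `base` of all later positions. -/
theorem pushProg_ends {w : ℕ} {s : State} (b : Block) (es : List (ℕ × Slot))
    (hmem : s.mem = memOf (cells es)) (h8 : s.reg 8 = (cells es).length) (h10 : s.reg 10 = 1)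
    (h13 : s.reg 13 = b.code) (h14 : s.reg 14 = b.base) (h15 : s.reg 15 = b.radix)
    (h16 : s.reg 16 = b.count) (hw : 1 < 2 ^ w) (hlen : (cells es).length + 5 * b.count < 2 ^ w) :
    Ends w pushProg s (14 * b.count + 3) fun s' =>
      s'.mem = memOf (cells (es ++ b.slots.map fun σ => (0, σ))) ∧
      s'.reg 8 = (cells es).length + 5 * b.count ∧ s'.out = s.out ∧
      ∀ z, z ∉ [8, 14, 16, 17, 31] → s'.reg z = s.reg z := by
  refine Ends.mono (T := b.count * (13 + 1) + 1 + 1 + 1) ?_ (by omega) (fun _ h => h)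
  refine Ends.const (by omega) ?_
  refine Ends.cons (T := b.count * (13 + 1) + 1) (T' := 1) (Ends.loop b.count (fun i s' =>
      s'.mem = memOf (cells (es ++ ((List.range i).map b.slot).map fun σ => (0, σ))) ∧
      s'.reg 8 = (cells es).length + 5 * i ∧ s'.out = s.out ∧ s'.reg 16 = b.count - i ∧
      s'.reg 17 = (b.slot i).keep ∧ s'.reg 14 = (b.slot i).base ∧
      ∀ z, z ∉ [8, 14, 16, 17, 31] → s'.reg z = s.reg z) ?_ ?_ ?_) ?_
  · refine ⟨by simpa using hmem, by simpa using h8, rfl, by simpa using h16, by simp [Block.slot],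
      by simpa [Block.slot] using h14, fun z hz => ?_⟩
    simp only [List.mem_cons, List.not_mem_nil, or_false, not_or] at hz
    simp [hz]
  · rintro i hi s' ⟨g1, g2, g3, g4, g5, g6, g7⟩
    have z10 : s'.reg 10 = 1 := by rw [g7 10 (by decide), h10]
    have z13 : s'.reg 13 = b.code := by rw [g7 13 (by decide), h13]
    have z15 : s'.reg 15 = b.radix := by rw [g7 15 (by decide), h15]
    refine ⟨by omega, ?_⟩
    refine Ends.op ((cells es).length + 5 * i + 1) (by simp [BinOp.apply, g2, z10]) (by omega) ?_
    refine Ends.store _ b.radix (by simp; rfl) (by simp [z15]) ?_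
    refine Ends.op ((cells es).length + 5 * i + 2) (by simp [BinOp.apply, z10]) (by omega) ?_
    refine Ends.store _ b.code (by simp; rfl) (by simp [z13]) ?_
    refine Ends.op ((cells es).length + 5 * i + 3) (by simp [BinOp.apply, z10]) (by omega) ?_
    refine Ends.store _ _ (by simp; rfl) (by simp [g5]; rfl) ?_
    refine Ends.op ((cells es).length + 5 * i + 4) (by simp [BinOp.apply, z10]) (by omega) ?_
    refine Ends.store _ _ (by simp; rfl) (by simp [g6]; rfl) ?_
    refine Ends.op ((cells es).length + 5 * i + 5) (by simp [BinOp.apply, z10]) (by omega) ?_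
    refine Ends.const (by omega) (Ends.const (by omega) ?_)
    refine Ends.op (b.count - (i + 1)) (by simp [BinOp.apply, z10, g4]; omega) (by omega) ?_
    refine Ends.nil ⟨?_, by simp; ring, g3, by simp, by simp [Block.slot], by simp [Block.slot],
      fun z hz => ?_⟩
    · simp only [State.mem_setReg, State.mem_setMem, g1]
      have hl : (cells (es ++ ((List.range i).map b.slot).map fun σ => (0, σ))).length =
          (cells es).length + 5 * i := by
        rw [length_cells, length_cells]; simp; ring
      rw [List.range_succ, List.map_append, List.map_append, ← List.append_assoc,
        cells_append (es ++ List.map _ (List.map b.slot (List.range i)))]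
      generalize cells (es ++ ((List.range i).map b.slot).map fun σ => (0, σ)) = l at hl ⊢
      rw [← hl, ← memOf_append_zero l,
        show l.length + 1 = (l ++ [0]).length by simp, update_memOf_append,
        show l.length + 2 = (l ++ [0] ++ [b.radix]).length by simp, update_memOf_append,
        show l.length + 3 = (l ++ [0] ++ [b.radix] ++ [b.code]).length by simp, update_memOf_append,
        show l.length + 4 = (l ++ [0] ++ [b.radix] ++ [b.code] ++ [(b.slot i).keep]).length by simp,
        update_memOf_append]
      simp [cells, Block.slot]
    · have hz' := g7 z hz
      simp only [List.mem_cons, List.not_mem_nil, or_false, not_or] at hz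
      simp [hz, hz']
  · rintro s' ⟨-, -, -, g4, -⟩
    omega
  · rintro s' ⟨g1, g2, g3, g4, g5, g6, g7⟩
    refine Ends.nil ⟨g1, by simpa using g2, g3, fun z hz => ?_⟩
    have hz' := g7 z hz
    simp only [List.mem_cons, List.not_mem_nil, or_false, not_or] at hz
    simp [hz, hz']

end PoissonBinomial

namespace PoissonBinomial

/-! ### Passes over the digits -/

/-- Visit one position: load it, update the accumulator in register `22`, and execute `X` if the
accumulator is not zero; its code is in register `13`. -/
def scanBody (X : Program) : Program :=
  block [.load 20 8, .op .add 8 8 10, .op .add 8 8 10, .load 13 8, .op .add 8 8 10, .load 17 8,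
    .op .add 8 8 10, .load 14 8, .op .add 8 8 10, .op .mul 22 22 17, .op .add 22 22 14,
    .op .add 22 22 20, .ite 22 X (block []), .op .lt 21 8 9]

/-- Visit all positions below the address in register `9`. -/
def scanProg (X : Program) : Program :=
  block [.const 8 0, .const 22 0, .const 23 0, .op .lt 21 8 9, .loop 21 (scanBody X)]

/-- `X` adds `κ` to register `23` and writes `φ (register 22, register 13)` to the output. -/
def Visits (w : ℕ) (X : Program) (κ : ℕ) (φ : ℕ × ℕ → List ℕ) : Prop :=
  ∀ s : State, s.reg 23 + 1 < 2 ^ w → s.reg 10 = 1 → Ends w X s 3 fun s' =>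
    s'.reg 23 = s.reg 23 + κ ∧ s'.out = s.out ++ φ (s.reg 22, s.reg 13) ∧ s'.mem = s.mem ∧
      ∀ z, z ∉ [23, 31] → s'.reg z = s.reg z

/-- Induction on the positions still to be visited; `l` holds the memory already passed. As `keep ≤
1`, the accumulator never exceeds `a` plus the sum of all digits and bases, so `hsum` excludes
overflow. -/
theorem scanLoop_ends {w : ℕ} {X : Program} {κ : ℕ} {φ : ℕ × ℕ → List ℕ} (hκ : κ ≤ 1)
    (hX : Visits w X κ φ) (es : List (ℕ × Slot)) (hk : ∀ e ∈ es, e.2.keep ≤ 1) (l : List ℕ)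
    (a : ℕ) (s : State) (hmem : s.mem = memOf (l ++ cells es)) (h8 : s.reg 8 = l.length)
    (h9 : s.reg 9 = l.length + 5 * es.length) (h9w : s.reg 9 < 2 ^ w) (h10 : s.reg 10 = 1)
    (h22 : s.reg 22 = a) (h21 : s.reg 21 = if s.reg 8 < s.reg 9 then 1 else 0)
    (hsum : a + (es.map fun e => e.1 + e.2.base).sum < 2 ^ w)
    (h23 : s.reg 23 + es.length < 2 ^ w) :
    Ends w (.loop 21 (scanBody X)) s (20 * es.length + 1) fun s' => s'.mem = s.mem ∧
      s'.reg 23 = s.reg 23 + κ * (decode a (es.map Prod.snd) (es.map Prod.fst)).length ∧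
      s'.out = s.out ++ (decode a (es.map Prod.snd) (es.map Prod.fst)).flatMap φ ∧
      ∀ z, z ∉ [8, 13, 14, 17, 20, 21, 22, 23, 31] → s'.reg z = s.reg z := by
  induction es generalizing l a s with
  | nil =>
    refine Ends.loop_zero ?_ ?_
    · rw [h21, h8, h9]; simp
    · simp [decode]
  | cons e es ih =>
    obtain ⟨d, σ⟩ := e
    simp only [List.map_cons, List.sum_cons, List.length_cons, decode] at hsum h23 h9 ⊢
    rw [cells_cons] at hmem
    have hkeep : σ.keep ≤ 1 := hk (d, σ) (by simp)
    set a' := a * σ.keep + σ.base + d with ha'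
    have hak : a * σ.keep ≤ a := by
      calc a * σ.keep ≤ a * 1 := Nat.mul_le_mul_left _ hkeep
        _ = a := mul_one a
    have hone : ∀ a b : ℕ, (if a < b then 1 else 0) < 2 ^ w := fun a b => by split_ifs <;> omega
    refine Ends.mono (T := (4 + (1 + 1) + 1 + 1 + 1 + 1 + 1 + 1 + 1 + 1 + 1 + 1 + 1 + 1) +
      (20 * es.length + 1) + 1) ?_ (by ring_nf; omega) (fun _ h => h)
    refine Ends.loop_step (R := fun s' => s'.mem = s.mem ∧ s'.reg 8 = l.length + 5 ∧
      s'.reg 21 = (if l.length + 5 < s.reg 9 then 1 else 0) ∧ s'.reg 22 = a' ∧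
      s'.reg 23 = s.reg 23 + (if a' = 0 then 0 else κ) ∧
      s'.out = s.out ++ (if a' = 0 then [] else φ (a', σ.code)) ∧
      ∀ z, z ∉ [8, 13, 14, 17, 20, 21, 22, 23, 31] → s'.reg z = s.reg z) ?_ ?_ ?_
    · rw [h21, if_pos (by omega)]; simp
    · refine Ends.load d (by rw [hmem, h8]; exact memOf_add _ _ 0) ?_
      refine Ends.op (l.length + 1) (by simp [BinOp.apply, h8, h10]) (by omega) ?_
      refine Ends.op (l.length + 2) (by simp [BinOp.apply, h10]) (by omega) ?_
      refine Ends.load σ.code (by simp [hmem]; exact memOf_add _ _ 2) ?_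
      refine Ends.op (l.length + 3) (by simp [BinOp.apply, h10]) (by omega) ?_
      refine Ends.load σ.keep (by simp [hmem]; exact memOf_add _ _ 3) ?_
      refine Ends.op (l.length + 4) (by simp [BinOp.apply, h10]) (by omega) ?_
      refine Ends.load σ.base (by simp [hmem]; exact memOf_add _ _ 4) ?_
      refine Ends.op (l.length + 5) (by simp [BinOp.apply, h10]) (by omega) ?_
      refine Ends.op (a * σ.keep) (by simp [BinOp.apply, h22]) (by omega) ?_
      refine Ends.op (a * σ.keep + σ.base) (by simp [BinOp.apply]) (by omega) ?_
      refine Ends.op a' (by simp [BinOp.apply, ha']) (by omega) ?_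
      refine Ends.cons (T := 4) (T' := 1 + 1) (R := fun s' => s'.mem = s.mem ∧
        s'.reg 8 = l.length + 5 ∧ s'.reg 22 = a' ∧
        s'.reg 23 = s.reg 23 + (if a' = 0 then 0 else κ) ∧
        s'.out = s.out ++ (if a' = 0 then [] else φ (a', σ.code)) ∧
        ∀ z, z ∉ [8, 13, 14, 17, 20, 21, 22, 23, 31] → s'.reg z = s.reg z)
        (Ends.ite (T := 3) ?_ ?_) ?_
      · intro ha
        have ha : a' ≠ 0 := by simpa using ha
        refine Ends.mono (hX _ (by simp; omega) (by simp [h10])) le_rfl ?_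
        rintro s' ⟨g1, g2, g3, g4⟩
        refine ⟨g3, ?_, ?_, ?_, ?_, fun z hz => ?_⟩
        · rw [g4 8 (by decide)]; simp
        · rw [g4 22 (by decide)]; simp
        · rw [g1, if_neg ha]; simp
        · rw [g2, if_neg ha]; simp
        · simp only [List.mem_cons, List.not_mem_nil, or_false, not_or] at hz
          rw [g4 z (by simp [hz])]
          simp [hz]
      · intro ha
        have ha : a' = 0 := by simpa using ha
        refine Ends.mono (Ends.nil (Q := fun s' => _) ?_) (by omega) (fun _ h => h)
        refine ⟨rfl, by simp, by simp, by simp [ha], by simp [ha], fun z hz => ?_⟩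
        simp only [List.mem_cons, List.not_mem_nil, or_false, not_or] at hz
        simp [hz]
      · rintro s' ⟨g1, g2, g3, g4, g5, g6⟩
        refine Ends.op (if l.length + 5 < s.reg 9 then 1 else 0)
          (by simp [BinOp.apply, g2, g6 9 (by decide)]) (hone _ _) (Ends.nil ?_)
        refine ⟨g1, by simp [g2], by simp, by simp [g3], by simp [g4], g5, fun z hz => ?_⟩
        have hz' := g6 z hz
        simp only [List.mem_cons, List.not_mem_nil, or_false, not_or] at hz
        simp [hz, hz']
    · rintro s' ⟨g1, g2, g3, g4, g5, g6, g7⟩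
      have z9 : s'.reg 9 = s.reg 9 := g7 9 (by decide)
      refine Ends.mono (ih (fun e he => hk e (by simp [he]))
        (l ++ [d, σ.radix, σ.code, σ.keep, σ.base]) a' s' (by rw [g1, hmem]; simp)
        (by rw [g2]; simp) (by rw [z9, h9]; simp; ring) (by rw [z9]; exact h9w)
        (by rw [g7 10 (by decide), h10]) g4 (by rw [g3, g2, z9]) (by omega)
        (by rw [g5]; split_ifs <;> omega)) le_rfl ?_
      rintro s'' ⟨k1, k2, k3, k4⟩
      refine ⟨k1.trans g1, ?_, ?_, fun z hz => (k4 z hz).trans (g7 z hz)⟩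
      · rw [k2, g5]
        split_ifs <;> simp; ring
      · rw [k3, g6]
        split_ifs <;> simp

theorem scanProg_ends {w : ℕ} {X : Program} {κ : ℕ} {φ : ℕ × ℕ → List ℕ} (hκ : κ ≤ 1)
    (hX : Visits w X κ φ) (es : List (ℕ × Slot)) (hk : ∀ e ∈ es, e.2.keep ≤ 1) (s : State)
    (hmem : s.mem = memOf (cells es)) (h9 : s.reg 9 = 5 * es.length) (h9w : s.reg 9 < 2 ^ w)
    (h10 : s.reg 10 = 1) (hsum : (es.map fun e => e.1 + e.2.base).sum < 2 ^ w) (hw : 1 < 2 ^ w) :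
    Ends w (scanProg X) s (20 * es.length + 6) fun s' => s'.mem = s.mem ∧
      s'.reg 23 = κ * (decode 0 (es.map Prod.snd) (es.map Prod.fst)).length ∧
      s'.out = s.out ++ (decode 0 (es.map Prod.snd) (es.map Prod.fst)).flatMap φ ∧
      ∀ z, z ∉ [8, 13, 14, 17, 20, 21, 22, 23, 31] → s'.reg z = s.reg z := by
  have hone : ∀ a b : ℕ, (if a < b then 1 else 0) < 2 ^ w := fun a b => by split_ifs <;> omega
  refine Ends.mono (T := (20 * es.length + 1) + 1 + 1 + 1 + 1 + 1) ?_ (by omega) (fun _ h => h)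
  refine Ends.const (by omega) (Ends.const (by omega) (Ends.const (by omega) ?_))
  refine Ends.op (if 0 < s.reg 9 then 1 else 0) (by simp [BinOp.apply]) (hone _ _) ?_
  refine Ends.cons (T := 20 * es.length + 1) (T' := 1)
    (scanLoop_ends hκ hX es hk [] 0 _ (by simpa using hmem) (by simp) (by simpa using h9)
    (by simpa using h9w) (by simpa using h10) (by simp) (by simp) (by simpa using hsum)
    (by simp; omega)) ?_
  rintro s' ⟨g1, g2, g3, g4⟩
  refine Ends.nil ⟨by simpa using g1, by simpa using g2, by simpa using g3, fun z hz => ?_⟩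
  have hz' := g4 z hz
  simp only [List.mem_cons, List.not_mem_nil, or_false, not_or] at hz
  simp [hz, hz']

theorem visits_count {w : ℕ} : Visits w (block [.op .add 23 23 10]) 1 fun _ => [] := by
  intro s h h10
  refine Ends.mono (T := 1 + 1) ?_ (by omega) (fun _ h => h)
  refine Ends.op (s.reg 23 + 1) (by simp [BinOp.apply, h10]) h (Ends.nil ?_)
  refine ⟨by simp, by simp, rfl, fun z hz => ?_⟩
  simp only [List.mem_cons, List.not_mem_nil, or_false, not_or] at hz
  simp [hz]

theorem visits_emit {w : ℕ} : Visits w (block [.emit 22, .emit 13]) 0 fun y => [y.1, y.2] := by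
  intro s h h10
  refine Ends.mono (T := 1 + 1 + 1) ?_ (by omega) (fun _ h => h)
  refine Ends.emit _ rfl (Ends.emit _ rfl (Ends.nil ?_))
  refine ⟨by simp, by simp, rfl, fun z hz => ?_⟩
  simp only [List.mem_cons, List.not_mem_nil, or_false, not_or] at hz
  simp [hz]

/-! ### Incrementing the digits -/

/-- Add the carry in register `25` to one digit. Register `18` holds `5`. -/
def incrBody : Program :=
  block [.load 20 8, .op .add 24 8 10, .load 15 24, .op .add 20 20 25, .op .mod 26 20 15,
    .store 8 26, .op .div 25 20 15, .op .add 8 8 18, .op .lt 21 8 9]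

/-- Increment the number whose digits are in memory; the final carry is in register `25`. -/
def incrProg : Program :=
  block [.const 8 0, .const 25 1, .const 18 5, .op .lt 21 8 9, .loop 21 incrBody]

/-- Schoolbook addition: as a digit is smaller than its radix, a carry of at most `1` produces a
carry of at most `1`. The carry that leaves the last position is the overflow of the whole number.
-/
theorem incrLoop_ends {w : ℕ} (σs : List Slot) (hr : ∀ σ ∈ σs, 0 < σ.radix ∧ σ.radix < 2 ^ w)
    (l : List ℕ) (x c : ℕ) (hc : c ≤ 1) (hx : x < (σs.map Slot.radix).prod) (s : State)
    (hmem : s.mem = memOf (l ++ cells (entries σs x))) (h8 : s.reg 8 = l.length)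
    (h9 : s.reg 9 = l.length + 5 * σs.length) (h9w : s.reg 9 < 2 ^ w) (h10 : s.reg 10 = 1)
    (h18 : s.reg 18 = 5) (h25 : s.reg 25 = c)
    (h21 : s.reg 21 = if s.reg 8 < s.reg 9 then 1 else 0) :
    Ends w (.loop 21 incrBody) s (20 * σs.length + 1) fun s' =>
      s'.mem = memOf (l ++ cells (entries σs (x + c))) ∧
      s'.reg 25 = (x + c) / (σs.map Slot.radix).prod ∧ s'.out = s.out ∧
      ∀ z, z ∉ [8, 15, 20, 21, 24, 25, 26, 31] → s'.reg z = s.reg z := by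
  induction σs generalizing l x c s with
  | nil =>
    simp only [List.map_nil, List.prod_nil, Nat.lt_one_iff] at hx
    refine Ends.loop_zero ?_ ?_
    · rw [h21, h8, h9]; simp
    · simp [hmem, entries, h25, hx]
  | cons σ σs ih =>
    simp only [List.map_cons, List.prod_cons, List.length_cons, entries] at hx h9 hmem ⊢
    rw [cells_cons] at hmem
    dsimp only at hmem
    obtain ⟨hr0, hrw⟩ := hr σ (by simp)
    have hone : ∀ a b : ℕ, (if a < b then 1 else 0) < 2 ^ w := fun a b => by split_ifs <;> omega
    have hmod : x % σ.radix < σ.radix := Nat.mod_lt _ hr0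
    have hmod' : (x + c) % σ.radix < σ.radix := Nat.mod_lt _ hr0
    set c' := (x % σ.radix + c) / σ.radix with hc'
    have hc'1 : c' ≤ 1 := by
      exact Nat.lt_succ_iff.1 (Nat.div_lt_of_lt_mul (by omega))
    -- The carry is exactly what the remaining digits have to add.
    have hdiv : (x + c) / σ.radix = x / σ.radix + c' := by
      conv_lhs => rw [← Nat.div_add_mod x σ.radix, add_assoc]
      rw [Nat.mul_add_div hr0]
    refine Ends.mono (T := (1 + 1 + 1 + 1 + 1 + 1 + 1 + 1 + 1 + 1) +
      (20 * σs.length + 1) + 1) ?_ (by ring_nf; omega) (fun _ h => h)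
    refine Ends.loop_step (R := fun s' =>
      s'.mem = memOf (l ++ [(x + c) % σ.radix, σ.radix, σ.code, σ.keep, σ.base] ++
        cells (entries σs (x / σ.radix))) ∧ s'.reg 8 = l.length + 5 ∧
      s'.reg 21 = (if l.length + 5 < s.reg 9 then 1 else 0) ∧ s'.reg 25 = c' ∧ s'.out = s.out ∧
      ∀ z, z ∉ [8, 15, 20, 21, 24, 25, 26, 31] → s'.reg z = s.reg z) ?_ ?_ ?_
    · rw [h21, if_pos (by omega)]; simp
    · refine Ends.load (x % σ.radix) (by rw [hmem, h8]; exact memOf_add _ _ 0) ?_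
      refine Ends.op (l.length + 1) (by simp [BinOp.apply, h8, h10]) (by omega) ?_
      refine Ends.load σ.radix (by simp [hmem]; exact memOf_add _ _ 1) ?_
      refine Ends.op (x % σ.radix + c) (by simp [BinOp.apply, h25]) (by omega) ?_
      refine Ends.op ((x + c) % σ.radix) (by simp [BinOp.apply]) (by omega) ?_
      refine Ends.store l.length _ (by simp [h8]) (by simp; rfl) ?_
      refine Ends.op c' (by simp [BinOp.apply, hc']) (by omega) ?_
      refine Ends.op (l.length + 5) (by simp [BinOp.apply, h8, h18]) (by omega) ?_
      refine Ends.op (if l.length + 5 < s.reg 9 then 1 else 0) (by simp [BinOp.apply])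
        (hone _ _) (Ends.nil ?_)
      refine ⟨?_, by simp, by simp, by simp, rfl, fun z hz => ?_⟩
      · simp only [State.mem_setReg, State.mem_setMem, hmem]
        rw [update_memOf]
        simp
      · simp only [List.mem_cons, List.not_mem_nil, or_false, not_or] at hz
        simp [hz]
    · rintro s' ⟨g1, g2, g3, g4, g5, g6⟩
      have z9 : s'.reg 9 = s.reg 9 := g6 9 (by decide)
      refine Ends.mono (ih (fun σ hσ => hr σ (by simp [hσ]))
        (l ++ [(x + c) % σ.radix, σ.radix, σ.code, σ.keep, σ.base]) (x / σ.radix) c' hc'1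
        (Nat.div_lt_of_lt_mul hx) s' g1 (by rw [g2]; simp) (by rw [z9, h9]; simp; ring)
        (by rw [z9]; exact h9w) (by rw [g6 10 (by decide), h10]) (by rw [g6 18 (by decide), h18])
        g4 (by rw [g3, g2, z9])) le_rfl ?_
      rintro s'' ⟨k1, k2, k3, k4⟩
      refine ⟨?_, ?_, k3.trans g5, fun z hz => (k4 z hz).trans (g6 z hz)⟩
      · rw [k1, cells_cons, hdiv]; simp
      · rw [k2, ← hdiv, Nat.div_div_eq_div_mul]

theorem incrProg_ends {w : ℕ} (σs : List Slot) (hr : ∀ σ ∈ σs, 0 < σ.radix ∧ σ.radix < 2 ^ w)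
    (x : ℕ) (hx : x < (σs.map Slot.radix).prod) (s : State)
    (hmem : s.mem = memOf (cells (entries σs x))) (h9 : s.reg 9 = 5 * σs.length)
    (h9w : s.reg 9 < 2 ^ w) (h10 : s.reg 10 = 1) (hw : 5 < 2 ^ w) :
    Ends w incrProg s (20 * σs.length + 6) fun s' =>
      s'.mem = memOf (cells (entries σs (x + 1))) ∧
      s'.reg 25 = (x + 1) / (σs.map Slot.radix).prod ∧ s'.out = s.out ∧
      ∀ z, z ∉ [8, 15, 18, 20, 21, 24, 25, 26, 31] → s'.reg z = s.reg z := by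
  have hone : ∀ a b : ℕ, (if a < b then 1 else 0) < 2 ^ w := fun a b => by split_ifs <;> omega
  refine Ends.mono (T := (20 * σs.length + 1) + 1 + 1 + 1 + 1 + 1) ?_ (by omega) (fun _ h => h)
  refine Ends.const (by omega) (Ends.const (by omega) (Ends.const (by omega) ?_))
  refine Ends.op (if 0 < s.reg 9 then 1 else 0) (by simp [BinOp.apply]) (hone _ _) ?_
  refine Ends.cons (T := 20 * σs.length + 1) (T' := 1)
    (incrLoop_ends σs hr [] x 1 le_rfl hx _ (by simpa using hmem) (by simp) (by simpa using h9)
    (by simpa using h9w) (by simpa using h10) (by simp) (by simp) (by simp)) ?_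
  rintro s' ⟨g1, g2, g3, g4⟩
  refine Ends.nil ⟨by simpa using g1, by simpa using g2, by simpa using g3, fun z hz => ?_⟩
  have hz' := g4 z (by simp at hz ⊢; tauto)
  simp only [List.mem_cons, List.not_mem_nil, or_false, not_or] at hz
  simp [hz, hz']

/-! ### Enumeration -/

/-- List all configurations; the end of the positions in memory is in register `9`. -/
def enumProg : Program :=
  block [.const 27 1, .loop 27 (block [
    scanProg (block [.op .add 23 23 10]), .emit 23, scanProg (block [.emit 22, .emit 13]),
    incrProg, .op .sub 27 10 25])]

/-- Each configuration is scanned twice, because its length must precede its entries in a write-only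
output: the first pass counts, the second one emits. -/
theorem enumProg_ends {w : ℕ} (bs : List Block)
    (hr : ∀ b ∈ bs, 0 < b.radix) (s : State)
    (hmem : s.mem = memOf (cells (entries (slots bs) 0)))
    (h9 : s.reg 9 = 5 * (slots bs).length) (h9w : s.reg 9 < 2 ^ w) (h10 : s.reg 10 = 1)
    (hsum : ((slots bs).map fun σ => σ.radix + σ.base).sum < 2 ^ w) (hw : 5 < 2 ^ w) :
    Ends w enumProg s (numConfigs bs * (60 * (slots bs).length + 22) + 3) fun s' =>
      s'.out = s.out ++ (List.range (numConfigs bs)).flatMap fun x =>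
        (config bs x).length :: (config bs x).flatMap fun y => [y.1, y.2] := by
  have hr' : ∀ σ ∈ slots bs, 0 < σ.radix := by
    intro σ hσ
    simp only [slots, Block.slots, List.mem_map, List.mem_flatMap] at hσ
    obtain ⟨b, hb, t, -, rfl⟩ := hσ
    exact hr b hb
  have hkeep : ∀ σ ∈ slots bs, σ.keep ≤ 1 := by
    intro σ hσ
    simp only [slots, Block.slots, List.mem_map, List.mem_flatMap] at hσ
    obtain ⟨b, hb, t, -, rfl⟩ := hσ
    simp only [Block.slot]
    split_ifs <;> omega
  have hpos : 0 < numConfigs bs := List.prod_pos (by simpa using hr')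
  have hlt : ∀ σ ∈ slots bs, 0 < σ.radix ∧ σ.radix < 2 ^ w := by
    intro σ hσ
    refine ⟨hr' σ hσ, lt_of_le_of_lt ?_ hsum⟩
    have := List.single_le_sum (l := (slots bs).map fun σ => σ.radix + σ.base) (by simp)
      _ (List.mem_map_of_mem hσ)
    omega
  have hkeep' : ∀ x, ∀ e ∈ entries (slots bs) x, e.2.keep ≤ 1 := by
    intro x e he
    refine hkeep _ ?_
    rw [← map_snd_entries (slots bs) x]
    exact List.mem_map_of_mem he
  have hsum' : ∀ x, ((entries (slots bs) x).map fun e => e.1 + e.2.base).sum < 2 ^ w := by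
    intro x
    refine lt_of_le_of_lt ?_ hsum
    clear hsum hkeep' hlt hkeep hmem h9
    generalize slots bs = σs at hr'
    induction σs generalizing x with
    | nil => simp [entries]
    | cons σ σs ih =>
      have h1 := ih (x / σ.radix) (fun σ h => hr' σ (by simp [h]))
      have h2 := Nat.mod_lt x (hr' σ (by simp))
      simp only [entries, List.map_cons, List.sum_cons]
      omega
  have hdec : ∀ x, decode 0 ((entries (slots bs) x).map Prod.snd)
      ((entries (slots bs) x).map Prod.fst) = config bs x := by
    intro x
    rw [map_fst_entries, map_snd_entries]; rfl
  set M := numConfigs bs with hM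
  set m := (slots bs).length with hm
  have hlen : ∀ x, (entries (slots bs) x).length = m := length_entries _
  refine Ends.mono (T := M * ((20 * m + 6) + ((20 * m + 6) + ((20 * m + 6) + (1 + 1)) + 1) + 1) +
    1 + 1 + 1) ?_ (by ring_nf; omega) (fun _ h => h)
  refine Ends.const (by omega) ?_
  refine Ends.cons (T := M * ((20 * m + 6) + ((20 * m + 6) + ((20 * m + 6) + (1 + 1)) + 1) + 1) + 1)
    (T' := 1) (Ends.loop M (fun i s' => s'.mem = memOf (cells (entries (slots bs) i)) ∧
      s'.reg 27 = (if i < M then 1 else 0) ∧ s'.reg 9 = s.reg 9 ∧ s'.reg 10 = 1 ∧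
      s'.out = s.out ++ (List.range i).flatMap fun x =>
        (config bs x).length :: (config bs x).flatMap fun y => [y.1, y.2]) ?_ ?_ ?_) ?_
  · exact ⟨hmem, by simp [hpos], by simp, by simp [h10], by simp⟩
  · rintro i hi s' ⟨g1, g2, g3, g4, g5⟩
    refine ⟨by rw [g2, if_pos hi]; simp, ?_⟩
    refine Ends.cons (scanProg_ends (κ := 1) le_rfl visits_count _ (hkeep' i) s' g1
      (by rw [g3, h9, hlen]) (by rw [g3]; exact h9w) g4 (hsum' i) (by omega) |>.mono
        (T' := 20 * m + 6) (by rw [hlen]) (fun _ h => h)) ?_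
    rintro s1 ⟨k1, k2, k3, k4⟩
    rw [hdec, one_mul] at k2
    refine Ends.emit _ k2 ?_
    refine Ends.cons (scanProg_ends (κ := 0) (by omega) visits_emit _ (hkeep' i)
      (s1.emit (config bs i).length) (k1.trans g1) (by rw [State.reg_emit, k4 9 (by decide), g3, h9, hlen])
      (by rw [State.reg_emit, k4 9 (by decide), g3]; exact h9w)
      (by rw [State.reg_emit, k4 10 (by decide), g4]) (hsum' i) (by omega) |>.mono
        (T' := 20 * m + 6) (by rw [hlen]) (fun _ h => h)) ?_
    rintro s2 ⟨l1, -, l3, l4⟩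
    rw [hdec] at l3
    refine Ends.cons (incrProg_ends _ hlt i hi _ ((l1.trans k1).trans g1)
      (by rw [l4 9 (by decide), State.reg_emit, k4 9 (by decide), g3, h9])
      (by rw [l4 9 (by decide), State.reg_emit, k4 9 (by decide), g3]; exact h9w)
      (by rw [l4 10 (by decide), State.reg_emit, k4 10 (by decide), g4]) hw) ?_
    rintro s3 ⟨m1, m2, m3, m4⟩
    have z10 : s3.reg 10 = 1 := by
      rw [m4 10 (by decide), l4 10 (by decide), State.reg_emit, k4 10 (by decide), g4]
    -- The carry out of the last digit appears for the first time after `M` increments and ends the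
    -- loop.
    have z25 : 1 - s3.reg 25 = if i + 1 < M then 1 else 0 := by
      rw [m2]
      change 1 - (i + 1) / M = _
      split_ifs with h
      · rw [Nat.div_eq_of_lt h]
      · rw [show i + 1 = M by omega, Nat.div_self hpos]
    refine Ends.op (if i + 1 < M then 1 else 0) (by simp only [BinOp.apply]; rw [z10, z25])
      (by split_ifs <;> omega) (Ends.nil ?_)
    refine ⟨m1, by simp, ?_, by simp [z10], ?_⟩
    · simp [m4 9 (by decide), l4 9 (by decide), k4 9 (by decide), g3]
    · simp only [State.out_setReg]
      rw [m3, l3, State.out_emit, k3, g5, List.range_succ, List.flatMap_append]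
      simp
  · rintro s' ⟨-, g2, -⟩
    rw [g2, if_neg (lt_irrefl _)]
  · rintro s' ⟨-, -, -, -, g5⟩
    exact Ends.nil g5

end PoissonBinomial

namespace PoissonBinomial

/-! ### The program -/

/-- The blocks of the first `m` levels. -/
def levelBlocks (r K : ℕ → ℕ) (m : ℕ) : List Block :=
  (List.range m).flatMap fun i => [⟨2 * i + 2, 0, r i, K i⟩, ⟨2 * i + 3, 0, r i, K i⟩]

theorem levelBlocks_succ (r K : ℕ → ℕ) (m : ℕ) : levelBlocks r K (m + 1) =
    levelBlocks r K m ++ [⟨2 * m + 2, 0, r m, K m⟩, ⟨2 * m + 3, 0, r m, K m⟩] := by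
  rw [levelBlocks, List.range_succ, List.flatMap_append]
  simp [levelBlocks]

theorem slots_append (bs bs' : List Block) : slots (bs ++ bs') = slots bs ++ slots bs' :=
  List.flatMap_append

theorem length_slots_levelBlocks (r K : ℕ → ℕ) (m : ℕ) :
    (slots (levelBlocks r K m)).length = ∑ i ∈ Finset.range m, 2 * K i := by
  induction m with
  | zero => rfl
  | succ m ih =>
    rw [levelBlocks_succ, slots_append, List.length_append, ih, Finset.sum_range_succ, length_slots]
    simp
    ring

theorem blocks_eq (ℓ : ℕ) (r K : ℕ → ℕ) (z o P : ℕ) : blocks ℓ r K z o P =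
    levelBlocks r K (ℓ + 1) ++
      [⟨2 * ℓ + 4, 0, 2, 1⟩, ⟨2 * ℓ + 5, 0, 2, 1⟩, ⟨0, z, P, 1⟩, ⟨1, o, P, 1⟩] := rfl

theorem length_slots_blocks (ℓ : ℕ) (r K : ℕ → ℕ) (z o P : ℕ) :
    (slots (blocks ℓ r K z o P)).length = (∑ i ∈ Finset.range (ℓ + 1), 2 * K i) + 4 := by
  rw [blocks_eq, slots_append, List.length_append, length_slots_levelBlocks, length_slots]
  simp

/-- Positions with zero digits. -/
def zeros (σs : List Slot) : List (ℕ × Slot) := σs.map fun σ => (0, σ)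

theorem length_cells_zeros (σs : List Slot) : (cells (zeros σs)).length = 5 * σs.length := by
  rw [length_cells, zeros, List.length_map]

theorem zeros_append (σs σs' : List Slot) : zeros (σs ++ σs') = zeros σs ++ zeros σs' :=
  List.map_append

/-- The contents of registers and memory while blocks are written to memory. -/
structure Env (n μ s L b G i D : ℕ) (σs : List Slot) (st : State) : Prop where
  r0 : st.reg 0 = n
  r2 : st.reg 2 = μ
  r3 : st.reg 3 = s
  r4 : st.reg 4 = L
  r5 : st.reg 5 = b
  r6 : st.reg 6 = G
  r7 : st.reg 7 = i
  r8 : st.reg 8 = 5 * σs.length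
  r10 : st.reg 10 = 1
  r11 : st.reg 11 = 2
  r12 : st.reg 12 = D * L
  r29 : st.reg 29 = D
  r30 : st.reg 30 = D + 2
  mem : st.mem = memOf (cells (zeros σs))
  out : st.out = []

variable {w n μ s L b G i D : ℕ} {σs : List Slot} {st : State}

/-- Writing a block leaves everything else in place. -/
theorem Env.push (n μ s L b G i D : ℕ) (σs : List Slot) {cs : List Program} {Q : State → Prop}
    (c : Block) {T T' : ℕ}
    (h13 : st.reg 13 = c.code)
    (h14 : st.reg 14 = c.base) (h15 : st.reg 15 = c.radix) (h16 : st.reg 16 = c.count)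
    (hw : 1 < 2 ^ w) (h : Env n μ s L b G i D σs st) (hlen : 5 * (σs.length + c.count) < 2 ^ w)
    (hT : 14 * c.count + 3 ≤ T)
    (hQ : ∀ st', Env n μ s L b G i D (σs ++ c.slots) st' →
      (∀ z, z ∉ [8, 14, 16, 17, 31] → st'.reg z = st.reg z) → Ends w (block cs) st' T' Q) :
    Ends w (block (pushProg :: cs)) st (T + T') Q := by
  refine Ends.cons (Ends.mono (pushProg_ends c (zeros σs) h.mem (by rw [h.r8, length_cells_zeros])
    h.r10 h13 h14 h15 h16 hw (by rw [length_cells_zeros]; omega)) hT fun _ h => h) ?_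
  rintro st' ⟨g1, g2, g3, g4⟩
  have e : ∀ z v, z ∉ [8, 14, 16, 17, 31] → st.reg z = v → st'.reg z = v := fun z v hz hv => by
    rw [g4 z hz, hv]
  exact hQ st' ⟨e _ _ (by decide) h.r0, e _ _ (by decide) h.r2, e _ _ (by decide) h.r3,
    e _ _ (by decide) h.r4, e _ _ (by decide) h.r5, e _ _ (by decide) h.r6, e _ _ (by decide) h.r7,
    by rw [g2, length_cells_zeros, List.length_append]; simp [Block.slots]; ring,
    e _ _ (by decide) h.r10, e _ _ (by decide) h.r11, e _ _ (by decide) h.r12,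
    e _ _ (by decide) h.r29, e _ _ (by decide) h.r30, by rw [g1, zeros_append]; rfl,
    by rw [g3, h.out]⟩ g4

/-- Registers that are not mentioned may be overwritten. -/
theorem Env.setReg (h : Env n μ s L b G i D σs st) {x : ℕ} (v : ℕ)
    (hx : x ∉ [0, 2, 3, 4, 5, 6, 7, 8, 10, 11, 12, 29, 30]) :
    Env n μ s L b G i D σs (st.setReg x v) := by
  simp only [List.mem_cons, List.not_mem_nil, or_false, not_or] at hx
  obtain ⟨h0, h2, h3, h4, h5, h6, h7, h8, h10, h11, h12, h29, h30⟩ := hx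
  exact ⟨by simp [h.r0, Ne.symm h0], by simp [h.r2, Ne.symm h2], by simp [h.r3, Ne.symm h3],
    by simp [h.r4, Ne.symm h4], by simp [h.r5, Ne.symm h5], by simp [h.r6, Ne.symm h6],
    by simp [h.r7, Ne.symm h7], by simp [h.r8, Ne.symm h8], by simp [h.r10, Ne.symm h10],
    by simp [h.r11, Ne.symm h11], by simp [h.r12, Ne.symm h12], by simp [h.r29, Ne.symm h29],
    by simp [h.r30, Ne.symm h30], h.mem, h.out⟩

/-- Write the two blocks of a level. -/
def levelProg : Program :=
  block [.op .mul 15 3 5, .op .mul 15 15 11, .op .mul 15 15 11, .op .add 15 15 11, .op .div 28 4 6,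
    .op .mul 28 28 29, .op .add 28 28 30, .op .add 13 7 7, .op .add 13 13 11, .const 14 0,
    .op .add 16 28 14, pushProg, .op .add 13 13 10, .const 14 0, .op .add 16 28 14, pushProg]

theorem levelProg_ends (h : Env n μ s L b G i D σs st) (K : ℕ) (hK : K = D * (L / G) + (D + 2))
    (hr : 4 * s * b + 2 < 2 ^ w) (hi : 2 * i + 3 < 2 ^ w) (hw : 1 < 2 ^ w)
    (hlen : 5 * (σs.length + 2 * K) < 2 ^ w) (hLw : L < 2 ^ w) :
    Ends w levelProg st (28 * K + 21) (Env n μ s L b G i D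
      (σs ++ slots [⟨2 * i + 2, 0, 4 * s * b + 2, K⟩, ⟨2 * i + 3, 0, 4 * s * b + 2, K⟩])) := by
  have hdiv : L / G ≤ L := Nat.div_le_self _ _
  have hsb : s * b * 4 + 2 = 4 * s * b + 2 := by ring
  refine Ends.mono (T := (14 * K + 3) + (14 * K + 3 + 1 + 1 + 1 + 1) + 1 + 1 + 1 + 1 + 1 + 1 + 1 + 1 +
    1 + 1 + 1) ?_ (by omega) (fun _ h => h)
  refine Ends.op (s * b) (by simp [BinOp.apply, h.r3, h.r5]) (by omega) ?_
  refine Ends.op (s * b * 2) (by simp [BinOp.apply, h.r11]) (by omega) ?_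
  refine Ends.op (s * b * 4) (by simp [BinOp.apply, h.r11]; ring) (by omega) ?_
  refine Ends.op (4 * s * b + 2) (by simp [BinOp.apply, h.r11]; ring) hr ?_
  refine Ends.op (L / G) (by simp [BinOp.apply, h.r4, h.r6]) (by omega) ?_
  refine Ends.op (D * (L / G)) (by simp [BinOp.apply, h.r29]; ring) (by omega) ?_
  refine Ends.op K (by simp [BinOp.apply, h.r30, hK]) (by omega) ?_
  refine Ends.op (i + i) (by simp [BinOp.apply, h.r7]) (by omega) ?_
  refine Ends.op (2 * i + 2) (by simp [BinOp.apply, h.r11]; ring) (by omega) (Ends.const (by omega) ?_)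
  -- Register `14` has just been set to `0`, so that the addition copies a register.
  refine Ends.op K (by simp [BinOp.apply]) (by omega) ?_
  refine Env.push n μ s L b G i D σs ⟨2 * i + 2, 0, 4 * s * b + 2, K⟩ (T := 14 * K + 3) (T' := 14 * K + 3 + 1 + 1 + 1 + 1)
    (by simp) (by simp) (by simp) (by simp)
    (by omega) ?_ ?_ le_rfl ?_
  · repeat apply Env.setReg (hx := by decide)
    exact h
  · simp only; omega
  intro st1 k1 k2
  have z13 : st1.reg 13 = 2 * i + 2 := by rw [k2 13 (by decide)]; simp
  have z15 : st1.reg 15 = 4 * s * b + 2 := by rw [k2 15 (by decide)]; simp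
  have z28 : st1.reg 28 = K := by rw [k2 28 (by decide)]; simp
  refine Ends.op (2 * i + 3) (by simp [BinOp.apply, z13, k1.r10]) (by omega)
    (Ends.const (by omega) ?_)
  refine Ends.op K (by simp [BinOp.apply, z28]) (by omega) ?_
  refine Env.push n μ s L b G i D (σs ++ Block.slots ⟨2 * i + 2, 0, 4 * s * b + 2, K⟩)
    ⟨2 * i + 3, 0, 4 * s * b + 2, K⟩ (T := 14 * K + 3) (T' := 1)
    (by simp) (by simp) (by simp [z15]) (by simp)
    (by omega) ?_ ?_ le_rfl ?_
  · repeat apply Env.setReg (hx := by decide)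
    exact k1
  · simp only [List.length_append, Block.slots, List.length_map, List.length_range]; omega
  intro st2 l1 _
  refine Ends.nil (Env.setReg ?_ _ (by decide))
  simpa [slots] using l1

/-- Write the last four blocks. -/
def tailProg : Program :=
  block [.op .add 13 7 7, .const 20 4, .op .add 13 13 20, .const 14 0, .op .add 15 11 14,
    .op .add 16 10 14, pushProg,
    .op .add 13 13 10, .const 14 0, .op .add 16 10 14, pushProg,
    .op .mul 19 3 5, .op .mul 19 19 11, .op .mul 19 19 11, .op .mul 19 19 11, .const 20 8,
    .op .add 19 19 20, .op .add 15 19 19, .op .add 15 15 10,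
    .op .sub 14 0 2, .op .sub 14 14 19, .const 13 0, .const 16 1, pushProg,
    .op .sub 14 2 19, .const 13 1, .const 16 1, pushProg]

/-- The windows for the numbers of zeros and ones are centred at `n - μ` and `μ`. Truncated
subtraction is intended: it cuts them off at `0`. -/
theorem tailProg_ends (h : Env n μ s L b G i D σs st) (P : ℕ) (hP : P = 8 * s * b + 8)
    (hr : 2 * P + 1 < 2 ^ w) (hi : 2 * i + 5 < 2 ^ w) (hn : n < 2 ^ w) (hμ : μ < 2 ^ w)
    (hlen : 5 * (σs.length + 4) < 2 ^ w) :
    Ends w tailProg st 93 (Env n μ s L b G i D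
      (σs ++ slots [⟨2 * i + 4, 0, 2, 1⟩, ⟨2 * i + 5, 0, 2, 1⟩, ⟨0, n - μ - P, 2 * P + 1, 1⟩,
        ⟨1, μ - P, 2 * P + 1, 1⟩])) := by
  have hw : 17 < 2 ^ w := by omega
  have hsb : s * b * 8 + 8 = P := by rw [hP]; ring
  -- Writing a block with one position takes `14 * 1 + 3` steps; the number is kept opaque.
  obtain ⟨k, hk⟩ : ∃ k, k = 17 := ⟨_, rfl⟩
  refine Ends.mono (T := (k) + ((k) + ((k) + ((k) + 1 + 1 + 1 + 1) +
    1 + 1 + 1 + 1 + 1 + 1 + 1 + 1 + 1 + 1 + 1 + 1) + 1 + 1 + 1) + 1 + 1 + 1 + 1 + 1 + 1) ?_ (by omega)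
    (fun _ h => h)
  refine Ends.op (i + i) (by simp [BinOp.apply, h.r7]) (by omega) (Ends.const (by omega) ?_)
  refine Ends.op (2 * i + 4) (by simp [BinOp.apply]; ring) (by omega) (Ends.const (by omega) ?_)
  refine Ends.op 2 (by simp [BinOp.apply, h.r11]) (by omega) ?_
  refine Ends.op 1 (by simp [BinOp.apply, h.r10]) (by omega) ?_
  refine Env.push n μ s L b G i D σs ⟨2 * i + 4, 0, 2, 1⟩ (T := k)
    (by simp) (by simp) (by simp) (by simp)
    (by omega) ?_ ?_ hk.ge ?_
  · repeat apply Env.setReg (hx := by decide)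
    exact h
  · simp only; omega
  intro st1 k1 k2
  have z13 : st1.reg 13 = 2 * i + 4 := by rw [k2 13 (by decide)]; simp
  have z15 : st1.reg 15 = 2 := by rw [k2 15 (by decide)]; simp
  refine Ends.op (2 * i + 5) (by simp [BinOp.apply, z13, k1.r10]) (by omega)
    (Ends.const (by omega) ?_)
  refine Ends.op 1 (by simp [BinOp.apply, k1.r10]) (by omega) ?_
  refine Env.push n μ s L b G i D (σs ++ Block.slots ⟨2 * i + 4, 0, 2, 1⟩)
    ⟨2 * i + 5, 0, 2, 1⟩ (T := k)
    (by simp) (by simp) (by simp [z15]) (by simp)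
    (by omega) ?_ ?_ hk.ge ?_
  · repeat apply Env.setReg (hx := by decide)
    exact k1
  · simp only [List.length_append, Block.slots, List.length_map, List.length_range]; omega
  intro st2 l1 _
  refine Ends.op (s * b) (by simp [BinOp.apply, l1.r3, l1.r5]) (by omega) ?_
  refine Ends.op (s * b * 2) (by simp [BinOp.apply, l1.r11]) (by omega) ?_
  refine Ends.op (s * b * 4) (by simp [BinOp.apply, l1.r11]; ring) (by omega) ?_
  refine Ends.op (s * b * 8) (by simp [BinOp.apply, l1.r11]; ring) (by omega)
    (Ends.const (by omega) ?_)
  refine Ends.op P (by simp [BinOp.apply, hsb]) (by omega) ?_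
  refine Ends.op (P + P) (by simp [BinOp.apply]) (by omega) ?_
  refine Ends.op (2 * P + 1) (by simp [BinOp.apply, l1.r10]; ring) (by omega) ?_
  refine Ends.op (n - μ) (by simp [BinOp.apply, l1.r0, l1.r2]) (by omega) ?_
  refine Ends.op (n - μ - P) (by simp [BinOp.apply]) (by omega)
    (Ends.const (by omega) (Ends.const (by omega) ?_))
  refine Env.push n μ s L b G i D (σs ++ Block.slots ⟨2 * i + 4, 0, 2, 1⟩ ++ Block.slots ⟨2 * i + 5, 0, 2, 1⟩)
    ⟨0, n - μ - P, 2 * P + 1, 1⟩ (T := k)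
    (by simp) (by simp) (by simp) (by simp)
    (by omega) ?_ ?_ hk.ge ?_
  · repeat apply Env.setReg (hx := by decide)
    exact l1
  · simp only [List.length_append, Block.slots, List.length_map, List.length_range]; omega
  intro st3 m1 m2
  have z15 : st3.reg 15 = 2 * P + 1 := by rw [m2 15 (by decide)]; simp
  have z19 : st3.reg 19 = P := by rw [m2 19 (by decide)]; simp
  refine Ends.op (μ - P) (by simp [BinOp.apply, m1.r2, z19]) (by omega)
    (Ends.const (by omega) (Ends.const (by omega) ?_))
  refine Env.push n μ s L b G i D (σs ++ Block.slots ⟨2 * i + 4, 0, 2, 1⟩ ++ Block.slots ⟨2 * i + 5, 0, 2, 1⟩ ++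
    Block.slots ⟨0, n - μ - P, 2 * P + 1, 1⟩)
    ⟨1, μ - P, 2 * P + 1, 1⟩ (T := k) (T' := 1)
    (by simp) (by simp) (by simp [z15]) (by simp)
    (by omega) ?_ ?_ hk.ge ?_
  · repeat apply Env.setReg (hx := by decide)
    exact m1
  · simp only [List.length_append, Block.slots, List.length_map, List.length_range]; omega
  intro st4 o1 _
  refine Ends.nil (Env.setReg ?_ _ (by decide))
  simpa [slots] using o1

end PoissonBinomial

namespace PoissonBinomial

/-! ### The whole program -/

/-- The program, for accuracy parameter `D`. The input is `n`, `⌈1 / ε⌉`, and the estimates of the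
mean and of the variance. -/
def mainProg (D : ℕ) : Program :=
  block [.const 10 1, .const 11 2, .const 29 D, .const 30 (D + 2), logProg 1 4, .op .div 5 3 4,
    .const 20 4, .op .add 5 5 20, logProg 5 6, .op .mul 12 29 4, .op .lt 21 6 12,
    .loop 21 (block [levelProg, .op .mul 5 5 5, .op .add 6 6 6, .op .add 7 7 10, .op .lt 21 6 12]),
    levelProg, tailProg, .emit 7, .const 14 0, .op .add 9 8 14, enumProg]

theorem radix_add_base_le {bs : List Block} {c : Block} (hc : c ∈ bs) (h : 0 < c.count) :
    c.radix + c.base ≤ ((slots bs).map fun σ => σ.radix + σ.base).sum := by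
  refine List.single_le_sum (by simp) _ (List.mem_map.2 ⟨c.slot 0, ?_, by simp [Block.slot]⟩)
  exact List.mem_flatMap.2 ⟨c, hc, List.mem_map.2 ⟨0, List.mem_range.2 h, rfl⟩⟩

theorem log_mul_lt {b : ℕ} (hb : b ≠ 0) (m : ℕ) : Nat.log 2 b * m < b ^ m :=
  calc Nat.log 2 b * m < 2 ^ (Nat.log 2 b * m) := Nat.lt_two_pow_self
    _ = (2 ^ Nat.log 2 b) ^ m := pow_mul _ _ _
    _ ≤ b ^ m := Nat.pow_le_pow_left (Nat.pow_log_le_self 2 hb) m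

/-- The base of the radices of the levels. -/
def levelBase (N s : ℕ) : ℕ := 4 + s / Nat.log 2 N

/-- The radix of the blocks of a level. -/
def levelRadix (N s i : ℕ) : ℕ := 4 * s * levelBase N s ^ 2 ^ i + 2

/-- A lower bound for the binary logarithm of `levelBase N s ^ 2 ^ i`. -/
def levelLog (N s i : ℕ) : ℕ := Nat.log 2 (levelBase N s) * 2 ^ i

/-- The number of positions in the blocks of a level. -/
def levelCount (D N s i : ℕ) : ℕ := D * (Nat.log 2 N / levelLog N s i) + (D + 2)

/-- A bound for the distance of the numbers of ones and zeros from their estimates. -/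
def spread (N s ℓ : ℕ) : ℕ := 8 * s * levelBase N s ^ 2 ^ ℓ + 8

/-- All blocks, with `ℓ + 1` levels. -/
def allBlocks (D n N μ s ℓ : ℕ) : List Block :=
  blocks ℓ (levelRadix N s) (levelCount D N s) (n - μ - spread N s ℓ) (μ - spread N s ℓ)
    (2 * spread N s ℓ + 1)

theorem levelLog_lt (N s i : ℕ) : levelLog N s i < levelBase N s ^ 2 ^ i :=
  log_mul_lt (by simp [levelBase]) _

theorem levelBase_pow_le {N s : ℕ} (hs : 1 ≤ s) (i : ℕ) :
    levelBase N s ^ 2 ^ i + 2 ≤ levelRadix N s i := by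
  rw [levelRadix]
  nlinarith [Nat.zero_le (levelBase N s ^ 2 ^ i)]

/-- Apart from the input, the intermediate values are controlled by radices, bases and numbers of
positions, so the hypotheses on the word size exclude every overflow. -/
theorem mainProg_ends {w n N μ s D ℓ : ℕ} (hs : 1 ≤ s) (hN : N ≠ 0)
    (hlt : ∀ i < ℓ, levelLog N s i < D * Nat.log 2 N) (hle : D * Nat.log 2 N ≤ levelLog N s ℓ)
    (hnw : n < 2 ^ w) (hNw : N < 2 ^ w) (hμw : μ < 2 ^ w) (hDw : D * Nat.log 2 N < 2 ^ w)
    (hlen : 5 * (slots (allBlocks D n N μ s ℓ)).length + 10 < 2 ^ w)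
    (hsum : ((slots (allBlocks D n N μ s ℓ)).map fun σ => σ.radix + σ.base).sum < 2 ^ w) :
    Ends w (mainProg D) (State.init [n, N, μ, s])
      (5 * Nat.log 2 N + 5 * levelLog N s ℓ +
        (ℓ + 1) * (28 * (slots (allBlocks D n N μ s ℓ)).length + 27) +
        numConfigs (allBlocks D n N μ s ℓ) * (60 * (slots (allBlocks D n N μ s ℓ)).length + 22) +
        130) fun st =>
      st.out = ℓ :: (List.range (numConfigs (allBlocks D n N μ s ℓ))).flatMap fun x =>
        (config (allBlocks D n N μ s ℓ) x).length ::
          (config (allBlocks D n N μ s ℓ) x).flatMap fun y => [y.1, y.2] := by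
  set bs := allBlocks D n N μ s ℓ with hbs
  set m := (slots bs).length with hm
  set M := numConfigs bs with hM
  set L := Nat.log 2 N with hL
  set r := levelRadix N s with hr
  set K := levelCount D N s with hK
  set P := spread N s ℓ with hP
  set b := levelBase N s with hb
  have hbs' : bs = levelBlocks r K (ℓ + 1) ++ [⟨2 * ℓ + 4, 0, 2, 1⟩, ⟨2 * ℓ + 5, 0, 2, 1⟩,
    ⟨0, n - μ - P, 2 * P + 1, 1⟩, ⟨1, μ - P, 2 * P + 1, 1⟩] := blocks_eq _ _ _ _ _ _
  have hKpos : ∀ i, D + 2 ≤ K i := fun i => Nat.le_add_left _ _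
  -- positions
  have hm' : m = (∑ i ∈ Finset.range (ℓ + 1), 2 * K i) + 4 := length_slots_blocks _ _ _ _ _ _
  have hpre : ∀ i ≤ ℓ, (slots (levelBlocks r K i)).length + 2 * K i + 4 ≤ m := by
    intro i hi
    rw [length_slots_levelBlocks, hm', ← Finset.sum_range_succ]
    exact Nat.add_le_add_right
      (Finset.sum_le_sum_of_subset (Finset.range_mono (by omega))) 4
  have hℓm : ℓ + 1 ≤ m := by
    rw [hm']
    calc ℓ + 1 = ∑ _i ∈ Finset.range (ℓ + 1), 1 := by simp
      _ ≤ ∑ i ∈ Finset.range (ℓ + 1), 2 * K i :=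
        Finset.sum_le_sum fun i _ => by have := hKpos i; omega
      _ ≤ _ := Nat.le_add_right _ _
  have hKm : ∀ i ≤ ℓ, K i ≤ m := fun i hi => by have := hpre i hi; omega
  -- bounds for the contents of registers
  have hrw : ∀ i ≤ ℓ, r i < 2 ^ w := by
    intro i hi
    have hmem : (⟨2 * i + 2, 0, r i, K i⟩ : Block) ∈ bs := by
      rw [hbs']
      refine List.mem_append_left _ (List.mem_flatMap.2 ⟨i, List.mem_range.2 (by omega), by simp⟩)
    have := radix_add_base_le hmem (by have := hKpos i; simp only; omega)
    simp only at this
    omega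
  have hbw : ∀ i ≤ ℓ, b ^ 2 ^ i + 2 < 2 ^ w := fun i hi =>
    lt_of_le_of_lt (levelBase_pow_le hs i) (hrw i hi)
  have hGw : ∀ i ≤ ℓ, levelLog N s i < 2 ^ w := fun i hi => by
    have : levelLog N s i < b ^ 2 ^ i := levelLog_lt N s i
    have := hbw i hi
    omega
  have hPw : 2 * P + 1 < 2 ^ w := by
    have hmem : (⟨0, n - μ - P, 2 * P + 1, 1⟩ : Block) ∈ bs := by rw [hbs']; simp
    have := radix_add_base_le hmem (by simp)
    simp only at this
    omega
  have hb0 : b ^ 2 ^ 0 = b := by rw [pow_zero, pow_one]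
  have hbw0 : b + 2 < 2 ^ w := by have := hbw 0 (by omega); rwa [hb0] at this
  have hg0 : levelLog N s 0 = Nat.log 2 b := by rw [levelLog, pow_zero, mul_one]
  have hLN : L < 2 ^ w := (Nat.log_lt_self 2 hN).trans hNw
  have hDw' : D + 2 < 2 ^ w := by have := hKpos 0; have := hKm 0 (by omega); omega
  have hone : ∀ a b : ℕ, (if a < b then 1 else 0) < 2 ^ w := fun a b => by split_ifs <;> omega
  have hgle : Nat.log 2 b ≤ levelLog N s ℓ := Nat.le_mul_of_pos_right _ (by positivity)
  have hr_pos : ∀ c ∈ bs, 0 < c.radix := by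
    intro c hc
    rw [hbs', List.mem_append] at hc
    rcases hc with hc | hc
    · obtain ⟨i, -, hc⟩ := List.mem_flatMap.1 hc
      simp only [List.mem_cons, List.not_mem_nil, or_false] at hc
      rcases hc with rfl | rfl <;> simp [hr, levelRadix]
    · simp only [List.mem_cons, List.not_mem_nil, or_false] at hc
      rcases hc with rfl | rfl | rfl | rfl <;> simp
  obtain ⟨t93, ht93⟩ : ∃ t, t = 93 := ⟨_, rfl⟩
  refine Ends.mono (T := (5 * L + 5) + ((5 * Nat.log 2 b + 5) +
    (((ℓ * ((28 * m + 21) + (1 + 1 + 1 + 1 + 1) + 1) + 1) + ((28 * m + 21) + (t93 +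
      ((M * (60 * m + 22) + 3) + 1 + 1 + 1 + 1)))) + 1 + 1) + 1 + 1 + 1) + 1 + 1 + 1 + 1)
    ?_ (by rw [ht93]; ring_nf; omega) (fun _ h => h)
  refine Ends.const (by omega) (Ends.const (by omega) (Ends.const (by omega)
    (Ends.const (by omega) ?_)))
  set st0 := ((((State.init [n, N, μ, s]).setReg 10 1).setReg 11 2).setReg 29 D).setReg 30 (D + 2)
    with hst0
  have z1 : st0.reg 1 = N := by simp [hst0, State.init]
  refine Ends.cons (T := 5 * L + 5) ((logProg_ends (x := 1) (y := 4) (by decide) (by decide)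
    (by omega) (by simp [hst0]) (by simp [hst0]) (by rwa [z1]) (by rwa [z1])).mono
    (by rw [z1]) fun _ h => h) ?_
  rintro st1 ⟨a1, a2, a3, a4⟩
  rw [z1, ← hL] at a1
  refine Ends.op (s / L) (by simp [BinOp.apply, a1, a4 3 (by decide), hst0, State.init])
    (by have : b = 4 + s / L := rfl
        omega) (Ends.const (by omega) ?_)
  refine Ends.op b (by simp [BinOp.apply, hb, levelBase, hL, add_comm]) (by omega) ?_
  set st2 := ((st1.setReg 5 (s / L)).setReg 20 4).setReg 5 b with hst2
  have z5 : st2.reg 5 = b := by simp [hst2]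
  have z10 : st2.reg 10 = 1 := by simp [hst2, a4 10 (by decide), hst0]
  have z11 : st2.reg 11 = 2 := by simp [hst2, a4 11 (by decide), hst0]
  refine Ends.cons (T := 5 * Nat.log 2 b + 5) ((logProg_ends (x := 5) (y := 6) (by decide)
    (by decide) (by omega) z10 z11 (by rw [z5]; simp [hb, levelBase]) (by rw [z5]; omega)).mono
    (by rw [z5]) fun _ h => h) ?_
  rintro st3 ⟨b1, b2, b3, b4⟩
  rw [z5] at b1
  refine Ends.op (D * L)
    (by simp [BinOp.apply, b4 29 (by decide), b4 4 (by decide), hst2, a4 29 (by decide), a1, hst0])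
    hDw ?_
  refine Ends.op (if levelLog N s 0 < D * L then 1 else 0) (by simp [BinOp.apply, b1, hg0])
    (hone _ _) ?_
  refine Ends.cons (T := ℓ * ((28 * m + 21) + (1 + 1 + 1 + 1 + 1) + 1) + 1)
    (Ends.loop ℓ (fun i st => Env n μ s L (b ^ 2 ^ i) (levelLog N s i) i D
      (slots (levelBlocks r K i)) st ∧
      st.reg 21 = if levelLog N s i < D * L then 1 else 0) ?_ ?_ ?_) ?_
  · refine ⟨Env.setReg ?_ _ (by decide), by simp⟩
    refine ⟨?_, ?_, ?_, ?_, ?_, ?_, ?_, ?_, ?_, ?_, ?_, ?_, ?_, ?_, ?_⟩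
    · simp [b4 0 (by decide), hst2, a4 0 (by decide), hst0, State.init]
    · simp [b4 2 (by decide), hst2, a4 2 (by decide), hst0, State.init]
    · simp [b4 3 (by decide), hst2, a4 3 (by decide), hst0, State.init]
    · simp [b4 4 (by decide), hst2, a1]
    · simp [b4 5 (by decide), hst2]
    · simp [b1, hg0]
    · simp [b4 7 (by decide), hst2, a4 7 (by decide), hst0, State.init]
    · simp [b4 8 (by decide), hst2, a4 8 (by decide), hst0, State.init, levelBlocks, slots]
    · simp [b4 10 (by decide), z10]
    · simp [b4 11 (by decide), z11]
    · simp
    · simp [b4 29 (by decide), hst2, a4 29 (by decide), hst0]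
    · simp [b4 30 (by decide), hst2, a4 30 (by decide), hst0]
    · simp [b2, hst2, a2, hst0, State.init, levelBlocks, slots, zeros, cells, memOf_nil]
    · simp [b3, hst2, a3, hst0, State.init]
  · rintro i hi st ⟨e1, e2⟩
    refine ⟨by rw [e2, if_pos (hlt i hi)]; simp, ?_⟩
    have hp := hpre i hi.le
    refine Ends.cons (T := 28 * m + 21) (T' := 1 + 1 + 1 + 1 + 1) ((levelProg_ends e1 (K i) rfl
      (by have := hrw i hi.le; exact this) (by omega) (by omega) (by omega) hLN).mono
      (by have := hKm i hi.le; omega) fun _ h => h) ?_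
    intro st' e3
    -- Squaring the base and doubling its logarithm lead to the next level, just as `B (i + 1) = B i
    -- ^ 2`.
    have hsq : b ^ 2 ^ i * b ^ 2 ^ i = b ^ 2 ^ (i + 1) := by rw [← pow_add]; ring_nf
    have hdb : levelLog N s i + levelLog N s i = levelLog N s (i + 1) := by
      simp only [levelLog]; ring
    refine Ends.op (b ^ 2 ^ (i + 1)) (by simp [BinOp.apply, e3.r5, hsq])
      (by have := hbw (i + 1) hi; omega) ?_
    refine Ends.op (levelLog N s (i + 1)) (by simp [BinOp.apply, e3.r6, hdb]) (hGw _ hi) ?_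
    refine Ends.op (i + 1) (by simp [BinOp.apply, e3.r7, e3.r10]) (by omega) ?_
    refine Ends.op (if levelLog N s (i + 1) < D * L then 1 else 0)
      (by simp [BinOp.apply, e3.r12]) (hone _ _) (Ends.nil ⟨Env.setReg (Env.setReg ?_ _ (by decide))
      _ (by decide), by simp⟩)
    rw [levelBlocks_succ, slots_append]
    exact ⟨by simp [e3.r0], by simp [e3.r2], by simp [e3.r3], by simp [e3.r4], by simp, by simp,
      by simp, e3.r8, by simp [e3.r10], by simp [e3.r11], by simp [e3.r12],
      by simp [e3.r29], by simp [e3.r30], e3.mem, e3.out⟩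
  · rintro st ⟨-, e2⟩
    rw [e2, if_neg (by omega)]
  rintro st4 ⟨e1, -⟩
  have hp := hpre ℓ le_rfl
  -- The loop has stopped before writing level `ℓ`, whose blocks are still missing.
  refine Ends.cons (T := 28 * m + 21) ((levelProg_ends e1 (K ℓ) rfl
    (by have := hrw ℓ le_rfl; exact this) (by omega) (by omega) (by omega) hLN).mono
    (by have := hKm ℓ le_rfl; omega) fun _ h => h) ?_
  intro st5 e2
  rw [← slots_append] at e2
  replace e2 : Env n μ s L (b ^ 2 ^ ℓ) (levelLog N s ℓ) ℓ D (slots (levelBlocks r K (ℓ + 1))) st5 := by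
    rw [levelBlocks_succ]
    exact e2
  have hl : (slots (levelBlocks r K (ℓ + 1))).length + 4 = m := by
    rw [length_slots_levelBlocks, hm']
  refine Ends.cons (T := t93) ((tailProg_ends e2 P rfl hPw (by omega) hnw hμw (by omega)).mono
    ht93.ge fun _ h => h) ?_
  intro st6 e3
  rw [← slots_append, ← hbs'] at e3
  refine Ends.emit ℓ e3.r7 (Ends.const (by omega) ?_)
  refine Ends.op (5 * m) (by simp [BinOp.apply, e3.r8, hm]) (by omega) ?_
  refine Ends.cons (T' := 1) (enumProg_ends bs hr_pos _ ?_ ?_ ?_ ?_ hsum (by omega)) ?_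
  · simp only [State.mem_setReg, State.mem_emit, e3.mem]
    rw [entries_zero, zeros]
  · simp [hm]
  · simp; omega
  · simp [e3.r10]
  · intro st7 e4
    refine Ends.nil ?_
    simp only [State.out_setReg, e4, State.out_emit, e3.out]
    rfl

end PoissonBinomial

namespace PoissonBinomial

/-! ### Sizes -/

theorem two_le_log {N : ℕ} (hN : 4 ≤ N) : 2 ≤ Nat.log 2 N :=
  Nat.le_log_of_pow_le (by norm_num) (by omega)

theorem two_le_log_levelBase (N s : ℕ) : 2 ≤ Nat.log 2 (levelBase N s) :=
  two_le_log (Nat.le_add_right _ _)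

theorem levelBase_le {N s A : ℕ} (hN : 4 ≤ N) (hs : s ≤ N ^ (A + 1)) :
    levelBase N s ≤ N ^ (A + 2) := by
  have h1 : s / Nat.log 2 N ≤ s := Nat.div_le_self _ _
  have h2 : N ^ 1 ≤ N ^ (A + 1) := Nat.pow_le_pow_right (by omega) (by omega)
  have h3 : N ^ (A + 2) = N ^ (A + 1) * N := pow_succ _ _
  rw [levelBase]
  nlinarith

theorem two_pow_levelLog_le (N s i : ℕ) : 2 ^ levelLog N s i ≤ levelBase N s ^ 2 ^ i := by
  rw [levelLog, pow_mul]
  exact Nat.pow_le_pow_left (Nat.pow_log_le_self 2 (by simp [levelBase])) _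

theorem levelBase_pow_le_two_pow (N s i : ℕ) :
    levelBase N s ^ 2 ^ i ≤ 2 ^ (2 * levelLog N s i) := by
  have h := two_le_log_levelBase N s
  rw [levelLog, ← mul_assoc, pow_mul]
  refine Nat.pow_le_pow_left ?_ _
  exact (Nat.lt_pow_succ_log_self (by norm_num) _).le.trans
    (Nat.pow_le_pow_right (by norm_num) (by omega))

theorem levelLog_mono (N s : ℕ) : Monotone (levelLog N s) := fun _ _ h =>
  Nat.mul_le_mul_left _ (Nat.pow_le_pow_right (by norm_num) h)

theorem two_mul_two_pow_le_levelLog (N s i : ℕ) : 2 * 2 ^ i ≤ levelLog N s i :=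
  Nat.mul_le_mul_right _ (two_le_log_levelBase N s)

theorem exists_le_levelLog (D N s : ℕ) : ∃ i, D * Nat.log 2 N ≤ levelLog N s i := by
  refine ⟨D * Nat.log 2 N, ?_⟩
  have h1 := two_mul_two_pow_le_levelLog N s (D * Nat.log 2 N)
  have h2 := Nat.lt_two_pow_self (n := D * Nat.log 2 N)
  omega

/-- The number of levels, minus one. -/
def depth (D N s : ℕ) : ℕ := Nat.find (exists_le_levelLog D N s)

theorem le_levelLog_depth (D N s : ℕ) : D * Nat.log 2 N ≤ levelLog N s (depth D N s) :=
  Nat.find_spec (exists_le_levelLog D N s)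

theorem levelLog_lt_of_lt_depth {D N s i : ℕ} (hi : i < depth D N s) :
    levelLog N s i < D * Nat.log 2 N := not_le.1 (Nat.find_min (exists_le_levelLog D N s) hi)

/-- A positive depth overshoots `D * log₂ N` by at most one doubling, by minimality. At depth `0`
the size of `s` bounds the base itself. -/
theorem levelLog_depth_le {D N s A : ℕ} (hN : 4 ≤ N) (hs : s ≤ N ^ (A + 1)) :
    levelLog N s (depth D N s) ≤ (2 * (A + 2) + 2 * D) * Nat.log 2 N := by
  rcases h : depth D N s with _ | i
  · have h1 : levelBase N s < 2 ^ ((Nat.log 2 N + 1) * (A + 2)) := by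
      rw [pow_mul]
      exact (levelBase_le hN hs).trans_lt
        (Nat.pow_lt_pow_left (Nat.lt_pow_succ_log_self (by norm_num) N) (by omega))
    have h2 := Nat.log_lt_of_lt_pow (by simp [levelBase]) h1
    rw [levelLog, pow_zero, mul_one]
    nlinarith [two_le_log hN]
  · have h1 := levelLog_lt_of_lt_depth (h ▸ Nat.lt_succ_self i : i < depth D N s)
    have h2 : levelLog N s (i + 1) = 2 * levelLog N s i := by simp only [levelLog]; ring
    rw [h2]
    nlinarith

/-- `levelLog` grows at least like `2 ^ i`, so the threshold `D * log₂ N` is passed after about `log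
log N` levels. -/
theorem depth_le {D N s : ℕ} : depth D N s ≤ D + Nat.log 2 (Nat.log 2 N) + 1 := by
  rcases h : depth D N s with _ | i
  · omega
  · have h1 := levelLog_lt_of_lt_depth (h ▸ Nat.lt_succ_self i : i < depth D N s)
    have h2 := two_mul_two_pow_le_levelLog N s i
    have h3 : 2 ^ i < 2 ^ (D + (Nat.log 2 (Nat.log 2 N) + 1)) := by
      rw [pow_add]
      calc 2 ^ i ≤ 2 * 2 ^ i := by omega
        _ < D * Nat.log 2 N := by omega
        _ ≤ 2 ^ D * 2 ^ (Nat.log 2 (Nat.log 2 N) + 1) := Nat.mul_le_mul Nat.lt_two_pow_self.le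
          (Nat.lt_pow_succ_log_self (by norm_num) _).le
    have := (Nat.pow_lt_pow_iff_right (by norm_num)).1 h3
    omega

/-- A bound for `levelLog N s (depth D N s) / Nat.log 2 N`. -/
def logFactor (A D : ℕ) : ℕ := 2 * (A + 2) + 2 * D

/-- A bound for `levelCount D N s i * levelLog N s i / Nat.log 2 N`. -/
def countFactor (A D : ℕ) : ℕ := D + (D + 2) * logFactor A D

/-- The quotient part contributes at most `D * log₂ N`. The additive `D + 2` is harmless because up
to the depth `levelLog` is itself `O(log N)`. -/
theorem levelCount_mul_le {D N s A i : ℕ} (hN : 4 ≤ N) (hs : s ≤ N ^ (A + 1))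
    (hi : i ≤ depth D N s) :
    levelCount D N s i * levelLog N s i ≤ countFactor A D * Nat.log 2 N := by
  have h1 := (levelLog_mono N s hi).trans (levelLog_depth_le hN hs)
  have h2 := Nat.div_mul_le_self (Nat.log 2 N) (levelLog N s i)
  rw [levelCount, countFactor, add_mul (D * _), mul_assoc, add_mul D (_ * _), mul_assoc (D + 2)]
  exact Nat.add_le_add (Nat.mul_le_mul_left _ h2) (Nat.mul_le_mul_left _ h1)

/-- Two positions are set aside for the end points of the interval. The remaining `D * (⌊log₂ N /
levelLog⌋ + 1)` also make up for rounding down. -/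
theorem le_levelCount_mul {D N s i : ℕ} :
    D * Nat.log 2 N ≤ (levelCount D N s i - 2) * levelLog N s i := by
  have hpos : 0 < levelLog N s i := lt_of_lt_of_le (by positivity) (two_mul_two_pow_le_levelLog N s i)
  have h := Nat.lt_mul_div_succ (Nat.log 2 N) hpos
  have e : levelCount D N s i - 2 = D * (Nat.log 2 N / levelLog N s i + 1) := by
    rw [levelCount, mul_add, mul_one]; omega
  rw [e, mul_assoc]
  refine Nat.mul_le_mul_left _ ?_
  rw [mul_comm]
  exact h.le

/-- A geometric series, since `levelLog` at level `i` is at least `2 ^ i`. -/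
theorem sum_levelCount_le {D N s A : ℕ} (hN : 4 ≤ N) (hs : s ≤ N ^ (A + 1)) :
    ∑ i ∈ Finset.range (depth D N s + 1), levelCount D N s i ≤
      2 * (countFactor A D * Nat.log 2 N) := by
  refine le_trans (Finset.sum_le_sum fun i hi => ?_)
    ((Nat.geom_sum_le (b := 2) le_rfl (countFactor A D * Nat.log 2 N) (depth D N s + 1)).trans ?_)
  · rw [Nat.le_div_iff_mul_le (by positivity)]
    refine le_trans (Nat.mul_le_mul_left _ ?_)
      (levelCount_mul_le hN hs (Nat.lt_succ_iff.1 (Finset.mem_range.1 hi)))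
    have := two_mul_two_pow_le_levelLog N s i
    omega
  · rw [Nat.add_one_sub_one, Nat.div_one, mul_comm]

theorem length_slots_allBlocks_le {D n N μ s A : ℕ} (hN : 4 ≤ N) (hs : s ≤ N ^ (A + 1)) :
    (slots (allBlocks D n N μ s (depth D N s))).length ≤
      (4 * countFactor A D + 2) * Nat.log 2 N := by
  rw [allBlocks, length_slots_blocks, ← Finset.mul_sum]
  have h1 := sum_levelCount_le (D := D) hN hs
  have h2 := two_le_log hN
  have e : (4 * countFactor A D + 2) * Nat.log 2 N =
    2 * (2 * (countFactor A D * Nat.log 2 N)) + 2 * Nat.log 2 N := by ring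
  omega

theorem estimate_le (N s : ℕ) (hN : 4 ≤ N) : s ≤ Nat.log 2 N * levelBase N s := by
  have h := Nat.lt_mul_div_succ s (lt_of_lt_of_le (by norm_num) (two_le_log hN) : 0 < Nat.log 2 N)
  rw [levelBase]
  nlinarith

/-- The double logarithm in the exponents. -/
def logLog (N : ℕ) : ℕ := Nat.log 2 (Nat.log 2 N) + 1

/-- By `estimate_le`, `s` exceeds the base by at most a factor `log₂ N`. A digit at level `i`
therefore costs `log log N` bits besides a multiple of `levelLog`. -/
theorem eight_mul_le {N s i : ℕ} (hN : 4 ≤ N) :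
    8 * s * levelBase N s ^ 2 ^ i ≤ 2 ^ (logLog N + 7 * levelLog N s i) := by
  have h0 : Nat.log 2 (levelBase N s) ≤ levelLog N s i := Nat.le_mul_of_pos_right _ (by positivity)
  have h1 : Nat.log 2 N ≤ 2 ^ logLog N := (Nat.lt_pow_succ_log_self (by norm_num) _).le
  have h2 : levelBase N s ≤ 2 ^ (2 * levelLog N s i) := by
    have := two_le_log_levelBase N s
    exact (Nat.lt_pow_succ_log_self (by norm_num) _).le.trans
      (Nat.pow_le_pow_right (by norm_num) (by omega))
  have h3 := levelBase_pow_le_two_pow N s i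
  have h4 : (8 : ℕ) ≤ 2 ^ (3 * levelLog N s i) := by
    have := two_le_log_levelBase N s
    calc (8 : ℕ) = 2 ^ 3 := by norm_num
      _ ≤ _ := Nat.pow_le_pow_right (by norm_num) (by omega)
  calc 8 * s * levelBase N s ^ 2 ^ i
      ≤ 2 ^ (3 * levelLog N s i) * (2 ^ logLog N * 2 ^ (2 * levelLog N s i)) *
        2 ^ (2 * levelLog N s i) := by
        gcongr
        exact (estimate_le N s hN).trans (Nat.mul_le_mul h1 h2)
    _ = 2 ^ (logLog N + 7 * levelLog N s i) := by
        rw [← pow_add, ← pow_add, ← pow_add]; ring_nf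

theorem one_le_mul_levelBase_pow {N s : ℕ} (hs : 1 ≤ s) (i : ℕ) : 4 ≤ s * levelBase N s ^ 2 ^ i := by
  have h : 4 ^ 1 ≤ levelBase N s ^ 2 ^ i :=
    (Nat.pow_le_pow_left (Nat.le_add_right _ _) 1).trans
      (Nat.pow_le_pow_right (by simp) Nat.one_le_two_pow)
  nlinarith

theorem levelRadix_le {N s i : ℕ} (hN : 4 ≤ N) (hs : 1 ≤ s) :
    levelRadix N s i ≤ 2 ^ (logLog N + 7 * levelLog N s i) := by
  refine le_trans ?_ (eight_mul_le hN)
  rw [levelRadix]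
  nlinarith [one_le_mul_levelBase_pow (N := N) hs i]

theorem two_mul_spread_le {N s ℓ : ℕ} (hN : 4 ≤ N) (hs : 1 ≤ s) :
    2 * spread N s ℓ + 1 ≤ 2 ^ (logLog N + 7 * levelLog N s ℓ + 2) := by
  have h := eight_mul_le (s := s) (i := ℓ) hN
  rw [pow_add]
  rw [spread]
  nlinarith [one_le_mul_levelBase_pow (N := N) hs ℓ]

theorem numConfigs_append (bs bs' : List Block) :
    numConfigs (bs ++ bs') = numConfigs bs * numConfigs bs' := by
  rw [numConfigs, slots_append, List.map_append, List.prod_append]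
  rfl

theorem numConfigs_levelBlocks_le {r K e : ℕ → ℕ} {m : ℕ} (h : ∀ i < m, r i ≤ 2 ^ e i) :
    numConfigs (levelBlocks r K m) ≤ 2 ^ ∑ i ∈ Finset.range m, 2 * (K i * e i) := by
  induction m with
  | zero => simp [levelBlocks, numConfigs, slots]
  | succ m ih =>
    rw [levelBlocks_succ, numConfigs_append, Finset.sum_range_succ, pow_add, numConfigs_cons,
      numConfigs_cons]
    refine Nat.mul_le_mul (ih fun i hi => h i (by omega)) ?_
    have hm : r m ^ K m ≤ 2 ^ (K m * e m) := by
      rw [mul_comm, pow_mul]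
      exact Nat.pow_le_pow_left (h m (by omega)) _
    rw [two_mul (K m * e m), pow_add]
    refine Nat.mul_le_mul hm ?_
    simpa [numConfigs, slots] using hm

/-- A bound for the binary logarithm of the number of configurations, up to a factor
`Nat.log 2 N * logLog N`. -/
def configFactor (A D : ℕ) : ℕ :=
  4 * countFactor A D + 14 * countFactor A D * (D + 2) + 8 + 14 * logFactor A D

/-- Of the bits of a digit, the `log log N` part is summed over `O(log N)` positions, and the
`levelLog` part gives `O(log N)` on each of `O(log log N)` levels. Both total `O(log N * log log
N)`. -/
theorem numConfigs_allBlocks_le {D n N μ s A : ℕ} (hN : 4 ≤ N) (hs1 : 1 ≤ s)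
    (hs : s ≤ N ^ (A + 1)) :
    numConfigs (allBlocks D n N μ s (depth D N s)) ≤
      2 ^ (configFactor A D * (Nat.log 2 N * logLog N)) := by
  set L := Nat.log 2 N with hL
  set Λ := logLog N with hΛ
  set ℓ := depth D N s with hℓ
  have hΛ1 : 1 ≤ Λ := Nat.le_add_left _ _
  have hL2 : 2 ≤ L := two_le_log hN
  have hsp := two_mul_spread_le (ℓ := ℓ) hN hs1
  set q := logLog N + 7 * levelLog N s ℓ + 2 with hq
  have hlev := numConfigs_levelBlocks_le (r := levelRadix N s) (K := levelCount D N s)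
    (e := fun i => Λ + 7 * levelLog N s i) (m := ℓ + 1) fun i _ => levelRadix_le hN hs1
  have hsum : ∑ i ∈ Finset.range (ℓ + 1), 2 * (levelCount D N s i * (Λ + 7 * levelLog N s i)) ≤
      (4 * countFactor A D + 14 * countFactor A D * (D + 2)) * (L * Λ) := by
    calc ∑ i ∈ Finset.range (ℓ + 1), 2 * (levelCount D N s i * (Λ + 7 * levelLog N s i))
        ≤ ∑ i ∈ Finset.range (ℓ + 1), (levelCount D N s i * (2 * Λ) + 14 * (countFactor A D * L)) := by
          refine Finset.sum_le_sum fun i hi => ?_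
          have := levelCount_mul_le (D := D) hN hs (Nat.lt_succ_iff.1 (Finset.mem_range.1 hi))
          rw [← hL] at this
          nlinarith
      _ = (∑ i ∈ Finset.range (ℓ + 1), levelCount D N s i) * (2 * Λ) +
          (ℓ + 1) * (14 * (countFactor A D * L)) := by
          rw [Finset.sum_add_distrib, Finset.sum_mul, Finset.sum_const, Finset.card_range,
            smul_eq_mul]
      _ ≤ (2 * (countFactor A D * L)) * (2 * Λ) +
          ((D + 2) * Λ) * (14 * (countFactor A D * L)) := by
          refine Nat.add_le_add (Nat.mul_le_mul_right _ (sum_levelCount_le hN hs))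
            (Nat.mul_le_mul_right _ ?_)
          have h1 : ℓ ≤ D + Nat.log 2 L + 1 := depth_le
          have h2 : Λ = Nat.log 2 L + 1 := rfl
          nlinarith
      _ = _ := by ring
  have htail : 2 * (q + 1) ≤ (8 + 14 * logFactor A D) * (L * Λ) := by
    have h1 : levelLog N s ℓ ≤ logFactor A D * L := levelLog_depth_le hN hs
    have h2 : L ≤ L * Λ := Nat.le_mul_of_pos_right _ hΛ1
    have h3 : logFactor A D * L ≤ logFactor A D * (L * Λ) := Nat.mul_le_mul_left _ h2
    have h4 : 2 * Λ ≤ L * Λ := Nat.mul_le_mul_right _ hL2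
    have e : (8 + 14 * logFactor A D) * (L * Λ) = 8 * (L * Λ) + 14 * (logFactor A D * (L * Λ)) := by
      ring
    omega
  rw [allBlocks, blocks_eq, numConfigs_append]
  refine (Nat.mul_le_mul hlev (show _ ≤ 2 ^ (2 * (q + 1)) from ?_)).trans ?_
  · rw [numConfigs_eq]
    simp only [List.map_cons, List.map_nil, List.prod_cons, List.prod_nil, pow_one, mul_one]
    calc 2 * (2 * ((2 * spread N s ℓ + 1) * (2 * spread N s ℓ + 1)))
        ≤ 2 * (2 * (2 ^ q * 2 ^ q)) := by gcongr
      _ = 2 ^ (2 * (q + 1)) := by rw [pow_mul', pow_succ]; ring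
  · rw [← pow_add]
    refine Nat.pow_le_pow_right (by norm_num) ?_
    rw [configFactor, add_assoc _ 8, add_mul _ (8 + _)]
    exact Nat.add_le_add hsum htail

/-- For the running time: it makes the number of positions, and so the cost of one configuration, at
most logarithmic in the size of the output set. -/
theorem two_pow_length_le {bs : List Block} (h : ∀ b ∈ bs, 2 ≤ b.radix) :
    2 ^ (slots bs).length ≤ numConfigs bs := by
  induction bs with
  | nil => simp [slots, numConfigs]
  | cons b bs ih =>
    rw [numConfigs_cons, length_slots, List.map_cons, List.sum_cons, pow_add, ← length_slots]
    exact Nat.mul_le_mul (Nat.pow_le_pow_left (h b (by simp)) _) (ih fun b hb => h b (by simp [hb]))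

theorem two_le_radix {D n N μ s ℓ : ℕ} {c : Block} (hc : c ∈ allBlocks D n N μ s ℓ) :
    2 ≤ c.radix := by
  rw [allBlocks, blocks_eq, List.mem_append] at hc
  rcases hc with hc | hc
  · obtain ⟨i, -, hc⟩ := List.mem_flatMap.1 hc
    simp only [List.mem_cons, List.not_mem_nil, or_false] at hc
    rcases hc with rfl | rfl <;> simp [levelRadix]
  · simp only [List.mem_cons, List.not_mem_nil, or_false] at hc
    rcases hc with rfl | rfl | rfl | rfl <;> simp [spread] <;> omega

theorem length_lt_numConfigs (D n N μ s ℓ : ℕ) :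
    (slots (allBlocks D n N μ s ℓ)).length < numConfigs (allBlocks D n N μ s ℓ) :=
  Nat.lt_two_pow_self.trans_le (two_pow_length_le fun _ => two_le_radix)

theorem depth_lt_length {D n N μ s ℓ : ℕ} :
    ℓ + 1 ≤ (slots (allBlocks D n N μ s ℓ)).length := by
  rw [allBlocks, length_slots_blocks]
  calc ℓ + 1 = ∑ _i ∈ Finset.range (ℓ + 1), 1 := by simp
    _ ≤ ∑ i ∈ Finset.range (ℓ + 1), 2 * levelCount D N s i :=
      Finset.sum_le_sum fun i _ => by simp only [levelCount]; omega
    _ ≤ _ := Nat.le_add_right _ _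

theorem levelLog_lt_numConfigs {D n N μ s ℓ : ℕ} (hs : 1 ≤ s) :
    levelLog N s ℓ < numConfigs (allBlocks D n N μ s ℓ) := by
  have h1 := levelLog_lt N s ℓ
  have h2 : levelBase N s ^ 2 ^ ℓ ≤ 2 * spread N s ℓ + 1 := by
    rw [spread]
    nlinarith [Nat.zero_le (levelBase N s ^ 2 ^ ℓ)]
  have h3 : 2 * spread N s ℓ + 1 ≤ numConfigs (allBlocks D n N μ s ℓ) := by
    have hlev : 1 ≤ numConfigs (levelBlocks (levelRadix N s) (levelCount D N s) (ℓ + 1)) := by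
      refine Nat.one_le_two_pow.trans (two_pow_length_le fun b hb => ?_)
      exact two_le_radix (c := b) (D := D) (n := n) (N := N) (μ := μ) (s := s) (ℓ := ℓ)
        (by rw [allBlocks, blocks_eq]; exact List.mem_append_left _ hb)
    rw [allBlocks, blocks_eq, numConfigs_append]
    refine le_trans ?_ (Nat.mul_le_mul_right _ hlev)
    rw [numConfigs_eq]
    simp only [List.map_cons, List.map_nil, List.prod_cons, List.prod_nil, pow_one, mul_one]
    nlinarith [Nat.zero_le (spread N s ℓ)]
  omega

/-- Every quantity on the left is below the number of configurations, and `277 = 5 + 5 + (28 + 27) +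
(60 + 22) + 130`. -/
theorem time_le {D n N μ s ℓ : ℕ} (hs : 1 ≤ s) (hD : 1 ≤ D)
    (hle : D * Nat.log 2 N ≤ levelLog N s ℓ) :
    5 * Nat.log 2 N + 5 * levelLog N s ℓ +
        (ℓ + 1) * (28 * (slots (allBlocks D n N μ s ℓ)).length + 27) +
        numConfigs (allBlocks D n N μ s ℓ) * (60 * (slots (allBlocks D n N μ s ℓ)).length + 22) +
        130 ≤ 277 * numConfigs (allBlocks D n N μ s ℓ) ^ 2 := by
  have h1 := levelLog_lt_numConfigs (D := D) (n := n) (N := N) (μ := μ) (ℓ := ℓ) hs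
  have h2 := length_lt_numConfigs D n N μ s ℓ
  have h3 : ℓ + 1 ≤ _ := depth_lt_length (D := D) (n := n) (N := N) (μ := μ) (s := s)
  have h4 : Nat.log 2 N ≤ D * Nat.log 2 N := Nat.le_mul_of_pos_left _ hD
  generalize numConfigs (allBlocks D n N μ s ℓ) = M at *
  generalize (slots (allBlocks D n N μ s ℓ)).length = m at *
  have h5 : (ℓ + 1) * (28 * m + 27) ≤ M * (28 * M + 27) := Nat.mul_le_mul (by omega) (by omega)
  have h6 : M * (60 * m + 22) ≤ M * (60 * M + 22) := Nat.mul_le_mul_left _ (by omega)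
  have h7 : M ≤ M ^ 2 := Nat.le_self_pow (by norm_num) M
  have h8 : 1 ≤ M ^ 2 := by nlinarith
  nlinarith

end PoissonBinomial

namespace PoissonBinomial

/-! ### Word size -/

theorem lt_pow_of_le_mul {q a c e k : ℕ} (hq : 2 ≤ q) (ha : a ≤ c * q ^ e) (hk : c + e ≤ k) :
    a < q ^ k := by
  have h1 : c < q ^ c := Nat.lt_two_pow_self.trans_le (Nat.pow_le_pow_left hq c)
  have h2 : 0 < q ^ e := by positivity
  calc a ≤ c * q ^ e := ha
    _ < q ^ c * q ^ e := Nat.mul_lt_mul_of_pos_right h1 h2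
    _ = q ^ (c + e) := (pow_add _ _ _).symm
    _ ≤ q ^ k := Nat.pow_le_pow_right (by omega) hk

theorem levelBase_pow_depth_le {D N s A : ℕ} (hN : 4 ≤ N) (hs : s ≤ N ^ (A + 1)) :
    levelBase N s ^ 2 ^ depth D N s ≤ N ^ (2 * logFactor A D) := by
  refine (levelBase_pow_le_two_pow _ _ _).trans ?_
  calc 2 ^ (2 * levelLog N s (depth D N s)) ≤ 2 ^ (Nat.log 2 N * (2 * logFactor A D)) := by
        refine Nat.pow_le_pow_right (by norm_num) ?_
        have : _ ≤ logFactor A D * Nat.log 2 N := levelLog_depth_le (D := D) hN hs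
        nlinarith
    _ = (2 ^ Nat.log 2 N) ^ (2 * logFactor A D) := pow_mul _ _ _
    _ ≤ N ^ (2 * logFactor A D) :=
        Nat.pow_le_pow_left (Nat.pow_log_le_self 2 (by omega)) _

/-- An exponent for the word size. -/
def wordFactor (A D : ℕ) : ℕ := 24 * (4 * countFactor A D + 2) + A + 2 * logFactor A D + D + 5

/-- Everything is a constant times a power of `n + N`, and the constant is absorbed into the
exponent by `lt_pow_of_le_mul`. -/
theorem word_bounds {D n N μ s A : ℕ} (hN : 4 ≤ N) (hs1 : 1 ≤ s) (hs : s ≤ N ^ (A + 1))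
    (hμ : μ ≤ n + s) :
    n < (n + N) ^ wordFactor A D ∧ N < (n + N) ^ wordFactor A D ∧ μ < (n + N) ^ wordFactor A D ∧
    D * Nat.log 2 N < (n + N) ^ wordFactor A D ∧
    5 * (slots (allBlocks D n N μ s (depth D N s))).length + 10 < (n + N) ^ wordFactor A D ∧
    ((slots (allBlocks D n N μ s (depth D N s))).map fun σ => σ.radix + σ.base).sum <
      (n + N) ^ wordFactor A D := by
  set ℓ := depth D N s with hℓ
  set q := n + N with hq
  have hq4 : 4 ≤ q := by omega
  have hlog : Nat.log 2 N ≤ q := (Nat.log_le_self 2 N).trans (by omega)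
  have hlen := length_slots_allBlocks_le (D := D) (n := n) (μ := μ) hN hs
  have hlenq : (slots (allBlocks D n N μ s ℓ)).length ≤ (4 * countFactor A D + 2) * q :=
    hlen.trans (Nat.mul_le_mul_left _ hlog)
  set e := A + 1 + 2 * logFactor A D with he
  have hsq : s ≤ q ^ (A + 1) := hs.trans (Nat.pow_le_pow_left (by omega) _)
  have hse : s ≤ q ^ e := hsq.trans (Nat.pow_le_pow_right (by omega) (by omega))
  have hqe : q ≤ q ^ e := Nat.le_self_pow (by omega) q
  have hz : s * levelBase N s ^ 2 ^ ℓ ≤ q ^ e := by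
    rw [he, pow_add]
    exact Nat.mul_le_mul hsq ((levelBase_pow_depth_le hN hs).trans
      (Nat.pow_le_pow_left (by omega) _))
  have hzi : ∀ i ≤ ℓ, s * levelBase N s ^ 2 ^ i ≤ q ^ e := fun i hi =>
    (Nat.mul_le_mul_left _ (Nat.pow_le_pow_right (by simp [levelBase])
      (Nat.pow_le_pow_right (by norm_num) hi))).trans hz
  have hsb := one_le_mul_levelBase_pow (N := N) hs1
  have hW : 24 * (4 * countFactor A D + 2) + A + 2 * logFactor A D + D + 5 = wordFactor A D := rfl
  have hσ : ∀ σ ∈ slots (allBlocks D n N μ s ℓ), σ.radix + σ.base ≤ 24 * q ^ e := by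
    intro σ hσ
    obtain ⟨c, hc, hσ⟩ := List.mem_flatMap.1 hσ
    obtain ⟨t, -, rfl⟩ := List.mem_map.1 hσ
    have h1 : (c.slot t).radix + (c.slot t).base ≤ c.radix + c.base := by
      simp only [Block.slot]; split_ifs <;> omega
    refine h1.trans ?_
    -- With `x = s * levelBase ^ 2 ^ ℓ ≥ 4`, the left side is `16 * x + 17 ≤ 21 * x`. The bases add
    -- at most `2 * q ^ e`, as `μ ≤ n + s`.
    have hspread : 2 * spread N s ℓ + 1 ≤ 21 * q ^ e := by
      have := hsb ℓ
      rw [spread, mul_assoc]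
      omega
    rw [allBlocks, blocks_eq, List.mem_append] at hc
    rcases hc with hc | hc
    · obtain ⟨i, hi, hc⟩ := List.mem_flatMap.1 hc
      have h2 := hzi i (Nat.lt_succ_iff.1 (List.mem_range.1 hi))
      have h3 := hsb i
      simp only [List.mem_cons, List.not_mem_nil, or_false] at hc
      rcases hc with rfl | rfl <;> simp only [levelRadix, mul_assoc] <;> omega
    · simp only [List.mem_cons, List.not_mem_nil, or_false] at hc
      rcases hc with rfl | rfl | rfl | rfl <;> simp only <;> omega
  refine ⟨?_, ?_, ?_, ?_, ?_, ?_⟩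
  · exact lt_pow_of_le_mul (c := 1) (e := 1) (by omega) (by rw [pow_one]; omega) (by omega)
  · exact lt_pow_of_le_mul (c := 1) (e := 1) (by omega) (by rw [pow_one]; omega) (by omega)
  · exact lt_pow_of_le_mul (c := 2) (e := e) (by omega) (by omega) (by omega)
  · exact lt_pow_of_le_mul (c := D) (e := 1) (by omega) (by rw [pow_one]; gcongr) (by omega)
  · refine lt_pow_of_le_mul (c := 5 * (4 * countFactor A D + 2) + 10) (e := 1) (by omega) ?_
      (by omega)
    rw [pow_one, add_mul, mul_assoc]
    omega
  · refine lt_pow_of_le_mul (c := 24 * (4 * countFactor A D + 2)) (e := e + 1) (by omega) ?_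
      (by omega)
    refine (List.sum_le_card_nsmul _ (24 * q ^ e) fun y hy => ?_).trans ?_
    · obtain ⟨σ, h, rfl⟩ := List.mem_map.1 hy
      exact hσ σ h
    · rw [List.length_map, smul_eq_mul]
      calc _ ≤ (4 * countFactor A D + 2) * q * (24 * q ^ e) := Nat.mul_le_mul_right _ hlenq
        _ = _ := by ring

/-! ### Real estimates -/

variable {ε V : ℝ}

theorem four_le_ceil (h0 : 0 < ε) (h1 : ε ≤ 1 / 4) : 4 ≤ ⌈1 / ε⌉₊ := by
  have h : (4 : ℝ) ≤ 1 / ε := by rw [le_div_iff₀ h0]; linarith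
  exact_mod_cast h.trans (Nat.le_ceil _)

theorem ceil_le_sq (h0 : 0 < ε) (h1 : ε ≤ 1 / 4) : (⌈1 / ε⌉₊ : ℝ) ≤ (1 / ε) ^ 2 := by
  have h : (4 : ℝ) ≤ 1 / ε := by rw [le_div_iff₀ h0]; linarith
  have := Nat.ceil_lt_add_one (by positivity : 0 ≤ 1 / ε)
  nlinarith

theorem log_ceil_le (h0 : 0 < ε) (h1 : ε ≤ 1 / 4) :
    (Nat.log 2 ⌈1 / ε⌉₊ : ℝ) ≤ 3 * Real.log (1 / ε) := by
  have hN := four_le_ceil h0 h1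
  have h2 : ((2 ^ Nat.log 2 ⌈1 / ε⌉₊ : ℕ) : ℝ) ≤ (1 / ε) ^ 2 :=
    (Nat.cast_le.2 (Nat.pow_log_le_self 2 (by omega))).trans (ceil_le_sq h0 h1)
  push_cast at h2
  have h3 := Real.log_le_log (by positivity) h2
  rw [Real.log_pow, Real.log_pow] at h3
  have h4 := Real.log_two_gt_d9
  have h5 : (0 : ℝ) ≤ Nat.log 2 ⌈1 / ε⌉₊ := Nat.cast_nonneg _
  push_cast at h3
  nlinarith

theorem log_inv_le (h0 : 0 < ε) (h1 : ε ≤ 1 / 4) :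
    Real.log (1 / ε) ≤ 2 * Nat.log 2 ⌈1 / ε⌉₊ := by
  have hL := two_le_log (four_le_ceil h0 h1)
  have h2 : 1 / ε ≤ ((2 ^ (Nat.log 2 ⌈1 / ε⌉₊ + 1) : ℕ) : ℝ) :=
    (Nat.le_ceil _).trans (Nat.cast_le.2 (Nat.lt_pow_succ_log_self (by norm_num) _).le)
  push_cast at h2
  have h3 := Real.log_le_log (by positivity) h2
  rw [Real.log_pow] at h3
  have h4 := Real.log_two_lt_d9
  have h5 : (2 : ℝ) ≤ Nat.log 2 ⌈1 / ε⌉₊ := by exact_mod_cast hL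
  push_cast at h3
  nlinarith

theorem inv_le_two_pow (h0 : 0 < ε) (h1 : ε ≤ 1 / 4) :
    1 / ε ≤ 2 ^ (2 * Nat.log 2 ⌈1 / ε⌉₊) := by
  have hL := two_le_log (four_le_ceil h0 h1)
  have h2 : 1 / ε ≤ ((2 ^ (Nat.log 2 ⌈1 / ε⌉₊ + 1) : ℕ) : ℝ) :=
    (Nat.le_ceil _).trans (Nat.cast_le.2 (Nat.lt_pow_succ_log_self (by norm_num) _).le)
  push_cast at h2
  exact h2.trans (pow_le_pow_right₀ (by norm_num) (by omega))

theorem log_four_le (h0 : 0 < ε) (h1 : ε ≤ 1 / 4) : 1.386 ≤ Real.log (1 / ε) := by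
  have h : (4 : ℝ) ≤ 1 / ε := by rw [le_div_iff₀ h0]; linarith
  have h2 := Real.log_le_log (by norm_num) h
  rw [show (4 : ℝ) = 2 ^ 2 by norm_num, Real.log_pow] at h2
  have := Real.log_two_gt_d9
  push_cast at h2
  linarith

theorem logLog_le (h0 : 0 < ε) (h1 : ε ≤ 1 / 4) :
    (logLog ⌈1 / ε⌉₊ : ℝ) ≤ 11 * Real.log (Real.log (1 / ε)) := by
  have hL := two_le_log (four_le_ceil h0 h1)
  have hx := log_four_le h0 h1
  have h3 := log_ceil_le h0 h1
  set x := Real.log (1 / ε) with hxdef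
  -- The constant `6` is absorbed into `x ^ 6`, as `x` is at least about `log 4`. Afterwards `7 /
  -- log 2 < 11`.
  have h2 : ((2 ^ logLog ⌈1 / ε⌉₊ : ℕ) : ℝ) ≤ x ^ 7 := by
    have h4 : 2 ^ logLog ⌈1 / ε⌉₊ ≤ 2 * Nat.log 2 ⌈1 / ε⌉₊ := by
      rw [logLog, pow_succ, mul_comm]
      exact Nat.mul_le_mul_left _ (Nat.pow_log_le_self 2 (by omega))
    have h5 : ((2 ^ logLog ⌈1 / ε⌉₊ : ℕ) : ℝ) ≤ 2 * Nat.log 2 ⌈1 / ε⌉₊ := by exact_mod_cast h4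
    have h6 : (6 : ℝ) ≤ x ^ 6 :=
      le_trans (by norm_num) (pow_le_pow_left₀ (by norm_num) hx 6)
    calc _ ≤ 6 * x := by linarith
      _ ≤ x ^ 6 * x := by gcongr
      _ = x ^ 7 := (pow_succ _ _).symm
  push_cast at h2
  have h4 := Real.log_le_log (by positivity) h2
  rw [Real.log_pow, Real.log_pow] at h4
  have h5 := Real.log_two_gt_d9
  have h6 : (0 : ℝ) ≤ logLog ⌈1 / ε⌉₊ := Nat.cast_nonneg _
  have h7 : 0 ≤ Real.log x := Real.log_nonneg (by linarith)
  push_cast at h4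
  nlinarith

end PoissonBinomial

namespace PoissonBinomial

variable {ε V : ℝ} {s : ℕ}

/-! ### The interval lengths and their integer estimates -/

/-- Up to constants `s` is `V + 1` and `V * R ^ 2 ≤ log (1/ε)`, so `R ^ 2` times the base is
bounded; two further factors `R ≤ 1/4` absorb the constants. -/
theorem levelBase_mul_R (h0 : 0 < ε) (h1 : ε ≤ 1 / 4) (hV : 0 ≤ V) (hs : (s : ℝ) ≤ 2 * (V + 1)) :
    levelBase ⌈1 / ε⌉₊ s * R ε V ^ 4 ≤ 1 := by
  have hx := log_inv_pos h0 h1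
  have hxL := log_inv_le h0 h1
  have hR := R_pos h0 h1 hV
  have hR4 := R_le (ε := ε) (V := V)
  have hVR := mul_R_sq_le h0 h1 hV
  set x := Real.log (1 / ε) with hxdef
  set L := Nat.log 2 ⌈1 / ε⌉₊ with hL
  have hLpos : (0 : ℝ) < L := by linarith
  have hu : R ε V ^ 2 ≤ 1 / 16 := by nlinarith
  have hu0 : 0 < R ε V ^ 2 := by positivity
  set u := R ε V ^ 2 with hudef
  have h4 : R ε V ^ 4 = u ^ 2 := by rw [hudef, ← pow_mul]
  have hb : (levelBase ⌈1 / ε⌉₊ s : ℝ) ≤ 4 + s / L := by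
    rw [levelBase]
    push_cast
    gcongr
    exact Nat.cast_div_le
  have hsL : (s : ℝ) / L * u ≤ 4 + 4 * u := by
    rw [div_mul_eq_mul_div, div_le_iff₀ hLpos]
    nlinarith
  rw [h4]
  calc (levelBase ⌈1 / ε⌉₊ s : ℝ) * u ^ 2 ≤ (4 + s / L) * u ^ 2 := by gcongr
    _ = (4 * u + s / L * u) * u := by ring
    _ ≤ (4 * u + (4 + 4 * u)) * u := by gcongr
    _ ≤ 1 := by nlinarith

/-- If `R = 1/4`, the summand `4` of the base suffices. Otherwise `V * R ^ 2 = log (1/ε)`, and `V`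
is at most `b ^ 2 * log (1/ε)` because `6 * (b - 3) ≤ b ^ 2`. -/
theorem one_le_levelBase_mul_R (h0 : 0 < ε) (h1 : ε ≤ 1 / 4) (hV : 0 ≤ V)
    (hs : (V + 1) / 2 ≤ s) : 1 ≤ levelBase ⌈1 / ε⌉₊ s * R ε V := by
  have hR := R_pos h0 h1 hV
  have hb4 : (4 : ℝ) ≤ levelBase ⌈1 / ε⌉₊ s := by
    exact_mod_cast (Nat.le_add_right 4 _ : 4 ≤ levelBase ⌈1 / ε⌉₊ s)
  rcases (R_le (ε := ε) (V := V)).lt_or_eq with h | h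
  swap
  · rw [h]; linarith
  have hx := log_inv_pos h0 h1
  have hLx := log_ceil_le h0 h1
  have hVR := mul_R_sq_eq h0 h1 hV h
  set x := Real.log (1 / ε) with hxdef
  set L := Nat.log 2 ⌈1 / ε⌉₊ with hL
  have hL2 : (2 : ℝ) ≤ L := by exact_mod_cast two_le_log (four_le_ceil h0 h1)
  set b := levelBase ⌈1 / ε⌉₊ s with hb
  have hsL : (s : ℝ) ≤ L * (b - 3) := by
    have := Nat.lt_mul_div_succ s (by exact_mod_cast (by linarith : (0 : ℝ) < L) : 0 < L)
    have e : (b : ℝ) - 3 = ((s / L : ℕ) : ℝ) + 1 := by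
      rw [hb, levelBase, hL]; push_cast; ring
    rw [e]
    exact_mod_cast this.le
  have hVb : V ≤ x * b ^ 2 := by
    have h2 : (L : ℝ) * (b - 3) ≤ 3 * x * (b - 3) :=
      mul_le_mul_of_nonneg_right hLx (by linarith)
    nlinarith [mul_nonneg (by linarith : 0 ≤ x) (sq_nonneg ((b : ℝ) - 3))]
  by_contra hlt
  rw [not_le] at hlt
  have h3 : 0 ≤ (b : ℝ) * R ε V := by positivity
  have h4 : ((b : ℝ) * R ε V) ^ 2 < 1 := by nlinarith
  have h5 : V * R ε V ^ 2 ≤ x * ((b : ℝ) * R ε V) ^ 2 := by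
    rw [mul_pow, ← mul_assoc]
    gcongr
  nlinarith

theorem levelBase_pow_mul_B (h0 : 0 < ε) (h1 : ε ≤ 1 / 4) (hV : 0 ≤ V)
    (hs : (s : ℝ) ≤ 2 * (V + 1)) (i : ℕ) :
    (levelBase ⌈1 / ε⌉₊ s : ℝ) ^ 2 ^ i * B ε V i ^ 4 ≤ 1 := by
  have hR := R_pos h0 h1 hV
  rw [B, pow_right_comm, ← mul_pow]
  exact pow_le_one₀ (by positivity) (levelBase_mul_R h0 h1 hV hs)

theorem one_le_levelBase_pow_mul_B (h0 : 0 < ε) (h1 : ε ≤ 1 / 4) (hV : 0 ≤ V)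
    (hs : (V + 1) / 2 ≤ s) (i : ℕ) : 1 ≤ (levelBase ⌈1 / ε⌉₊ s : ℝ) ^ 2 ^ i * B ε V i := by
  rw [B, ← mul_pow]
  exact one_le_pow₀ (one_le_levelBase_mul_R h0 h1 hV hs)

/-- Here `B i ≤ 2 ^ (-levelLog / 4)` and `1/ε ≤ 2 ^ (2 * log₂ N)`; the product of `4` and `2` is the
factor `8`. -/
theorem B_pow_le (h0 : 0 < ε) (h1 : ε ≤ 1 / 4) (hV : 0 ≤ V) (hs : (s : ℝ) ≤ 2 * (V + 1))
    {i k E : ℕ} (h : 8 * E * Nat.log 2 ⌈1 / ε⌉₊ ≤ k * levelLog ⌈1 / ε⌉₊ s i) :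
    B ε V i ^ k ≤ ε ^ E := by
  have hB := B_pos h0 h1 hV i
  have h2 : ((2 ^ levelLog ⌈1 / ε⌉₊ s i : ℕ) : ℝ) ≤ (levelBase ⌈1 / ε⌉₊ s : ℝ) ^ 2 ^ i := by
    exact_mod_cast two_pow_levelLog_le _ _ _
  push_cast at h2
  have h3 : (2 : ℝ) ^ levelLog ⌈1 / ε⌉₊ s i * B ε V i ^ 4 ≤ 1 :=
    (mul_le_mul_of_nonneg_right h2 (by positivity)).trans (levelBase_pow_mul_B h0 h1 hV hs i)
  have h4 : (2 : ℝ) ^ (8 * E * Nat.log 2 ⌈1 / ε⌉₊) * (B ε V i ^ k) ^ 4 ≤ 1 := by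
    calc _ ≤ (2 : ℝ) ^ (k * levelLog ⌈1 / ε⌉₊ s i) * (B ε V i ^ k) ^ 4 := by
          gcongr
          norm_num
      _ = ((2 : ℝ) ^ levelLog ⌈1 / ε⌉₊ s i * B ε V i ^ 4) ^ k := by
          ring
      _ ≤ 1 := pow_le_one₀ (by positivity) h3
  have h5 : ((1 / ε) ^ E * B ε V i ^ k) ^ 4 ≤ 1 := by
    refine le_trans ?_ h4
    rw [mul_pow]
    gcongr
    calc ((1 / ε) ^ E) ^ 4 = (1 / ε) ^ (4 * E) := by rw [← pow_mul, mul_comm]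
      _ ≤ (2 ^ (2 * Nat.log 2 ⌈1 / ε⌉₊)) ^ (4 * E) := by
          gcongr
          exact inv_le_two_pow h0 h1
      _ = 2 ^ (8 * E * Nat.log 2 ⌈1 / ε⌉₊) := by rw [← pow_mul]; ring_nf
  have h6 : (1 / ε) ^ E * B ε V i ^ k ≤ 1 := by
    by_contra hc
    exact absurd h5 (not_le.2 (one_lt_pow₀ (not_le.1 hc) (by norm_num)))
  rw [div_pow, one_pow, div_mul_eq_mul_div, one_mul, div_le_one (by positivity)] at h6
  exact h6

theorem estimate_le_pow {A : ℕ} (h0 : 0 < ε) (h1 : ε ≤ 1 / 4) (hVA : V ≤ (1 / ε) ^ A)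
    (hs : (s : ℝ) ≤ 2 * (V + 1)) : s ≤ ⌈1 / ε⌉₊ ^ (A + 1) := by
  have hN : (4 : ℝ) ≤ ⌈1 / ε⌉₊ := by exact_mod_cast four_le_ceil h0 h1
  have h2 : V ≤ (⌈1 / ε⌉₊ : ℝ) ^ A :=
    hVA.trans (pow_le_pow_left₀ (by positivity) (Nat.le_ceil _) A)
  have h3 : 1 ≤ (⌈1 / ε⌉₊ : ℝ) ^ A := one_le_pow₀ (by linarith)
  have h4 : (s : ℝ) ≤ (⌈1 / ε⌉₊ : ℝ) ^ (A + 1) := by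
    rw [pow_succ]
    nlinarith
  exact_mod_cast h4

theorem inv_B_depth_le {A D : ℕ} (h0 : 0 < ε) (h1 : ε ≤ 1 / 4) (hV : 0 ≤ V)
    (hVA : V ≤ (1 / ε) ^ A) (hs : (V + 1) / 2 ≤ s) (hs' : (s : ℝ) ≤ 2 * (V + 1)) :
    1 / B ε V (depth D ⌈1 / ε⌉₊ s) ≤ (1 / ε) ^ (4 * logFactor A D) := by
  have hB := B_pos h0 h1 hV (depth D ⌈1 / ε⌉₊ s)
  rw [div_le_iff₀ hB]
  refine (one_le_levelBase_pow_mul_B h0 h1 hV hs (depth D ⌈1 / ε⌉₊ s)).trans ?_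
  gcongr
  have h := levelBase_pow_depth_le (D := D) (four_le_ceil h0 h1) (estimate_le_pow h0 h1 hVA hs')
  calc (levelBase ⌈1 / ε⌉₊ s : ℝ) ^ 2 ^ depth D ⌈1 / ε⌉₊ s
      ≤ (⌈1 / ε⌉₊ : ℝ) ^ (2 * logFactor A D) := by exact_mod_cast h
    _ ≤ ((1 / ε) ^ 2) ^ (2 * logFactor A D) := by
        gcongr
        exact ceil_le_sq h0 h1
    _ = _ := by rw [← pow_mul]; ring_nf

theorem levelCount_le {A D i : ℕ} (h0 : 0 < ε) (h1 : ε ≤ 1 / 4) (hV : 0 ≤ V)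
    (hVA : V ≤ (1 / ε) ^ A) (hs : (V + 1) / 2 ≤ s) (hs' : (s : ℝ) ≤ 2 * (V + 1))
    (hi : i ≤ depth D ⌈1 / ε⌉₊ s) :
    (levelCount D ⌈1 / ε⌉₊ s i : ℝ) ≤
      6 * countFactor A D * (Real.log (1 / ε) / Real.log (1 / B ε V i)) := by
  have hB := B_pos h0 h1 hV i
  have hB4 := B_le h0 h1 hV i
  have hlog : 0 < Real.log (1 / B ε V i) := by
    refine Real.log_pos ?_
    rw [lt_div_iff₀ hB]
    linarith
  have h2 : Real.log (1 / B ε V i) ≤ 2 * levelLog ⌈1 / ε⌉₊ s i := by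
    have h3 : 1 / B ε V i ≤ (2 : ℝ) ^ (2 * levelLog ⌈1 / ε⌉₊ s i) := by
      rw [div_le_iff₀ hB]
      refine (one_le_levelBase_pow_mul_B h0 h1 hV hs i).trans ?_
      gcongr
      exact_mod_cast levelBase_pow_le_two_pow _ _ _
    have h4 := Real.log_le_log (by positivity) h3
    rw [Real.log_pow] at h4
    have h5 := Real.log_two_lt_d9
    push_cast at h4
    nlinarith [(Nat.cast_nonneg (levelLog ⌈1 / ε⌉₊ s i) : (0 : ℝ) ≤ _)]
  have h6 : (levelCount D ⌈1 / ε⌉₊ s i : ℝ) * levelLog ⌈1 / ε⌉₊ s i ≤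
      countFactor A D * Nat.log 2 ⌈1 / ε⌉₊ := by
    exact_mod_cast levelCount_mul_le (four_le_ceil h0 h1) (estimate_le_pow h0 h1 hVA hs') hi
  have h7 := log_ceil_le h0 h1
  rw [← mul_div_assoc, le_div_iff₀ hlog]
  calc (levelCount D ⌈1 / ε⌉₊ s i : ℝ) * Real.log (1 / B ε V i)
      ≤ levelCount D ⌈1 / ε⌉₊ s i * (2 * levelLog ⌈1 / ε⌉₊ s i) := by gcongr
    _ ≤ 2 * (countFactor A D * Nat.log 2 ⌈1 / ε⌉₊) := by linarith
    _ ≤ 2 * (countFactor A D * (3 * Real.log (1 / ε))) := by gcongr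
    _ = _ := by ring

theorem isDepth_depth {A D C : ℕ} (h0 : 0 < ε) (h1 : ε ≤ 1 / 4) (hV : 0 ≤ V)
    (hVA : V ≤ (1 / ε) ^ A) (hs : (V + 1) / 2 ≤ s) (hs' : (s : ℝ) ≤ 2 * (V + 1)) (hD : 8 ≤ D)
    (hC : 11 * (D + 1) ≤ C) (hC' : 4 * logFactor A D ≤ C) :
    IsDepth C ε V (depth D ⌈1 / ε⌉₊ s) := by
  have hε1 : 1 ≤ 1 / ε := by rw [le_div_iff₀ h0]; linarith
  have hB := B_pos h0 h1 hV (depth D ⌈1 / ε⌉₊ s)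
  refine ⟨?_, ?_, ?_⟩
  · have h2 : depth D ⌈1 / ε⌉₊ s ≤ (D + 1) * logLog ⌈1 / ε⌉₊ := by
      have := depth_le (D := D) (N := ⌈1 / ε⌉₊) (s := s)
      rw [logLog]
      nlinarith
    have h3 := logLog_le h0 h1
    have h5 : 0 ≤ Real.log (Real.log (1 / ε)) := Real.log_nonneg (log_inv_pos h0 h1).le
    calc (depth D ⌈1 / ε⌉₊ s : ℝ) ≤ (D + 1 : ℝ) * logLog ⌈1 / ε⌉₊ := by exact_mod_cast h2
      _ ≤ (D + 1) * (11 * Real.log (Real.log (1 / ε))) := by gcongr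
      _ = ((11 * (D + 1) : ℕ) : ℝ) * Real.log (Real.log (1 / ε)) := by push_cast; ring
      _ ≤ C * Real.log (Real.log (1 / ε)) := by gcongr
  · have h2 := (inv_B_depth_le (D := D) h0 h1 hV hVA hs hs').trans (pow_le_pow_right₀ hε1 hC')
    rw [div_pow, one_pow] at h2
    exact (one_div_le_one_div hB (by positivity)).1 h2
  · have h2 := B_pow_le (E := 1) (k := 1) (i := depth D ⌈1 / ε⌉₊ s) h0 h1 hV hs' ?_
    · simpa using h2
    · have := le_levelLog_depth D ⌈1 / ε⌉₊ s
      nlinarith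

theorem numConfigs_le_rpow {A D n μ C : ℕ} (h0 : 0 < ε) (h1 : ε ≤ 1 / 4)
    (hVA : V ≤ (1 / ε) ^ A) (hs1 : 1 ≤ s) (hs' : (s : ℝ) ≤ 2 * (V + 1))
    (hC : 33 * configFactor A D ≤ C) :
    (numConfigs (allBlocks D n ⌈1 / ε⌉₊ μ s (depth D ⌈1 / ε⌉₊ s)) : ℝ) ≤
      (1 / ε) ^ (C * Real.log (Real.log (1 / ε))) := by
  have h2 := numConfigs_allBlocks_le (D := D) (n := n) (μ := μ) (four_le_ceil h0 h1) hs1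
    (estimate_le_pow h0 h1 hVA hs')
  have h3 := log_ceil_le h0 h1
  have h4 := logLog_le h0 h1
  have hx := log_inv_pos h0 h1
  have hxx : 0 ≤ Real.log (Real.log (1 / ε)) := Real.log_nonneg hx.le
  rw [Real.rpow_def_of_pos (by positivity)]
  refine (Nat.cast_le.2 h2).trans ?_
  push_cast
  rw [← Real.exp_log (by norm_num : (0 : ℝ) < 2), ← Real.exp_nat_mul]
  refine Real.exp_le_exp.2 ?_
  have h5 := Real.log_two_lt_d9
  push_cast
  calc (configFactor A D : ℝ) * (Nat.log 2 ⌈1 / ε⌉₊ * logLog ⌈1 / ε⌉₊) * Real.log 2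
      ≤ (configFactor A D : ℝ) * ((3 * Real.log (1 / ε)) * (11 * Real.log (Real.log (1 / ε)))) * 1 := by
        gcongr
        linarith
    _ = Real.log (1 / ε) * (((33 * configFactor A D : ℕ) : ℝ) * Real.log (Real.log (1 / ε))) := by
        push_cast; ring
    _ ≤ _ := by gcongr

end PoissonBinomial

namespace PoissonBinomial

/-! ### The enumerated set and its properties -/

variable {n : ℕ} {p q : Fin n → unitInterval} {ε : ℝ} {s μ : ℕ}

/-- The multisets of triples that the program lists. -/
noncomputable def candidates (D n N μ s : ℕ) (ε V : ℝ) : List (Multiset (ℕ × ℝ × ℝ)) :=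
  (namedConfigs (depth D N s) (allBlocks D n N μ s (depth D N s))).map (toTriples ε V)

theorem nodup_candidates {V : ℝ} (h0 : 0 < ε) (h1 : ε ≤ 1 / 4) (hV : 0 ≤ V) (D N : ℕ) :
    (candidates D n N μ s ε V).Nodup :=
  nodup_toTriples h0 h1 hV (blocks_nodup _ _ _ _ _ _) fun _ hb =>
    mem_blocks_codes.1 (List.mem_map_of_mem hb)

theorem length_candidates (D n N : ℕ) (ε V : ℝ) :
    (candidates D n N μ s ε V).length = numConfigs (allBlocks D n N μ s (depth D N s)) := by
  simp [candidates, namedConfigs]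

/-- The number of elements of a set is close to an estimate of it. -/
theorem count_mem_window {c S P m : ℕ} {x : ℝ} {y : ℝ} (hx : (c : ℝ) ≤ x) (hx' : x ≤ c + y)
    (hS : |x - (m : ℝ)| ≤ S) (hP : S + y ≤ P) : m - P ≤ c ∧ c < m - P + (2 * P + 1) := by
  rw [abs_le] at hS
  have h1 : (m : ℝ) ≤ c + P := by linarith
  have h2 : (c : ℝ) ≤ m + P := by linarith
  have h1' : m ≤ c + P := by exact_mod_cast h1
  have h2' : c ≤ m + P := by exact_mod_cast h2
  omega

theorem isStructuredApprox_of_isGoodApprox {A D C : ℕ} (h0 : 0 < ε) (h1 : ε ≤ 1 / 4)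
    (hVA : var (pbd p) ≤ (1 / ε) ^ A) (hs : (var (pbd p) + 1) / 2 ≤ s)
    (hs' : (s : ℝ) ≤ 2 * (var (pbd p) + 1))
    (hq : IsGoodApprox ε (depth D ⌈1 / ε⌉₊ s) (fun i => levelCount D ⌈1 / ε⌉₊ s i - 2) p q)
    (hC : 6 * countFactor A D ≤ C) (hC' : A + 4 * logFactor A D + 1 ≤ C) :
    IsStructuredApprox C ε (depth D ⌈1 / ε⌉₊ s) p q := by
  have hV : 0 ≤ var (pbd p) := var_nonneg p
  have hk : ∀ i, levelCount D ⌈1 / ε⌉₊ s i - 2 + 2 = levelCount D ⌈1 / ε⌉₊ s i := fun i => by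
    simp only [levelCount]; omega
  have hdist : ∀ i ≤ depth D ⌈1 / ε⌉₊ s, (levelCount D ⌈1 / ε⌉₊ s i : ℝ) ≤
      C * (Real.log (1 / ε) / Real.log (1 / B ε (var (pbd p)) i)) := by
    intro i hi
    refine (levelCount_le h0 h1 hV hVA hs hs' hi).trans ?_
    have hB := B_pos h0 h1 hV i
    have hB4 := B_le h0 h1 hV i
    have h2 : 0 ≤ Real.log (1 / B ε (var (pbd p)) i) :=
      Real.log_nonneg (by rw [le_div_iff₀ hB]; linarith)
    have h3 := log_inv_pos h0 h1
    gcongr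
    exact_mod_cast hC
  refine ⟨hq.dTV_lt.le.trans (by nlinarith), hq.mean_eq, hq.var_ge, hq.var_le, fun i hi => ?_,
    fun i hi => ?_, hq.last_I, hq.last_J, ?_, fun i hi => numParams_I_le h0 h1 hV q hq.var_le hi,
    fun i hi => numParams_J_le h0 h1 hV q hq.var_le hi⟩
  · have h := hq.distinct_I i hi
    rw [hk] at h
    exact (Nat.cast_le.2 h).trans (hdist i hi)
  · have h := hq.distinct_J i hi
    rw [hk] at h
    exact (Nat.cast_le.2 h).trans (hdist i hi)
  · obtain ⟨h2, h3⟩ := mean_sub_ones h0 h1 hV q hq.var_le hq.last_J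
    rw [hq.mean_eq] at h2 h3
    have hε : 4 ≤ 1 / ε := by rw [le_div_iff₀ h0]; linarith
    have hB := inv_B_depth_le (D := D) h0 h1 hV hVA hs hs'
    have hVB : var (pbd p) / B ε (var (pbd p)) (depth D ⌈1 / ε⌉₊ s) + 1 ≤ (1 / ε) ^ C := by
      calc _ ≤ (1 / ε) ^ A * (1 / ε) ^ (4 * logFactor A D) + 1 := by
            have hB0 := one_div_nonneg.2 (B_pos h0 h1 hV (depth D ⌈1 / ε⌉₊ s)).le
            rw [div_eq_mul_one_div]
            gcongr
        _ ≤ (1 / ε) ^ (A + 4 * logFactor A D) * (1 / ε) := by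
            rw [← pow_add]
            nlinarith [one_le_pow₀ (by linarith : 1 ≤ 1 / ε) (n := A + 4 * logFactor A D)]
        _ = (1 / ε) ^ (A + 4 * logFactor A D + 1) := (pow_succ _ _).symm
        _ ≤ (1 / ε) ^ C := pow_le_pow_right₀ (by linarith) hC'
    rw [abs_le]
    constructor <;> linarith

/-- The integer radices and windows are large enough since `V ≤ 2 * s` and `1 / B i ≤ levelBase ^ 2
^ i`. The numbers of ones and zeros deviate from `μ` and `n - μ` by the error `s` of the estimate
and by `V / B ℓ + 1` for the other parameters. -/
theorem exists_describes_candidates {D : ℕ} (h0 : 0 < ε) (h1 : ε ≤ 1 / 4)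
    (hμ : |mean (pbd p) - μ| ≤ s) (hs1 : 1 ≤ s) (hs : (var (pbd p) + 1) / 2 ≤ s)
    (hq : IsGoodApprox ε (depth D ⌈1 / ε⌉₊ s) (fun i => levelCount D ⌈1 / ε⌉₊ s i - 2) p q) :
    ∃ S ∈ candidates D n ⌈1 / ε⌉₊ μ s ε (var (pbd p)),
      Describes ε (var (pbd p)) (depth D ⌈1 / ε⌉₊ s) S q := by
  have hV : 0 ≤ var (pbd p) := var_nonneg p
  have hk : ∀ i, levelCount D ⌈1 / ε⌉₊ s i - 2 + 2 = levelCount D ⌈1 / ε⌉₊ s i := fun i => by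
    simp only [levelCount]; omega
  have hVs : var (pbd p) ≤ 2 * s := by linarith
  have hVB : ∀ i, var (pbd p) / B ε (var (pbd p)) i ≤ 2 * s * (levelBase ⌈1 / ε⌉₊ s : ℝ) ^ 2 ^ i := by
    intro i
    have hB := B_pos h0 h1 hV i
    have h2 := one_le_levelBase_pow_mul_B h0 h1 hV hs i
    rw [div_le_iff₀ hB]
    calc var (pbd p) ≤ 2 * s * 1 := by linarith
      _ ≤ 2 * s * ((levelBase ⌈1 / ε⌉₊ s : ℝ) ^ 2 ^ i * B ε (var (pbd p)) i) := by gcongr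
      _ = _ := by ring
  have hradix : ∀ i, ∀ c : ℕ, (c : ℝ) ≤ 2 * var (pbd p) / B ε (var (pbd p)) i →
      c < levelRadix ⌈1 / ε⌉₊ s i := by
    intro i c hc
    have h2 : (c : ℝ) ≤ ((4 * s * levelBase ⌈1 / ε⌉₊ s ^ 2 ^ i : ℕ) : ℝ) := by
      push_cast
      rw [mul_div_assoc] at hc
      linarith [hVB i]
    have h3 : c ≤ 4 * s * levelBase ⌈1 / ε⌉₊ s ^ 2 ^ i := by exact_mod_cast h2
    rw [levelRadix]
    omega
  have hspread : (s : ℝ) + (var (pbd p) / B ε (var (pbd p)) (depth D ⌈1 / ε⌉₊ s) + 1) ≤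
      (spread ⌈1 / ε⌉₊ s (depth D ⌈1 / ε⌉₊ s) : ℕ) := by
    have h2 := hVB (depth D ⌈1 / ε⌉₊ s)
    have h3 : (1 : ℝ) ≤ (levelBase ⌈1 / ε⌉₊ s : ℝ) ^ 2 ^ depth D ⌈1 / ε⌉₊ s := by
      refine one_le_pow₀ ?_
      exact_mod_cast (Nat.le_add_right 4 _).trans' (by norm_num)
    rw [spread]
    push_cast
    nlinarith [(Nat.cast_nonneg s : (0 : ℝ) ≤ s)]
  have hy : 0 ≤ var (pbd p) / B ε (var (pbd p)) (depth D ⌈1 / ε⌉₊ s) + 1 := by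
    have := B_pos h0 h1 hV (depth D ⌈1 / ε⌉₊ s)
    positivity
  obtain ⟨o1, o2⟩ := mean_sub_ones h0 h1 hV q hq.var_le hq.last_J
  obtain ⟨z1, z2⟩ := sub_mean_sub_zeros h0 h1 hV q hq.var_le hq.last_I
  rw [hq.mean_eq] at o1 o2 z1 z2
  refine exists_describes_blocks q (fun i hi => ⟨?_, ?_⟩) (fun i hi => ⟨?_, ?_⟩) hq.last_I hq.last_J
    ?_ ?_
  · exact (hq.distinct_I i hi).trans (hk i).le
  · exact hradix i _ (numParams_I_le h0 h1 hV q hq.var_le hi)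
  · exact (hq.distinct_J i hi).trans (hk i).le
  · exact hradix i _ (numParams_J_le h0 h1 hV q hq.var_le hi)
  -- If `μ > n`, the computed estimate `n - μ` is truncated to `0`, but then the number of zeros is
  -- at most `n - mean ≤ μ - mean ≤ s`.
  · by_cases hn : μ ≤ n
    · refine count_mem_window z1 z2 ?_ hspread
      rw [Nat.cast_sub hn, abs_sub_comm]
      convert hμ using 2
      ring
    · have h2 : numParams q {0} ≤ s := by
        have h3 : (n : ℝ) ≤ μ := by exact_mod_cast (not_le.1 hn).le
        rw [abs_le] at hμ
        exact_mod_cast (by linarith : (numParams q {0} : ℝ) ≤ s)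
      have h3 : s ≤ spread ⌈1 / ε⌉₊ s (depth D ⌈1 / ε⌉₊ s) := by
        exact_mod_cast (by linarith :
          (s : ℝ) ≤ (spread ⌈1 / ε⌉₊ s (depth D ⌈1 / ε⌉₊ s) : ℕ))
      omega
  · exact count_mem_window o1 o2 hμ hspread

end PoissonBinomial

theorem lemma5 (A : ℕ) :
    ∃ (C : ℕ) (prog : Program),
      ∀ (n : ℕ) (p : Fin n → unitInterval) (ε : ℝ), 0 < ε → ε ≤ 1 / 4 →
        var (pbd p) ≤ (1 / ε) ^ A →
      -- integer estimates of the mean and of the variance plus one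
      ∀ μ s : ℕ, |mean (pbd p) - μ| ≤ √s →
        (var (pbd p) + 1) / 2 ≤ s → (s : ℝ) ≤ 2 * (var (pbd p) + 1) →
      ∃ (ℓ : ℕ) (M : Finset (Multiset (ℕ × ℝ × ℝ))),
        IsDepth C ε (var (pbd p)) ℓ ∧
        -- (i)
        (∀ S ∈ M, ∀ x ∈ S, ∃ J : IntervalName ℓ,
          x.2 = (J.low ε (var (pbd p)), J.high ε (var (pbd p)))) ∧
        -- (ii)
        (∀ S ∈ M, (S.card : ℝ) ≤ C * Real.log (1 / ε)) ∧
        -- (iii)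
        (∃ S ∈ M, ∃ q : Fin n → unitInterval,
          IsStructuredApprox C ε ℓ p q ∧ dTV (pbd p) (pbd q) < ε ^ 2 ∧
          Describes ε (var (pbd p)) ℓ S q) ∧
        -- (iv)
        (M.card : ℝ) ≤ (1 / ε) ^ (C * Real.log (Real.log (1 / ε))) ∧
        ∀ w : ℕ, (n + ⌈1 / ε⌉₊) ^ C ≤ 2 ^ w →
          Enumerates prog w [n, ⌈1 / ε⌉₊, μ, s] ε (var (pbd p)) ℓ M (C * M.card ^ C) := by
  obtain ⟨E, hE, happrox⟩ := exists_isGoodApprox A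
  -- `B_pow_le` turns this threshold on `levelLog` into the exponent `E` that the approximation
  -- requires.
  set D := 8 * E with hD
  set C := 11 * (D + 1) + (A + 4 * logFactor A D + 1) + 6 * countFactor A D +
    33 * configFactor A D + 3 * (4 * countFactor A D + 2) + wordFactor A D + 277 with hC
  refine ⟨C, mainProg D, ?_⟩
  intro n p ε h0 h1 hVA μ s hμ hs hs'
  have hV : 0 ≤ var (pbd p) := var_nonneg p
  have hs1 : 1 ≤ s := by
    have : (0 : ℝ) < s := by linarith
    exact_mod_cast this
  have hN := four_le_ceil h0 h1
  have hsA := estimate_le_pow h0 h1 hVA hs'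
  -- Only this weaker bound is used; the windows have length at least of order `s` anyway.
  have hμs : |mean (pbd p) - μ| ≤ s := by
    refine hμ.trans ?_
    rw [Real.sqrt_le_left (by positivity)]
    exact_mod_cast Nat.le_self_pow (by norm_num) s
  set N := ⌈1 / ε⌉₊ with hNdef
  set ℓ := depth D N s with hℓ
  set bs := allBlocks D n N μ s ℓ with hbs
  have hle : D * Nat.log 2 N ≤ levelLog N s ℓ := le_levelLog_depth D N s
  -- Two positions of each block are reserved for the end points, so the number of power sums is
  -- `levelCount - 2`.
  obtain ⟨q, hq⟩ := happrox n p ε h0 h1 hVA ℓ (fun i => levelCount D N s i - 2)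
    (fun i _ => by simp only [levelCount]; omega)
    (by simpa using B_pow_le (k := 1) h0 h1 hV hs' (by rw [one_mul]; exact hle))
    (fun i _ => B_pow_le h0 h1 hV hs' le_levelCount_mul)
  have hnodup : (candidates D n N μ s ε (var (pbd p))).Nodup := nodup_candidates h0 h1 hV D N
  have hcard : (⟨_, Multiset.coe_nodup.2 hnodup⟩ : Finset (Multiset (ℕ × ℝ × ℝ))).card =
      numConfigs bs := length_candidates D n N ε _
  have hmem : ∀ S ∈ candidates D n N μ s ε (var (pbd p)), ∃ l ∈ namedConfigs ℓ bs,
      toTriples ε (var (pbd p)) l = S := fun S hS => List.mem_map.1 hS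
  have hmean : mean (pbd p) ≤ n := by
    rw [mean_pbd]
    calc ∑ j, (p j : ℝ) ≤ ∑ _j : Fin n, (1 : ℝ) := Finset.sum_le_sum fun j _ => (p j).2.2
      _ = n := by simp
  have hμn : μ ≤ n + s := by
    rw [abs_le] at hμs
    exact_mod_cast (by linarith : (μ : ℝ) ≤ n + s)
  refine ⟨ℓ, ⟨_, Multiset.coe_nodup.2 hnodup⟩, ?_, ?_, ?_, ?_, ?_, ?_⟩
  · exact isDepth_depth h0 h1 hV hVA hs hs' (by omega) (by omega) (by omega)
  · intro S hS x hx
    obtain ⟨l, -, rfl⟩ := hmem S hS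
    obtain ⟨y, -, rfl⟩ := List.mem_map.1 hx
    exact ⟨y.2, rfl⟩
  · intro S hS
    obtain ⟨l, hl, rfl⟩ := hmem S hS
    obtain ⟨x, -, rfl⟩ := List.mem_map.1 hl
    have h2 : (config bs x).length ≤ (4 * countFactor A D + 2) * Nat.log 2 N :=
      (length_decode_le _ _ _).trans (length_slots_allBlocks_le hN hsA)
    have h3 := log_ceil_le h0 h1
    have h4 := log_inv_pos h0 h1
    simp only [toTriples, Multiset.coe_card, List.length_map]
    calc ((config bs x).length : ℝ) ≤ (4 * countFactor A D + 2 : ℕ) * Nat.log 2 N := by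
          exact_mod_cast h2
      _ ≤ (4 * countFactor A D + 2 : ℕ) * (3 * Real.log (1 / ε)) := by gcongr
      _ = (3 * (4 * countFactor A D + 2) : ℕ) * Real.log (1 / ε) := by push_cast; ring
      _ ≤ C * Real.log (1 / ε) := by
          gcongr
          omega
  · obtain ⟨S, hS, hdesc⟩ := exists_describes_candidates h0 h1 hμs hs1 hs hq
    exact ⟨S, hS, q, isStructuredApprox_of_isGoodApprox h0 h1 hVA hs hs' hq (by omega) (by omega),
      hq.dTV_lt, hdesc⟩
  · rw [hcard]
    exact numConfigs_le_rpow h0 h1 hVA hs1 hs' (by omega)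
  · intro w hw
    have hw' : (n + N) ^ wordFactor A D ≤ 2 ^ w :=
      (Nat.pow_le_pow_right (by omega) (by omega)).trans hw
    obtain ⟨b1, b2, b3, b4, b5, b6⟩ := word_bounds (D := D) hN hs1 hsA hμn
    obtain ⟨st, t, hrun, ht, hout⟩ := mainProg_ends (w := w) (n := n) hs1 (by omega)
      (fun i hi => levelLog_lt_of_lt_depth hi) hle (b1.trans_le hw') (b2.trans_le hw')
      (b3.trans_le hw') (b4.trans_le hw') (b5.trans_le hw') (b6.trans_le hw')
    refine ⟨namedConfigs ℓ bs, st, t, rfl, hrun, ?_, ?_⟩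
    · rw [hcard]
      refine ht.trans ((time_le hs1 (by omega) hle).trans ?_)
      have hM : 0 < numConfigs bs := (Nat.zero_le _).trans_lt (length_lt_numConfigs D n N μ s ℓ)
      exact Nat.mul_le_mul (by omega) (Nat.pow_le_pow_right hM (by omega))
    · rw [hout, namedConfigs, List.flatMap_map]
      congr 1
      refine List.flatMap_congr fun x _ => ?_
      rw [encode_named]
      exact fun y hy => mem_blocks_codes.1 (mem_decode hy)
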